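/- Let $l,d\ge 1$ and let $R$ be a commutative ring in which $2$ is not a zero divisor. Let $G$ be the superalgebra $(R_l[x_1,\dots,x_d]\,\hat\otimes\,R\Sigma_d)\otimes C_d$ (which the PBW theorem identifies with the associated graded algebra of a cyclotomic Sergeev superalgebra of level $l$): it is generated by the even elements $x_1,\dots,x_d$ and $w\in\Sigma_d$ and the odd elements $c_1,\dots,c_d$, subject to $x_ix_j=x_jx_i$, $x_i^l=0$, $c_i^2=1$, $c_ic_j=-c_jc_i$ for $i\ne j$, the multiplication of $\Sigma_d$, $x_ic_i=-c_ix_i$, $x_ic_j=c_jx_i$ for $i\neq j$, $wx_i=x_{w(i)}w$ and $wc_i=c_{w(i)}w$. For $A\subseteq I_d=\{1,\dots,d\}$ let $R_l[A]$ and $C[A]$ be the subalgebras generated by the $x_i$, respectively the $c_i$, with $i\in A$. Let $\mathcal C_X$ be the centralizer of $x_1,\dots,x_d$ in $G$, and $\mathcal C_{CX}$ the set of even elements of $\mathcal C_X$ that commute with $c_1,\dots,c_d$. An element $z$ is of maximal degree with respect to $A$ if $x_i^{l-1}$ divides $z$ for all $i\in A$. For a non-empty ordered set $A=\{i_1,\dots,i_a\}\subseteq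 I_d$ write $\sigma_A=(i_1\ \dots\ i_a)$ and, for $\alpha\in\mathbb Z_2^a$, $|\alpha|=\#\{j:\alpha_j=1\}$, $c_\alpha(A)=c_{i_1}^{\alpha_1}\cdots c_{i_a}^{\alpha_a}$, $\epsilon^\alpha_j=\prod_{k<j}(-1)^{\alpha_k}$; $\alpha$ is even if $|\alpha|$ is even, and then $\tau_\alpha=(-1)^{|\alpha|/2+\sum_j j\alpha_j}$. For $r\ge 0$ put $$A^{(r)}=\sum_{\alpha\text{ even}}\tau_\alpha\Big(\sum_{r_1+\dots+r_a=(a-1)(l-1)+r}(\epsilon^\alpha_1x_{i_1})^{r_1}\cdots(\epsilon^\alpha_ax_{i_a})^{r_a}\Big)\sigma_A\,c_\alpha(A).$$ This is called a CX-cycle on $A$ if $(a-1)l+r$ is even. An odd skew cycle on $A$ is an odd element of $\mathcal C_X$ of the form $f\sigma_Ac$ with $f\in R_l[A]$, $c\in C[A]$, that anticommutes with $c_1,\dots,c_d$. Let $A_1,\dots,A_m$ be pairwise disjoint non-empty ordered subsets of $I_d$, and let $U=A_1\cup\dots\cup A_m$ (ordered by concatenation). (i) Let $z=F\sigma_{A_1}\cdots\sigma_{A_m}c\in\mathcal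 C_{CX}$, where $c\in C[U]$ and $F\in R_l[I_d]$ is of maximal degree with respect to $U$. If $z\neq 0$, then $$z=P\,z_1z_2\cdots z_m,$$ where each $z_i$ is a CX-cycle on $A_i$ or an odd skew cycle on $A_i$, the number of $i$ for which it is taken to be an odd skew cycle is even, and $P$ is a polynomial over $R$ in the squares $x_j^2$ with $j\notin U$ (note that $x_j^{2k}$ is the CX-cycle $\{j\}^{(2k)}$). Moreover $P$ can be chosen such that whenever $F\in x^\nu R_l[U]$ for a monomial $x^\nu$ in the variables $x_j$, $j\notin U$, then $P$ is a scalar multiple of $x^\nu$. In particular, if $F\in R_l[U]$, then $z$ is a scalar multiple of $z_1\cdots z_m$. (ii) Let $z=\sum_{\alpha}f_\alpha\,\sigma_{A_1}\cdots\sigma_{A_m}\,c_\alpha(U)\in\mathcal C_{CX}$, the sum being over the even $\alpha\in\mathbb Z_2^{|U|}$, with $f_\alpha\in R_l[I_d]$. Suppose that no non-zero $f_\alpha$ is of maximal degree with respect to any of the $A_i$. Then $z$ is an $R$-linear combination of products of disjoint CX-cycles. -/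

import Mathlib

namespace Sergeev

/-- Generators: polynomial generators `x i`, Clifford generators `c i`, and the elements `s w`
of the symmetric group on `d` letters. -/
inductive Gen (d : ℕ) : Type
  | x (i : Fin d) : Gen d
  | c (i : Fin d) : Gen d
  | s (w : Equiv.Perm (Fin d)) : Gen d

/-- Defining relations of `(R_l[x_1, …, x_d] ⊗̂ R Σ_d) ⊗ C_d`: those of the truncated polynomial
algebra, of the Clifford algebra and of the group algebra, followed by the cross relations. -/
inductive Rel (R : Type*) [CommRing R] (l d : ℕ) :
    FreeAlgebra R (Gen d) → FreeAlgebra R (Gen d) → Prop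
  | x_comm (i j : Fin d) : Rel R l d
      (FreeAlgebra.ι R (Gen.x i) * FreeAlgebra.ι R (Gen.x j))
      (FreeAlgebra.ι R (Gen.x j) * FreeAlgebra.ι R (Gen.x i))
  | x_pow (i : Fin d) : Rel R l d (FreeAlgebra.ι R (Gen.x i) ^ l) 0
  | c_sq (i : Fin d) : Rel R l d
      (FreeAlgebra.ι R (Gen.c i) * FreeAlgebra.ι R (Gen.c i)) 1
  | c_anti (i j : Fin d) (hij : i ≠ j) : Rel R l d
      (FreeAlgebra.ι R (Gen.c i) * FreeAlgebra.ι R (Gen.c j))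
      (-(FreeAlgebra.ι R (Gen.c j) * FreeAlgebra.ι R (Gen.c i)))
  | s_one : Rel R l d (FreeAlgebra.ι R (Gen.s 1)) 1
  | s_mul (v w : Equiv.Perm (Fin d)) : Rel R l d
      (FreeAlgebra.ι R (Gen.s v) * FreeAlgebra.ι R (Gen.s w))
      (FreeAlgebra.ι R (Gen.s (v * w)))
  | x_c_same (i : Fin d) : Rel R l d
      (FreeAlgebra.ι R (Gen.x i) * FreeAlgebra.ι R (Gen.c i))
      (-(FreeAlgebra.ι R (Gen.c i) * FreeAlgebra.ι R (Gen.x i)))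
  | x_c_ne (i j : Fin d) (hij : i ≠ j) : Rel R l d
      (FreeAlgebra.ι R (Gen.x i) * FreeAlgebra.ι R (Gen.c j))
      (FreeAlgebra.ι R (Gen.c j) * FreeAlgebra.ι R (Gen.x i))
  | s_x (w : Equiv.Perm (Fin d)) (i : Fin d) : Rel R l d
      (FreeAlgebra.ι R (Gen.s w) * FreeAlgebra.ι R (Gen.x i))
      (FreeAlgebra.ι R (Gen.x (w i)) * FreeAlgebra.ι R (Gen.s w))
  | s_c (w : Equiv.Perm (Fin d)) (i : Fin d) : Rel R l d
      (FreeAlgebra.ι R (Gen.s w) * FreeAlgebra.ι R (Gen.c i))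
      (FreeAlgebra.ι R (Gen.c (w i)) * FreeAlgebra.ι R (Gen.s w))

/-- The graded cyclotomic Sergeev superalgebra of level `l`, that is, the twisted tensor product
`(R_l[x_1, …, x_d] ⊗̂ R Σ_d) ⊗ C_d`. -/
abbrev Gr (R : Type*) [CommRing R] (l d : ℕ) : Type _ := RingQuot (Rel R l d)

section

variable (R : Type*) [CommRing R] (l : ℕ) {d : ℕ}

/-- The polynomial generator `x_i`. -/
noncomputable def x (i : Fin d) : Gr R l d :=
  RingQuot.mkAlgHom R (Rel R l d) (FreeAlgebra.ι R (Gen.x i))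

/-- The Clifford generator `c_i`. -/
noncomputable def c (i : Fin d) : Gr R l d :=
  RingQuot.mkAlgHom R (Rel R l d) (FreeAlgebra.ι R (Gen.c i))

/-- The permutation `w`, as an element of the algebra. -/
noncomputable def s (w : Equiv.Perm (Fin d)) : Gr R l d :=
  RingQuot.mkAlgHom R (Rel R l d) (FreeAlgebra.ι R (Gen.s w))

variable (d) in
/-- The even part of the superalgebra: the `x_i` and the permutations are even, the `c_i` odd. -/
noncomputable def evenPart : Subalgebra R (Gr R l d) :=
  Algebra.adjoin R (Set.range (x R l) ∪ Set.range (s R l) ∪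
    {z | ∃ i j : Fin d, z = c R l i * c R l j})

variable (d) in
/-- The odd part of the superalgebra. -/
noncomputable def oddPart : Submodule R (Gr R l d) :=
  Submodule.span R {z | ∃ i : Fin d, ∃ w ∈ evenPart R l d, z = c R l i * w}

/-- `R_l[A]`, as a subalgebra. -/
noncomputable def polyOn (A : Set (Fin d)) : Subalgebra R (Gr R l d) :=
  Algebra.adjoin R (x R l '' A)

/-- `C[A]`, as a subalgebra. -/
noncomputable def cliffOn (A : Set (Fin d)) : Subalgebra R (Gr R l d) :=
  Algebra.adjoin R (c R l '' A)

variable (d) in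
/-- The centralizer of the polynomial subalgebra. -/
noncomputable def CX : Subalgebra R (Gr R l d) :=
  Subalgebra.centralizer R (Set.range (x R l))

variable (d) in
/-- The even centralizer of the Clifford subalgebra in `CX`. -/
noncomputable def CCX : Subalgebra R (Gr R l d) :=
  evenPart R l d ⊓ CX R l d ⊓ Subalgebra.centralizer R (Set.range (c R l))

variable {R l} in
/-- `z` is of maximal degree with respect to `A`. -/
def IsMaxDegree (z : Gr R l d) (A : Set (Fin d)) : Prop :=
  ∀ i ∈ A, x R l i ^ (l - 1) ∣ z

/-- The cycle `σ_A = (i_1 … i_a)` of an ordered set `A = {i_1, …, i_a}`. -/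
noncomputable def sigma (A : List (Fin d)) : Gr R l d := s R l A.formPerm

/-- `c_α(A) = c_{i_1}^{α_1} ⋯ c_{i_a}^{α_a}`. -/
noncomputable def cMon (A : List (Fin d)) (α : Fin A.length → ZMod 2) : Gr R l d :=
  (List.ofFn fun j => c R l (A.get j) ^ (α j).val).prod

/-- The monomial `x_1^{ν_1} ⋯ x_d^{ν_d}`. -/
noncomputable def xMon (ν : Fin d → ℕ) : Gr R l d :=
  (List.ofFn fun j => x R l j ^ ν j).prod

end

/-- `|α|`, the number of coordinates of `α` that are `1`. -/
def weight {a : ℕ} (α : Fin a → ZMod 2) : ℕ := ∑ j, (α j).val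

/-- The even elements of `(ℤ/2)^a`. -/
def evenVec (a : ℕ) : Finset (Fin a → ZMod 2) :=
  Finset.univ.filter fun α => Even (weight α)

/-- The exponent of the sign `ε^α_j = ∏_{k < j} (-1)^{α_k}`. -/
def epsExp {a : ℕ} (α : Fin a → ZMod 2) (j : Fin a) : ℕ :=
  ∑ k ∈ Finset.univ.filter (fun k => k < j), (α k).val

/-- The exponent `|α| / 2 + ∑ i α_i` (with `i` running from `1`) of the sign `τ_α`, for even
`α`. -/
def tauExp {a : ℕ} (α : Fin a → ZMod 2) : ℕ :=
  weight α / 2 + ∑ j : Fin a, ((j : ℕ) + 1) * (α j).val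

section

variable (R : Type*) [CommRing R] (l : ℕ) {d : ℕ}

/-- The polynomial `h_r^α(A)`: the sum, over all `r_1 + ⋯ + r_a = (a - 1)(l - 1) + r`, of
`(ε^α_1 x_{i_1})^{r_1} ⋯ (ε^α_a x_{i_a})^{r_a}`. -/
noncomputable def h (A : List (Fin d)) (r : ℕ) (α : Fin A.length → ZMod 2) : Gr R l d :=
  ∑ ρ ∈ Finset.Nat.antidiagonalTuple A.length ((A.length - 1) * (l - 1) + r),
    (List.ofFn fun j => ((-1) ^ epsExp α j * x R l (A.get j)) ^ ρ j).prod

/-- The X-cycle `A^{(r,α)} = h_r^α(A) σ_A c_α(A)`. -/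
noncomputable def xCycle (A : List (Fin d)) (r : ℕ) (α : Fin A.length → ZMod 2) : Gr R l d :=
  h R l A r α * sigma R l A * cMon R l A α

/-- The element `A^{(r)} = ∑ τ_α A^{(r,α)}`, the sum over all even `α`. -/
noncomputable def cxElem (A : List (Fin d)) (r : ℕ) : Gr R l d :=
  ∑ α ∈ evenVec A.length, (-1) ^ tauExp α * xCycle R l A r α

variable {R l}

/-- `z` is a CX-cycle `A^{(r)}` on the ordered set `A`: here `(a - 1) l + r` has to be even. -/
def IsCXCycle (A : List (Fin d)) (z : Gr R l d) : Prop :=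
  ∃ r : ℕ, Even ((A.length - 1) * l + r) ∧ z = cxElem R l A r

/-- `z` is an odd skew cycle `f σ_A c` on the ordered set `A`. -/
def IsOddSkewCycle (A : List (Fin d)) (z : Gr R l d) : Prop :=
  (∃ f ∈ polyOn R l {i | i ∈ A}, ∃ e ∈ cliffOn R l {i | i ∈ A}, z = f * sigma R l A * e) ∧
    z ∈ CX R l d ∧ z ∈ oddPart R l d ∧ ∀ j, z * c R l j = -(c R l j * z)

variable (R l d) in
/-- The products of (any finite number of) disjoint CX-cycles. -/
def cxProducts : Set (Gr R l d) :=
  {z | ∃ (n : ℕ) (B : Fin n → List (Fin d)) (w : Fin n → Gr R l d),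
    (∀ i, B i ≠ [] ∧ (B i).Nodup) ∧ (∀ i j, i ≠ j → (B i).Disjoint (B j)) ∧
    (∀ i, IsCXCycle (B i) (w i)) ∧ z = (List.ofFn w).prod}

end

end Sergeev

/-! The monomials `x^ν w c_α` with exponents below `l` form an `R`-basis (`span_monomials`,
`coef_injective`); independence comes from letting the algebra act on functions of `(ν, w, α)`.
Every identity can therefore be checked on coefficients. Let σ be the product of the cycles on the
blocks.

Commuting with `c_{σ(j)}` ties the coefficient at `α` to the one at `α + e_j + e_{σ(j)}`, up to a
sign that is the same for all such elements (`coef_of_c_comm`). Without using the heads of the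
blocks, this pushes all Clifford exponents of a block to its last letter, so coefficients are
decided by those at collected exponents (`coef_eq_iff_collect`). The head closes the circuit and
gives a consistency condition. To read it off, compare with a model: `signedCycle` is the sum
defining `A^{(r)}`, taken over the vectors of a fixed parity `p`. It commutes with `c_j` up to
`(-1)^p` for `j` not the head and up to `(-1)^((a-1)l+r)` at the head. Suppose that a monomial times
signed cycles, of total parity 0, agrees with `z` at a collected exponent. If the model anticommutes
with some `c_j`, that coefficient of `z` is its own negative, hence zero because 2 is regular. So a
non-zero coefficient forces `p_i = (a_i-1)l + r_i` and even exponents outside the blocks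
(`parity_of_coef_ne_zero`).

For (i), maximal degree forces `r_i = l-1` and hence every `p_i`: parity 0 gives a CX-cycle, parity
1 an odd skew cycle (`isOddSkewCycle_signedCycle`). Only the exponents outside the blocks remain
free, and they make up `P` (`eq_mul_prod_of_isMaxDegree`).

For (ii), carrying `x_j` once around a block multiplies by the sign of `α` on that block. If this
sign is -1, the coefficient survives only at top exponents, which the hypothesis excludes. So all
collected exponents are 0. There, commuting with the `x_j` makes the coefficients depend on the
block degrees only and vanish below degree `(a-1)(l-1)` (`balanced_of_forall_not_isMaxDegree`).
Subtracting products of CX-cycles level by level exhausts the support (`Balanced.mem_span`). -/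

namespace Sergeev

/-! ### Signs -/

/-- The sign `(-1)^e` for `e` an integer modulo `2`. -/
def sg (R : Type*) [CommRing R] (e : ZMod 2) : R := (-1) ^ e.val

section Signs

variable (R : Type*) [CommRing R]

@[simp] lemma sg_zero : sg R 0 = 1 := by simp [sg]

@[simp] lemma sg_one : sg R 1 = -1 := by simp [sg, ZMod.val_one]

lemma zmod_two_cases (a : ZMod 2) : a = 0 ∨ a = 1 := by
  revert a; decide

lemma zmod_two_add_self (a : ZMod 2) : a + a = 0 := CharTwo.add_self_eq_zero a

lemma sg_add (a b : ZMod 2) : sg R (a + b) = sg R a * sg R b := by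
  rcases zmod_two_cases a with rfl | rfl <;> rcases zmod_two_cases b with rfl | rfl <;>
    simp [zmod_two_add_self]

lemma sg_natCast (n : ℕ) : sg R (n : ZMod 2) = (-1) ^ n := by
  induction n with
  | zero => simp
  | succ n ih => rw [Nat.cast_succ, sg_add, ih, sg_one, pow_succ]

lemma sg_mul_self (a : ZMod 2) : sg R a * sg R a = 1 := by
  rw [← sg_add, zmod_two_add_self, sg_zero]

lemma isUnit_sg (a : ZMod 2) : IsUnit (sg R a) := IsUnit.of_mul_eq_one _ (sg_mul_self R a)

variable {R} in
lemma sg_smul_sg_smul {M : Type*} [AddCommMonoid M] [Module R M] (a : ZMod 2) (y : M) :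
    sg R a • sg R a • y = y := by
  rw [smul_smul, sg_mul_self, one_smul]

lemma val_cast_zmod_two (a : ZMod 2) : ((a.val : ℕ) : ZMod 2) = a := ZMod.natCast_zmod_val a

end Signs

/-- The sum of the entries of `α` strictly before `j`. -/
def pre {n : ℕ} (α : Fin n → ZMod 2) (j : Fin n) : ZMod 2 := ∑ k, if k < j then α k else 0

/-- The sum of the entries of `α` strictly after `j`. -/
def post {n : ℕ} (α : Fin n → ZMod 2) (j : Fin n) : ZMod 2 := ∑ k, if j < k then α k else 0

lemma pre_add {n : ℕ} (α β : Fin n → ZMod 2) (j : Fin n) :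
    pre (α + β) j = pre α j + pre β j := by
  simp only [pre, ← Finset.sum_add_distrib]
  exact Finset.sum_congr rfl fun k _ => by split_ifs <;> simp

lemma post_add {n : ℕ} (α β : Fin n → ZMod 2) (j : Fin n) :
    post (α + β) j = post α j + post β j := by
  simp only [post, ← Finset.sum_add_distrib]
  exact Finset.sum_congr rfl fun k _ => by split_ifs <;> simp

lemma pre_single {n : ℕ} (i j : Fin n) (a : ZMod 2) :
    pre (Pi.single i a) j = if i < j then a else 0 := by
  unfold pre
  rw [Finset.sum_eq_single i]
  · simp
  · intro k _ hk; simp [hk]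
  · simp

lemma post_single {n : ℕ} (i j : Fin n) (a : ZMod 2) :
    post (Pi.single i a) j = if j < i then a else 0 := by
  unfold post
  rw [Finset.sum_eq_single i]
  · simp
  · intro k _ hk; simp [hk]
  · simp

lemma pre_add_post {n : ℕ} (α : Fin n → ZMod 2) (j : Fin n) :
    pre α j + α j + post α j = ∑ k, α k := by
  have : α j = ∑ k, if k = j then α k else 0 := by simp
  rw [pre, post, this, ← Finset.sum_add_distrib, ← Finset.sum_add_distrib]
  refine Finset.sum_congr rfl fun k _ => ?_
  rcases lt_trichotomy k j with h | h | h
  · simp [h, h.ne, h.not_gt]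
  · simp [h]
  · simp [h, h.ne', h.not_gt]

/-! ### Ordered monomials in anticommuting elements -/

section Monomials

variable {R : Type*} [CommRing R] {B : Type*} [Semiring B] [Algebra R B]

/-- The one rule behind all commutation signs: it is applied with the `u k` being the `x_k`, the
`c_k` and whole signed cycles. -/
lemma mul_prod_ofFn_pow {n : ℕ} (u : Fin n → B) (v : B) (δ : Fin n → ZMod 2)
    (hv : ∀ k, v * u k = sg R (δ k) • (u k * v)) (e : Fin n → ℕ) :
    v * (List.ofFn fun k => u k ^ e k).prod =
      sg R (∑ k, δ k * (e k : ZMod 2)) • ((List.ofFn fun k => u k ^ e k).prod * v) := by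
  have hpow : ∀ k (m : ℕ), v * u k ^ m = sg R (δ k * m) • (u k ^ m * v) := by
    intro k m
    induction m with
    | zero => simp
    | succ m ih =>
      rw [pow_succ, ← mul_assoc, ih, smul_mul_assoc, mul_assoc, hv, mul_smul_comm, smul_smul,
        Nat.cast_succ, mul_add, mul_one, sg_add, mul_assoc]
  induction n with
  | zero => simp
  | succ n ih =>
    rw [List.ofFn_succ, List.prod_cons, ← mul_assoc, hpow, smul_mul_assoc, mul_assoc,
      ih (fun k => u k.succ) (fun k => δ k.succ) (fun k => hv _) (fun k => e k.succ)
        (fun k => hpow _), mul_smul_comm, smul_smul, Fin.sum_univ_succ, sg_add, mul_assoc]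

lemma pre_succ {n : ℕ} (α : Fin (n + 1) → ZMod 2) (j : Fin n) :
    pre α j.succ = α 0 + pre (fun k => α k.succ) j := by
  simp [pre, Fin.sum_univ_succ]

/-- Moving `u j` to its place passes the factors before it, which costs the sign of `pre α j`; there
`u j ^ 2 = 1` lets exponents add modulo 2. -/
lemma clifford_mul_prod {n : ℕ} (u : Fin n → B) (hsq : ∀ i, u i * u i = 1)
    (hanti : ∀ i j, i ≠ j → u i * u j = sg R 1 • (u j * u i)) (α : Fin n → ZMod 2) (j : Fin n) :
    u j * (List.ofFn fun k => u k ^ (α k).val).prod =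
      sg R (pre α j) • (List.ofFn fun k => u k ^ ((α + Pi.single j 1 : Fin n → ZMod 2) k).val).prod := by
  induction n with
  | zero => exact j.elim0
  | succ n ih =>
    simp only [List.ofFn_succ, List.prod_cons]
    refine Fin.cases ?_ (fun j => ?_) j
    · have h0 : pre α 0 = 0 := by simp [pre]
      have h1 : (fun k : Fin n => u k.succ ^ ((α + Pi.single 0 1 : Fin (n + 1) → ZMod 2) k.succ).val) =
          fun k : Fin n => u k.succ ^ (α k.succ).val := by
        funext k; simp [Pi.add_apply, Fin.succ_ne_zero]
      rw [h1, h0, sg_zero, one_smul, ← mul_assoc]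
      congr 1
      simp only [Pi.add_apply, Pi.single_eq_same]
      rcases zmod_two_cases (α 0) with h | h <;> simp [h, hsq, zmod_two_add_self, ZMod.val_one]
    · have h1 : (fun k : Fin n => u k.succ ^ ((α + Pi.single j.succ 1 : Fin (n + 1) → ZMod 2) k.succ).val) =
          fun k : Fin n => u k.succ ^
            (((fun k => α k.succ) + Pi.single j 1 : Fin n → ZMod 2) k).val := by
        funext k
        simp [Pi.add_apply, Pi.single_apply]
      have h2 : (α + Pi.single j.succ 1 : Fin (n + 1) → ZMod 2) 0 = α 0 := by simp [(Fin.succ_ne_zero j).symm]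
      have h3 : u j.succ * u 0 ^ (α 0).val = sg R (α 0) • (u 0 ^ (α 0).val * u j.succ) := by
        rcases zmod_two_cases (α 0) with h | h
        · simp [h]
        · simpa [h, ZMod.val_one] using hanti _ _ (Fin.succ_ne_zero j)
      rw [h1, h2, ← mul_assoc, h3, smul_mul_assoc, mul_assoc,
        ih (fun k => u k.succ) (fun i => hsq _)
          (fun i j hij => hanti _ _ (by simpa using hij)) (fun k => α k.succ) j,
        mul_smul_comm, smul_smul, pre_succ, sg_add]

end Monomials

/-! ### The defining relations -/

section Relations

variable (R : Type*) [CommRing R] (l : ℕ) {d : ℕ}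

variable {R l} in
lemma neg_eq_sg_smul (y : Gr R l d) : -y = sg R 1 • y := by
  rw [sg_one]; exact (neg_one_smul R y).symm

lemma neg_one_pow_mul (n : ℕ) (y : Gr R l d) : (-1) ^ n * y = sg R (n : ZMod 2) • y := by
  rw [sg_natCast]
  rw [neg_eq_sg_smul, smul_pow, one_pow, smul_one_mul, sg_one]

lemma x_mul_x (i j : Fin d) : x R l i * x R l j = x R l j * x R l i := by
  simpa [x] using RingQuot.mkAlgHom_rel R (Rel.x_comm (R := R) (l := l) i j)

lemma x_pow_level (i : Fin d) : x R l i ^ l = 0 := by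
  simpa [x] using RingQuot.mkAlgHom_rel R (Rel.x_pow (R := R) (l := l) i)

lemma c_mul_self (i : Fin d) : c R l i * c R l i = 1 := by
  simpa [c] using RingQuot.mkAlgHom_rel R (Rel.c_sq (R := R) (l := l) i)

lemma c_mul_c_of_ne (i j : Fin d) (hij : i ≠ j) :
    c R l i * c R l j = sg R 1 • (c R l j * c R l i) := by
  rw [← neg_eq_sg_smul]
  simpa [c] using RingQuot.mkAlgHom_rel R (Rel.c_anti (R := R) (l := l) i j hij)

lemma s_one : s R l (1 : Equiv.Perm (Fin d)) = 1 := by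
  simpa [s] using RingQuot.mkAlgHom_rel R (Rel.s_one (R := R) (l := l) (d := d))

lemma s_mul_s (v w : Equiv.Perm (Fin d)) : s R l v * s R l w = s R l (v * w) := by
  simpa [s] using RingQuot.mkAlgHom_rel R (Rel.s_mul (R := R) (l := l) v w)

lemma x_mul_c (i j : Fin d) :
    x R l i * c R l j = sg R (if i = j then 1 else 0) • (c R l j * x R l i) := by
  split_ifs with hij
  · subst hij
    rw [← neg_eq_sg_smul]
    simpa [x, c] using RingQuot.mkAlgHom_rel R (Rel.x_c_same (R := R) (l := l) i)
  · simpa [x, c] using RingQuot.mkAlgHom_rel R (Rel.x_c_ne (R := R) (l := l) i j hij)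

lemma c_mul_x (i j : Fin d) :
    c R l i * x R l j = sg R (if i = j then 1 else 0) • (x R l j * c R l i) := by
  have h : sg R (if i = j then 1 else 0) = sg R (if j = i then 1 else 0) := by
    simp only [eq_comm]
  rw [x_mul_c, h, sg_smul_sg_smul]

lemma c_mul_c (i j : Fin d) :
    c R l i * c R l j = sg R (if i = j then 0 else 1) • (c R l j * c R l i) := by
  split_ifs with hij
  · simp [hij]
  · exact c_mul_c_of_ne R l i j hij

lemma s_mul_x (w : Equiv.Perm (Fin d)) (i : Fin d) :
    s R l w * x R l i = x R l (w i) * s R l w := by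
  simpa [x, s] using RingQuot.mkAlgHom_rel R (Rel.s_x (R := R) (l := l) w i)

lemma s_mul_c (w : Equiv.Perm (Fin d)) (i : Fin d) :
    s R l w * c R l i = c R l (w i) * s R l w := by
  simpa [c, s] using RingQuot.mkAlgHom_rel R (Rel.s_c (R := R) (l := l) w i)

lemma c_mul_s (w : Equiv.Perm (Fin d)) (i : Fin d) :
    c R l i * s R l w = s R l w * c R l (w⁻¹ i) := by
  rw [s_mul_c]; simp

lemma prod_ofFn_s {m : ℕ} (v : Fin m → Equiv.Perm (Fin d)) :
    (List.ofFn fun i => s R l (v i)).prod = s R l (List.ofFn v).prod := by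
  induction m with
  | zero => simp [s_one]
  | succ m ih => simp [List.ofFn_succ, ih, s_mul_s]

variable (d) in
lemma adjoin_generators_eq_top :
    Algebra.adjoin R (Set.range (x R l (d := d)) ∪ Set.range (c R l) ∪ Set.range (s R l)) = ⊤ := by
  have h : (RingQuot.mkAlgHom R (Rel R l d)).range = ⊤ :=
    (AlgHom.range_eq_top _).2 (RingQuot.mkAlgHom_surjective R _)
  rw [← h, ← Algebra.map_top, ← FreeAlgebra.adjoin_range_ι, AlgHom.map_adjoin]
  congr 1
  ext z
  constructor
  · rintro ((⟨i, rfl⟩ | ⟨i, rfl⟩) | ⟨w, rfl⟩)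
    exacts [⟨_, ⟨Gen.x i, rfl⟩, rfl⟩, ⟨_, ⟨Gen.c i, rfl⟩, rfl⟩, ⟨_, ⟨Gen.s w, rfl⟩, rfl⟩]
  · rintro ⟨_, ⟨g, rfl⟩, rfl⟩
    cases g with
    | x i => exact .inl (.inl ⟨i, rfl⟩)
    | c i => exact .inl (.inr ⟨i, rfl⟩)
    | s w => exact .inr ⟨w, rfl⟩

/-- A subalgebra containing the generators is everything. -/
lemma mem_of_generators (S : Subalgebra R (Gr R l d)) (hx : ∀ i, x R l i ∈ S)
    (hc : ∀ i, c R l i ∈ S) (hs : ∀ w, s R l w ∈ S) (z : Gr R l d) : z ∈ S := by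
  have : (⊤ : Subalgebra R (Gr R l d)) ≤ S := by
    rw [← adjoin_generators_eq_top, Algebra.adjoin_le_iff]
    rintro _ ((⟨i, rfl⟩ | ⟨i, rfl⟩) | ⟨w, rfl⟩)
    exacts [hx i, hc i, hs w]
  exact this trivial

/-! ### Monomials -/

@[simp] lemma xMon_zero : xMon R l (0 : Fin d → ℕ) = 1 := by
  have : ∀ n : ℕ, (List.ofFn fun _ : Fin n => (1 : Gr R l d)).prod = 1 := by
    intro n; simp
  simp [xMon]

lemma x_mul_prod_pow {B : Type*} [Semiring B] {n : ℕ} (u : Fin n → B)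
    (hu : ∀ i j, u i * u j = u j * u i) (e : Fin n → ℕ) (j : Fin n) (m : ℕ) :
    u j ^ m * (List.ofFn fun k => u k ^ e k).prod =
      (List.ofFn fun k => u k ^ (e + Pi.single j m : Fin n → ℕ) k).prod := by
  induction n with
  | zero => exact j.elim0
  | succ n ih =>
    simp only [List.ofFn_succ, List.prod_cons]
    refine Fin.cases ?_ (fun j => ?_) j
    · simp [pow_add, ← mul_assoc, (Commute.refl (u 0)).pow_pow _ _ |>.eq]
    · have h1 : (fun k : Fin n => u k.succ ^ (e + Pi.single j.succ m : Fin (n + 1) → ℕ) k.succ) =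
          fun k : Fin n => u k.succ ^ (((fun k => e k.succ) + Pi.single j m : Fin n → ℕ) k) := by
        funext k
        simp [Pi.add_apply, Pi.single_apply]
      have h2 : (e + Pi.single j.succ m : Fin (n + 1) → ℕ) 0 = e 0 := by simp [(Fin.succ_ne_zero j).symm]
      have h3 : u j.succ ^ m * u 0 ^ e 0 = u 0 ^ e 0 * u j.succ ^ m :=
        (Commute.pow_pow (show Commute (u j.succ) (u 0) from hu _ _) _ _).eq
      rw [h1, h2, ← mul_assoc, h3, mul_assoc, ih (fun k => u k.succ) (fun i j => hu _ _)]

lemma x_pow_mul_xMon (i : Fin d) (m : ℕ) (ν : Fin d → ℕ) :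
    x R l i ^ m * xMon R l ν = xMon R l (ν + Pi.single i m) :=
  x_mul_prod_pow _ (x_mul_x R l) ν i m

lemma x_mul_xMon (i : Fin d) (ν : Fin d → ℕ) :
    x R l i * xMon R l ν = xMon R l (ν + Pi.single i 1) := by
  simpa using x_pow_mul_xMon R l i 1 ν

lemma prod_x_pow_mul_xMon {n : ℕ} (u : Fin n → Fin d) (e : Fin n → ℕ) (ν : Fin d → ℕ) :
    (List.ofFn fun k => x R l (u k) ^ e k).prod * xMon R l ν =
      xMon R l (ν + ∑ k, Pi.single (u k) (e k)) := by
  induction n with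
  | zero => simp
  | succ n ih =>
    rw [List.ofFn_succ, List.prod_cons, mul_assoc, ih (fun k => u k.succ) (fun k => e k.succ),
      x_pow_mul_xMon, Fin.sum_univ_succ, add_assoc, add_comm (∑ k : Fin n, _)]

lemma prod_x_pow {n : ℕ} (u : Fin n → Fin d) (e : Fin n → ℕ) :
    (List.ofFn fun k => x R l (u k) ^ e k).prod = xMon R l (∑ k, Pi.single (u k) (e k)) := by
  simpa using prod_x_pow_mul_xMon R l u e 0

lemma sum_single_eq {n : ℕ} {M : Type*} [AddCommMonoid M] (ν : Fin n → M) :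
    ∑ k, (Pi.single k (ν k) : Fin n → M) = ν := by
  funext j; simp [Finset.sum_apply, Pi.single_apply]

lemma xMon_mul_xMon (μ ν : Fin d → ℕ) : xMon R l μ * xMon R l ν = xMon R l (μ + ν) := by
  have := prod_x_pow_mul_xMon R l (fun k => k) μ ν
  rwa [sum_single_eq, add_comm] at this

lemma xMon_single (i : Fin d) (m : ℕ) : xMon R l (Pi.single i m) = x R l i ^ m := by
  simpa using (x_pow_mul_xMon R l i m 0).symm

lemma s_mul_xMon (w : Equiv.Perm (Fin d)) (ν : Fin d → ℕ) :
    s R l w * xMon R l ν = xMon R l (ν ∘ w.symm) * s R l w := by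
  have key : ∀ (n : ℕ) (u : Fin n → Fin d) (e : Fin n → ℕ),
      s R l w * (List.ofFn fun k => x R l (u k) ^ e k).prod =
        (List.ofFn fun k => x R l (w (u k)) ^ e k).prod * s R l w := by
    intro n
    induction n with
    | zero => simp
    | succ n ih =>
      intro u e
      have hp : s R l w * x R l (u 0) ^ e 0 = x R l (w (u 0)) ^ e 0 * s R l w :=
        (SemiconjBy.pow_right (s_mul_x R l w (u 0)) (e 0) :)
      rw [List.ofFn_succ, List.prod_cons, ← mul_assoc, hp, mul_assoc,
        ih (fun k => u k.succ) (fun k => e k.succ), List.ofFn_succ, List.prod_cons, mul_assoc]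
  rw [xMon, key d (fun k => k) ν, prod_x_pow]
  congr 2
  funext j
  simp only [Finset.sum_apply, Pi.single_apply, Function.comp_apply]
  rw [Finset.sum_eq_single (w.symm j)]
  · simp
  · intro k _ hk
    rw [if_neg]
    rintro rfl
    simp at hk
  · simp

lemma c_mul_xMon (i : Fin d) (ν : Fin d → ℕ) :
    c R l i * xMon R l ν = sg R (ν i : ZMod 2) • (xMon R l ν * c R l i) := by
  have := mul_prod_ofFn_pow (R := R) (x R l) (c R l i) (fun k => if i = k then 1 else 0)
    (fun k => c_mul_x R l i k) ν
  simpa [xMon] using this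

/-- The monomial `c_1^{α_1} ⋯ c_d^{α_d}`. -/
noncomputable def cFull (α : Fin d → ZMod 2) : Gr R l d :=
  (List.ofFn fun j => c R l j ^ (α j).val).prod

lemma c_mul_cFull (j : Fin d) (α : Fin d → ZMod 2) :
    c R l j * cFull R l α = sg R (pre α j) • cFull R l (α + Pi.single j 1) :=
  clifford_mul_prod (R := R) (c R l) (c_mul_self R l) (c_mul_c_of_ne R l) α j

@[simp] lemma cFull_zero : cFull R l (0 : Fin d → ZMod 2) = 1 := by
  simp [cFull]

end Relations

/-! ### A faithful representation on functions of exponents, permutations and signs -/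

/-- Functions on the index set `(ν, w, α)` of the monomials `x^ν w c_α`. -/
abbrev Coef (R : Type*) (d : ℕ) : Type _ :=
  (Fin d → ℕ) → Equiv.Perm (Fin d) → (Fin d → ZMod 2) → R

section Model

variable (R : Type*) [CommRing R] (l : ℕ) {d : ℕ}

/-- Left multiplication by `x_i`. -/
def actX (i : Fin d) : Module.End R (Coef R d) where
  toFun φ ν w α := if 1 ≤ ν i ∧ ν i < l then φ (ν - Pi.single i 1) w α else 0
  map_add' φ ψ := by
    funext ν w α; simp only [Pi.add_apply]; split_ifs <;> simp
  map_smul' r φ := by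
    funext ν w α; simp only [Pi.smul_apply, RingHom.id_apply]; split_ifs <;> simp

/-- Left multiplication by `c_i`. -/
def actC (i : Fin d) : Module.End R (Coef R d) where
  toFun φ ν w α :=
    sg R ((ν i : ZMod 2) + pre α (w⁻¹ i)) * φ ν w (α + Pi.single (w⁻¹ i) 1)
  map_add' φ ψ := by
    funext ν w α; simp only [Pi.add_apply, mul_add]
  map_smul' r φ := by
    funext ν w α; simp only [Pi.smul_apply, RingHom.id_apply, smul_eq_mul]; ring

/-- Left multiplication by a permutation. -/
def actS (v : Equiv.Perm (Fin d)) : Module.End R (Coef R d) where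
  toFun φ ν w α := φ (ν ∘ v) (v⁻¹ * w) α
  map_add' _ _ := rfl
  map_smul' _ _ := rfl

variable {R l}

lemma actX_apply (i : Fin d) (φ : Coef R d) (ν w α) :
    actX R l i φ ν w α = if 1 ≤ ν i ∧ ν i < l then φ (ν - Pi.single i 1) w α else 0 := rfl

lemma actC_apply (i : Fin d) (φ : Coef R d) (ν w α) : actC R i φ ν w α =
    sg R ((ν i : ZMod 2) + pre α (w⁻¹ i)) * φ ν w (α + Pi.single (w⁻¹ i) 1) := rfl

lemma actS_apply (v : Equiv.Perm (Fin d)) (φ : Coef R d) (ν w α) :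
    actS R v φ ν w α = φ (ν ∘ v) (v⁻¹ * w) α := rfl

lemma actX_pow_succ_apply (i : Fin d) (k : ℕ) (φ : Coef R d) (ν w α) :
    (actX R l i ^ (k + 1)) φ ν w α =
      if k + 1 ≤ ν i ∧ ν i < l then φ (ν - Pi.single i (k + 1)) w α else 0 := by
  induction k generalizing ν with
  | zero => simp [actX_apply]
  | succ k ih =>
    rw [pow_succ', Module.End.mul_apply, actX_apply]
    by_cases h1 : 1 ≤ ν i ∧ ν i < l
    · rw [if_pos h1, ih]
      have h2 : (ν - Pi.single i 1 - Pi.single i (k + 1) : Fin d → ℕ) =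
          ν - Pi.single i (k + 1 + 1) := by
        funext j
        by_cases hj : j = i
        · subst hj; simp; omega
        · simp [hj]
      have h3 : (k + 1 ≤ (ν - Pi.single i 1 : Fin d → ℕ) i ∧
          (ν - Pi.single i 1 : Fin d → ℕ) i < l) ↔ k + 1 + 1 ≤ ν i ∧ ν i < l := by
        simp; omega
      simp only [h2, h3]
    · rw [if_neg h1, if_neg]
      omega

lemma char_two_add_single (α : Fin d → ZMod 2) (j : Fin d) :
    α + Pi.single j 1 + Pi.single j 1 = α := by
  rw [add_assoc, ← Pi.single_add, zmod_two_add_self, Pi.single_zero, add_zero]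

variable (R l) in
/-- The action of the generators. -/
def actGen : Gen d → Module.End R (Coef R d)
  | .x i => actX R l i
  | .c i => actC R i
  | .s w => actS R w

/-- The relation `x_i ^ l = 0` is where `l ≠ 0` matters: for `l = 0` it reads `1 = 0`, which fails
on functions. -/
lemma actGen_rel [NeZero l] {a b : FreeAlgebra R (Gen d)} (hab : Rel R l d a b) :
    FreeAlgebra.lift R (actGen R l) a = FreeAlgebra.lift R (actGen R l) b := by
  cases hab with
  | x_comm i j =>
    simp only [map_mul, FreeAlgebra.lift_ι_apply, actGen]
    rcases eq_or_ne i j with rfl | hij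
    · rfl
    ext φ ν w α
    simp only [Module.End.mul_apply, actX_apply, Pi.sub_apply, Pi.single_eq_of_ne hij,
      Pi.single_eq_of_ne hij.symm, tsub_zero, tsub_right_comm (a := ν) (b := Pi.single i 1)]
    split_ifs <;> rfl
  | x_pow i =>
    obtain ⟨k, rfl⟩ := Nat.exists_eq_succ_of_ne_zero (NeZero.ne l)
    simp only [map_pow, FreeAlgebra.lift_ι_apply, actGen, map_zero]
    ext φ ν w α
    rw [Nat.succ_eq_add_one, actX_pow_succ_apply, if_neg (by omega)]
    rfl
  | c_sq i =>
    simp only [map_mul, FreeAlgebra.lift_ι_apply, actGen, map_one]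
    ext φ ν w α
    simp only [Module.End.mul_apply, actC_apply, pre_add, pre_single, lt_irrefl, if_false,
      add_zero, char_two_add_single, ← mul_assoc, sg_mul_self, one_mul, Module.End.one_apply]
  | c_anti i j hij =>
    simp only [map_mul, FreeAlgebra.lift_ι_apply, actGen, map_neg]
    ext φ ν w α
    have hne : w⁻¹ i ≠ w⁻¹ j := by simpa using hij
    simp only [Module.End.mul_apply, actC_apply, pre_add, pre_single, LinearMap.neg_apply,
      Pi.neg_apply, ← mul_assoc, ← sg_add, add_right_comm α (Pi.single (w⁻¹ i) 1)]
    rw [← neg_mul]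
    congr 1
    rw [neg_eq_neg_one_mul, ← sg_one, ← sg_add]
    congr 1
    rcases hne.lt_or_gt with h | h
    · simp only [h, h.not_gt, if_true, if_false]
      ring
    · simp only [h, h.not_gt, if_true, if_false]
      linear_combination zmod_two_add_self 1 * (-1 : ZMod 2)
  | s_one =>
    simp only [FreeAlgebra.lift_ι_apply, actGen, map_one]
    ext φ ν w α
    simp [actS_apply]
  | s_mul v w =>
    simp only [map_mul, FreeAlgebra.lift_ι_apply, actGen]
    ext φ ν u α
    simp only [Module.End.mul_apply, actS_apply, mul_inv_rev, mul_assoc]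
    rfl
  | x_c_same i =>
    simp only [map_mul, FreeAlgebra.lift_ι_apply, actGen, map_neg]
    ext φ ν w α
    simp only [Module.End.mul_apply, actC_apply, actX_apply, LinearMap.neg_apply, Pi.neg_apply,
      Pi.sub_apply, Pi.single_eq_same]
    split_ifs with h
    · rw [← neg_mul]
      congr 1
      rw [neg_eq_neg_one_mul, ← sg_one, ← sg_add]
      congr 1
      rw [Nat.cast_sub h.1, Nat.cast_one]
      linear_combination zmod_two_add_self 1 * (-1 : ZMod 2)
    · simp
  | x_c_ne i j hij =>
    simp only [map_mul, FreeAlgebra.lift_ι_apply, actGen]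
    ext φ ν w α
    simp only [Module.End.mul_apply, actC_apply, actX_apply,
      Pi.sub_apply, Pi.single_eq_of_ne hij.symm, tsub_zero]
    split_ifs <;> simp
  | s_x w i =>
    simp only [map_mul, FreeAlgebra.lift_ι_apply, actGen]
    ext φ ν u α
    simp only [Module.End.mul_apply, actS_apply, actX_apply, Function.comp_apply]
    have : (ν ∘ w - Pi.single i 1 : Fin d → ℕ) = (ν - Pi.single (w i) 1) ∘ w := by
      funext j; simp [Pi.single_apply]
    rw [this]
  | s_c w i =>
    simp only [map_mul, FreeAlgebra.lift_ι_apply, actGen]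
    ext φ ν u α
    simp only [Module.End.mul_apply, actS_apply, actC_apply, Function.comp_apply, mul_inv_rev,
      inv_inv, Equiv.Perm.mul_apply]

variable (R) in
/-- Right multiplication by `c_i`. -/
def ractC (i : Fin d) : Module.End R (Coef R d) where
  toFun φ ν w α := sg R (post α i) * φ ν w (α + Pi.single i 1)
  map_add' φ ψ := by
    funext ν w α; simp only [Pi.add_apply, mul_add]
  map_smul' r φ := by
    funext ν w α; simp only [Pi.smul_apply, RingHom.id_apply, smul_eq_mul]; ring

lemma ractC_apply (i : Fin d) (φ : Coef R d) (ν w α) :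
    ractC R i φ ν w α = sg R (post α i) * φ ν w (α + Pi.single i 1) := rfl

variable (R l) in
/-- Right multiplication by `x_i`. -/
def ractX (i : Fin d) : Module.End R (Coef R d) where
  toFun φ ν w α := sg R (α i) *
    (if 1 ≤ ν (w i) ∧ ν (w i) < l then φ (ν - Pi.single (w i) 1) w α else 0)
  map_add' φ ψ := by
    funext ν w α; simp only [Pi.add_apply]; split_ifs <;> simp [mul_add]
  map_smul' r φ := by
    funext ν w α
    simp only [Pi.smul_apply, RingHom.id_apply, smul_eq_mul]
    split_ifs
    · ring
    · simp

lemma ractX_apply (i : Fin d) (φ : Coef R d) (ν w α) : ractX R l i φ ν w α = sg R (α i) *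
    (if 1 ≤ ν (w i) ∧ ν (w i) < l then φ (ν - Pi.single (w i) 1) w α else 0) := rfl

variable [NeZero l]

variable (R l d) in
/-- The left regular representation in terms of coefficients. -/
noncomputable def rho : Gr R l d →ₐ[R] Module.End R (Coef R d) :=
  RingQuot.liftAlgHom R ⟨FreeAlgebra.lift R (actGen R l), fun _ _ h => actGen_rel h⟩

lemma rho_x (i : Fin d) : rho R l d (x R l i) = actX R l i := by
  simp [rho, x, RingQuot.liftAlgHom_mkAlgHom_apply, actGen]

lemma rho_c (i : Fin d) : rho R l d (c R l i) = actC R i := by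
  simp [rho, c, RingQuot.liftAlgHom_mkAlgHom_apply, actGen]

lemma rho_s (v : Equiv.Perm (Fin d)) : rho R l d (s R l v) = actS R v := by
  simp [rho, s, RingQuot.liftAlgHom_mkAlgHom_apply, actGen]

variable (R) in
/-- The coefficients of the unit. -/
def vac : Coef R d := fun ν w α => if ν = 0 ∧ w = 1 ∧ α = 0 then 1 else 0

variable (R l d) in
/-- The coefficients of an element in terms of the monomials `x^ν w c_α`. -/
noncomputable def coef : Gr R l d →ₗ[R] Coef R d :=
  (LinearMap.applyₗ (vac R)).comp (rho R l d).toLinearMap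

lemma coef_def (z : Gr R l d) : coef R l d z = rho R l d z (vac R) := rfl

lemma coef_mul (y z : Gr R l d) : coef R l d (y * z) = rho R l d y (coef R l d z) := by
  simp [coef_def]

lemma coef_one : coef R l d 1 = vac R := by simp [coef_def]

lemma coef_x_mul (i : Fin d) (z : Gr R l d) (ν w α) : coef R l d (x R l i * z) ν w α =
    if 1 ≤ ν i ∧ ν i < l then coef R l d z (ν - Pi.single i 1) w α else 0 := by
  rw [coef_mul, rho_x, actX_apply]

lemma coef_c_mul (i : Fin d) (z : Gr R l d) (ν w α) : coef R l d (c R l i * z) ν w α =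
    sg R ((ν i : ZMod 2) + pre α (w⁻¹ i)) * coef R l d z ν w (α + Pi.single (w⁻¹ i) 1) := by
  rw [coef_mul, rho_c, actC_apply]

lemma coef_s_mul (v : Equiv.Perm (Fin d)) (z : Gr R l d) (ν w α) :
    coef R l d (s R l v * z) ν w α = coef R l d z (ν ∘ v) (v⁻¹ * w) α := by
  rw [coef_mul, rho_s, actS_apply]

/-- An operator commuting with the generators commutes with the representation. -/
lemma rho_comm (T : Module.End R (Coef R d)) (hx : ∀ i, Commute T (actX R l i))
    (hc : ∀ i, Commute T (actC R i)) (hs : ∀ v, Commute T (actS R v)) (z : Gr R l d)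
    (φ : Coef R d) : rho R l d z (T φ) = T (rho R l d z φ) := by
  have h : z ∈ (Subalgebra.centralizer R {T}).comap (rho R l d) := by
    refine mem_of_generators R l _ (fun i => ?_) (fun i => ?_) (fun v => ?_) z <;>
      simp only [Subalgebra.mem_comap, Subalgebra.mem_centralizer_iff, Set.mem_singleton_iff,
        forall_eq, rho_x, rho_c, rho_s]
    exacts [(hx i).eq, (hc i).eq, (hs v).eq]
  simp only [Subalgebra.mem_comap, Subalgebra.mem_centralizer_iff, Set.mem_singleton_iff,
    forall_eq] at h
  exact (LinearMap.congr_fun h φ).symm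

/-- An operator that commutes with all left multiplications is determined by its value on the unit.
This identifies right multiplications from a check on generators and on `vac`. -/
lemma coef_mul_of_comm (T : Module.End R (Coef R d)) (y : Gr R l d)
    (hT : T (vac R) = coef R l d y) (hx : ∀ i, Commute T (actX R l i))
    (hc : ∀ i, Commute T (actC R i)) (hs : ∀ v, Commute T (actS R v)) (z : Gr R l d) :
    coef R l d (z * y) = T (coef R l d z) := by
  rw [coef_mul, ← hT, rho_comm T hx hc hs, coef_def]

lemma coef_mul_c (i : Fin d) (z : Gr R l d) (ν w α) : coef R l d (z * c R l i) ν w α =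
    sg R (post α i) * coef R l d z ν w (α + Pi.single i 1) := by
  rw [coef_mul_of_comm (ractC R i), ractC_apply]
  · rw [coef_def, rho_c]
    funext ν w α
    simp only [ractC_apply, actC_apply, vac]
    by_cases h : ν = 0 ∧ w = 1
    · obtain ⟨rfl, rfl⟩ := h
      by_cases hα : α = Pi.single i 1
      · subst hα
        simp [pre_single, post_single, ← Pi.single_add, zmod_two_add_self]
      · have : α + Pi.single i 1 ≠ 0 := fun h => hα (by
          rw [← char_two_add_single α i, h, zero_add])
        simp [this]
    · have h1 : ∀ β : Fin d → ZMod 2, ¬ (ν = 0 ∧ w = 1 ∧ β = 0) := by tauto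
      simp [h1]
  · intro j
    ext φ ν w α
    simp only [Module.End.mul_apply, ractC_apply, actX_apply]
    split_ifs <;> simp
  · intro j
    ext φ ν w α
    simp only [Module.End.mul_apply, ractC_apply, actC_apply, ← mul_assoc, ← sg_add, pre_add,
      post_add, pre_single, post_single, add_right_comm α (Pi.single i 1)]
    congr 2
    ring
  · intro v
    ext φ ν w α
    simp only [Module.End.mul_apply, ractC_apply, actS_apply]

/-- Since `w c_α x_i = ± x_{w(i)} w c_α`, the right factor is rewritten as a left one; commuting
with `x_i` thereby becomes a relation between left multiplications. -/
lemma coef_mul_x (i : Fin d) (z : Gr R l d) (ν w α) : coef R l d (z * x R l i) ν w α =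
    sg R (α i) * coef R l d (x R l (w i) * z) ν w α := by
  rw [coef_x_mul, coef_mul_of_comm (ractX R l i), ractX_apply]
  · rw [coef_def, rho_x]
    funext ν w α
    simp only [ractX_apply, actX_apply, vac]
    by_cases h : w = 1 ∧ α = 0
    · obtain ⟨rfl, rfl⟩ := h
      simp
    · have h1 : ∀ β : Fin d → ℕ, ¬ (β = 0 ∧ w = 1 ∧ α = 0) := by tauto
      simp [h1]
  · intro j
    ext φ ν w α
    simp only [Module.End.mul_apply, ractX_apply, actX_apply]
    rcases eq_or_ne j (w i) with rfl | hij
    · split_ifs <;> simp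
    · simp only [Pi.sub_apply, Pi.single_eq_of_ne hij, Pi.single_eq_of_ne hij.symm, tsub_zero,
        tsub_right_comm (a := ν) (b := Pi.single (w i) 1)]
      split_ifs <;> simp
  · intro j
    ext φ ν w α
    simp only [Module.End.mul_apply, ractX_apply, actC_apply]
    by_cases h : 1 ≤ ν (w i) ∧ ν (w i) < l
    · rw [if_pos h, if_pos h, ← mul_assoc, ← mul_assoc, ← sg_add, ← sg_add]
      congr 2
      by_cases hj : j = w i
      · subst hj
        simp only [Pi.sub_apply, Pi.single_eq_same, Pi.add_apply, Equiv.Perm.coe_inv, Equiv.symm_apply_apply]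
        rw [Nat.cast_sub h.1, Nat.cast_one]
        linear_combination zmod_two_add_self 1 * (-1 : ZMod 2)
      · have : i ≠ w⁻¹ j := by
          rintro rfl; simp at hj
        simp only [Pi.sub_apply, Pi.add_apply, Pi.single_eq_of_ne hj, Pi.single_eq_of_ne this,
          tsub_zero]
        ring
    · simp [h]
  · intro v
    ext φ ν w α
    simp only [Module.End.mul_apply, ractX_apply, actS_apply, Function.comp_apply,
      Equiv.Perm.mul_apply, Equiv.Perm.coe_inv, Equiv.apply_symm_apply]
    have : ((ν - Pi.single (w i) 1) ∘ v : Fin d → ℕ) = ν ∘ v - Pi.single (v⁻¹ (w i)) 1 := by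
      funext j
      simp only [Function.comp_apply, Pi.sub_apply, Pi.single_apply, Equiv.Perm.eq_inv_iff_eq]
    rw [this]
    rfl

end Model

/-! ### The monomial basis and coefficient formulas -/

section Coefficients

variable {R : Type*} [CommRing R] {l : ℕ} {d : ℕ}

/-- The projection to the exponents below `l`. -/
def truncProj (R : Type*) [CommRing R] (l : ℕ) {d : ℕ} : Module.End R (Coef R d) where
  toFun φ ν w α := if ∀ j, ν j < l then φ ν w α else 0
  map_add' φ ψ := by
    funext ν w α; simp only [Pi.add_apply]; split_ifs <;> simp
  map_smul' r φ := by
    funext ν w α; simp only [Pi.smul_apply, RingHom.id_apply]; split_ifs <;> simp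

lemma truncProj_apply (φ : Coef R d) (ν w α) :
    truncProj R l φ ν w α = if ∀ j, ν j < l then φ ν w α else 0 := rfl

/-- The parity operator. -/
def parityOp (R : Type*) [CommRing R] {d : ℕ} : Module.End R (Coef R d) where
  toFun φ ν w α := sg R (∑ k, α k) * φ ν w α
  map_add' φ ψ := by
    funext ν w α; simp only [Pi.add_apply, mul_add]
  map_smul' r φ := by
    funext ν w α; simp only [Pi.smul_apply, RingHom.id_apply, smul_eq_mul]; ring

lemma parityOp_apply (φ : Coef R d) (ν w α) :
    parityOp R φ ν w α = sg R (∑ k, α k) * φ ν w α := rfl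

lemma sum_add_single (α : Fin d → ZMod 2) (j : Fin d) (a : ZMod 2) :
    ∑ k, (α + Pi.single j a : Fin d → ZMod 2) k = ∑ k, α k + a := by
  simp [Finset.sum_add_distrib]

lemma xMon_eq_zero {μ : Fin d → ℕ} {j : Fin d} (hj : l ≤ μ j) : xMon R l μ = 0 := by
  have h : μ = (μ - Pi.single j l) + Pi.single j l := by
    funext k
    by_cases hk : k = j
    · subst hk; simp; omega
    · simp [hk]
  rw [h, ← x_pow_mul_xMon, x_pow_level, zero_mul]

/-- The monomials `x^ν w c_α` span the algebra. -/
lemma span_monomials (z : Gr R l d) : z ∈ Submodule.span R (Set.range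
    fun i : (Fin d → Fin l) × Equiv.Perm (Fin d) × (Fin d → ZMod 2) =>
      xMon R l (fun j => i.1 j) * s R l i.2.1 * cFull R l i.2.2) := by
  set M := Submodule.span R (Set.range
    fun i : (Fin d → Fin l) × Equiv.Perm (Fin d) × (Fin d → ZMod 2) =>
      xMon R l (fun j => i.1 j) * s R l i.2.1 * cFull R l i.2.2) with hM
  have hmem : ∀ ν w α, xMon R l ν * s R l w * cFull R l α ∈ M := by
    intro ν w α
    by_cases hν : ∀ j, ν j < l
    · exact Submodule.subset_span ⟨(fun j => ⟨ν j, hν j⟩, w, α), rfl⟩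
    · push Not at hν
      obtain ⟨j, hj⟩ := hν
      rw [xMon_eq_zero hj, zero_mul, zero_mul]
      exact zero_mem _
  -- The elements whose left multiplication preserves the span form a subalgebra. It contains the
  -- generators, hence everything; then apply it to 1.
  let T : Subalgebra R (Gr R l d) :=
    { carrier := {y | ∀ m ∈ M, y * m ∈ M}
      mul_mem' := fun {a b} ha hb m hm => by rw [mul_assoc]; exact ha _ (hb _ hm)
      add_mem' := fun {a b} ha hb m hm => by
        rw [add_mul]; exact add_mem (ha _ hm) (hb _ hm)
      algebraMap_mem' := fun r m hm => by
        rw [← Algebra.smul_def]; exact M.smul_mem _ hm }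
  have hT : ∀ y : Gr R l d, (∀ ν w α, y * (xMon R l ν * s R l w * cFull R l α) ∈ M) → y ∈ T := by
    intro y hy m hm
    induction hm using Submodule.span_induction with
    | mem m hm => obtain ⟨i, rfl⟩ := hm; exact hy _ _ _
    | zero => rw [mul_zero]; exact zero_mem _
    | add a b _ _ ha hb => rw [mul_add]; exact add_mem ha hb
    | smul r a _ ha => rw [mul_smul_comm]; exact M.smul_mem _ ha
  have hz : z ∈ T := by
    refine mem_of_generators R l T (fun i => hT _ fun ν w α => ?_)
      (fun i => hT _ fun ν w α => ?_) (fun v => hT _ fun ν w α => ?_) z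
    · rw [← mul_assoc, ← mul_assoc, x_mul_xMon]
      exact hmem _ _ _
    · rw [← mul_assoc, ← mul_assoc, c_mul_xMon, smul_mul_assoc, smul_mul_assoc, mul_assoc,
        mul_assoc, ← mul_assoc (c R l i), c_mul_s, mul_assoc (s R l w), c_mul_cFull,
        mul_smul_comm, mul_smul_comm, ← mul_assoc]
      exact M.smul_mem _ (M.smul_mem _ (hmem _ _ _))
    · rw [← mul_assoc, ← mul_assoc, s_mul_xMon, mul_assoc (xMon _ _ _), s_mul_s]
      exact hmem _ _ _
  have h1 : (1 : Gr R l d) ∈ M := by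
    have := hmem 0 1 0
    simpa [s_one] using this
  simpa using hz 1 h1

variable (R l) in
/-- Monomials with exponents supported on `A`. -/
def xMonSubmonoid (A : Set (Fin d)) : Submonoid (Gr R l d) where
  carrier := {y | ∃ ν : Fin d → ℕ, (∀ j ∉ A, ν j = 0) ∧ y = xMon R l ν}
  one_mem' := ⟨0, fun _ _ => rfl, (xMon_zero R l).symm⟩
  mul_mem' := by
    rintro _ _ ⟨μ, hμ, rfl⟩ ⟨ν, hν, rfl⟩
    exact ⟨μ + ν, fun j hj => by simp [hμ j hj, hν j hj], xMon_mul_xMon R l μ ν⟩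

lemma polyOn_le_span {A : Set (Fin d)} {f : Gr R l d} (hf : f ∈ polyOn R l A) :
    f ∈ Submodule.span R {y | ∃ ν : Fin d → ℕ, (∀ j ∉ A, ν j = 0) ∧ y = xMon R l ν} := by
  have key : Submonoid.closure (x R l '' A) ≤ xMonSubmonoid R l A := by
    rw [Submonoid.closure_le]
    rintro _ ⟨i, hi, rfl⟩
    refine ⟨Pi.single i 1, fun j hj => ?_, by rw [xMon_single, pow_one]⟩
    rw [Pi.single_eq_of_ne]
    rintro rfl
    exact hj hi
  have h : f ∈ Submodule.span R (Submonoid.closure (x R l '' A) : Set (Gr R l d)) := by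
    rw [← Algebra.adjoin_eq_span]
    exact hf
  exact Submodule.span_mono (fun y hy => key hy) h

lemma xMon_mem_polyOn {A : Set (Fin d)} {ν : Fin d → ℕ} (hν : ∀ j ∉ A, ν j = 0) :
    xMon R l ν ∈ polyOn R l A := by
  refine Subalgebra.list_prod_mem _ fun y hy => ?_
  obtain ⟨j, rfl⟩ := (List.mem_ofFn' _ _).1 hy
  beta_reduce
  by_cases hj : j ∈ A
  · exact pow_mem (Algebra.subset_adjoin (Set.mem_image_of_mem _ hj)) _
  · rw [hν j hj, pow_zero]
    exact one_mem _

variable [NeZero l]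

/-- The projection to exponents below `l` commutes with every left multiplication and fixes the
unit, so it fixes all coefficient functions. -/
lemma coef_eq_zero_of_le (z : Gr R l d) {ν : Fin d → ℕ} {j : Fin d} (hj : l ≤ ν j) (w α) :
    coef R l d z ν w α = 0 := by
  have hvac : truncProj R l (vac R (d := d)) = vac R := by
    funext ν w α
    simp only [truncProj_apply, vac]
    by_cases h : ν = 0
    · subst h; simp [Nat.pos_of_ne_zero (NeZero.ne l)]
    · simp [h]
  have h : coef R l d z = truncProj R l (coef R l d z) := by
    have key : rho R l d z (truncProj R l (vac R)) = truncProj R l (rho R l d z (vac R)) := by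
      refine rho_comm _ (fun i => ?_) (fun i => ?_) (fun v => ?_) z _
      · ext φ ν w α
        simp only [Module.End.mul_apply, truncProj_apply, actX_apply]
        by_cases h : 1 ≤ ν i ∧ ν i < l
        · have : (∀ j, ν j < l) ↔ ∀ j, (ν - Pi.single i 1 : Fin d → ℕ) j < l := by
            refine forall_congr' fun j => ?_
            by_cases hj : j = i
            · subst hj; simp; omega
            · simp [hj]
          simp only [h, this, and_self, if_true]
        · simp [h]
      · ext φ ν w α
        simp only [Module.End.mul_apply, truncProj_apply, actC_apply]
        split_ifs <;> simp
      · ext φ ν w α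
        simp only [Module.End.mul_apply, truncProj_apply, actS_apply, Function.comp_apply]
        have : (∀ j, ν (v j) < l) ↔ ∀ j, ν j < l :=
          ⟨fun h j => by simpa using h (v.symm j), fun h j => h _⟩
        simp only [this]
    rwa [hvac] at key
  rw [h, truncProj_apply, if_neg]
  push Not
  exact ⟨j, hj⟩

lemma lt_of_coef_ne_zero {z : Gr R l d} {ν : Fin d → ℕ} {w α}
    (h : coef R l d z ν w α ≠ 0) (j : Fin d) : ν j < l := by
  by_contra hj
  exact h (coef_eq_zero_of_le z (not_lt.1 hj) w α)

/-- The coefficients of an even element are supported on even signs. -/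
lemma coef_eq_zero_of_even (h2 : (2 : R) ∈ nonZeroDivisors R) {z : Gr R l d}
    (hz : z ∈ evenPart R l d) (ν w) {α : Fin d → ZMod 2} (hα : ∑ k, α k = 1) :
    coef R l d z ν w α = 0 := by
  have hx : ∀ i, Commute (parityOp R (d := d)) (actX R l i) := by
    intro i
    ext φ ν w α
    simp only [Module.End.mul_apply, parityOp_apply, actX_apply]
    split_ifs <;> simp
  have hs : ∀ v, Commute (parityOp R (d := d)) (actS R v) := by
    intro v
    ext φ ν w α
    simp only [Module.End.mul_apply, parityOp_apply, actS_apply]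
  -- A single `c_i` anticommutes with the parity operator; the pairs that generate the even part
  -- commute with it.
  have hc : ∀ i j, Commute (parityOp R (d := d)) (actC R i * actC R j) := by
    intro i j
    ext φ ν w α
    simp only [Module.End.mul_apply, parityOp_apply, actC_apply, sum_add_single, sg_add, sg_one]
    ring
  have h : z ∈ (Subalgebra.centralizer R {parityOp R}).comap (rho R l d) := by
    refine (Algebra.adjoin_le ?_ : evenPart R l d ≤ _) hz
    rintro _ ((⟨i, rfl⟩ | ⟨v, rfl⟩) | ⟨i, j, rfl⟩) <;>
      simp only [Subalgebra.coe_comap, Set.mem_preimage, SetLike.mem_coe,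
        Subalgebra.mem_centralizer_iff, Set.mem_singleton_iff, forall_eq, rho_x, rho_s, map_mul,
        rho_c]
    exacts [(hx i).eq, (hs v).eq, (hc i j).eq]
  simp only [Subalgebra.mem_comap, Subalgebra.mem_centralizer_iff, Set.mem_singleton_iff,
    forall_eq] at h
  have h0 : parityOp R (vac R (d := d)) = vac R := by
    funext ν w α
    simp only [parityOp_apply, vac]
    by_cases h : α = 0
    · subst h; simp
    · simp [h]
  have h1 := congrFun (congrFun (congrFun (LinearMap.congr_fun h (vac R)) ν) w) α
  rw [Module.End.mul_apply, Module.End.mul_apply, h0, ← coef_def, parityOp_apply, hα,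
    sg_one] at h1
  -- At an odd vector the coefficient equals its own negative.
  have h3 : coef R l d z ν w α * 2 = 0 := by linear_combination -h1
  exact (mul_right_mem_nonZeroDivisors_eq_zero_iff h2).1 h3

lemma coef_xMon_mul (μ : Fin d → ℕ) (z : Gr R l d) (ν w α) :
    coef R l d (xMon R l μ * z) ν w α =
      if ∀ j, μ j ≤ ν j ∧ ν j < l then coef R l d z (ν - μ) w α else 0 := by
  obtain ⟨n, hn⟩ : ∃ n, ∑ j, μ j = n := ⟨_, rfl⟩
  induction n generalizing μ ν with
  | zero =>
    have : μ = 0 := by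
      funext j
      simpa using (Finset.sum_eq_zero_iff.1 hn) j
    subst this
    simp only [xMon_zero, one_mul, tsub_zero, Pi.zero_apply, zero_le, true_and]
    split_ifs with h
    · rfl
    · push Not at h
      obtain ⟨j, hj⟩ := h
      exact coef_eq_zero_of_le z hj w α
  | succ n ih =>
    obtain ⟨i, -, hi⟩ : ∃ i ∈ Finset.univ, μ i ≠ 0 := by
      apply Finset.exists_ne_zero_of_sum_ne_zero
      omega
    have hμ : μ = (μ - Pi.single i 1) + Pi.single i 1 := by
      funext j
      by_cases hj : j = i
      · subst hj; simp; omega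
      · simp [hj]
    have hsum : ∑ j, (μ - Pi.single i 1 : Fin d → ℕ) j = n := by
      have : ∑ j, μ j = ∑ j, (μ - Pi.single i 1 : Fin d → ℕ) j + 1 := by
        conv_lhs => rw [hμ]
        simp [Finset.sum_add_distrib]
      omega
    have h1 : xMon R l μ * z = x R l i * (xMon R l (μ - Pi.single i 1) * z) := by
      rw [← mul_assoc, x_mul_xMon, ← hμ]
    rw [h1, coef_x_mul]
    by_cases hν : 1 ≤ ν i ∧ ν i < l
    · rw [if_pos hν, ih _ _ hsum]
      have e1 : (ν - Pi.single i 1 - (μ - Pi.single i 1) : Fin d → ℕ) = ν - μ := by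
        funext j
        by_cases hj : j = i
        · subst hj; simp; omega
        · simp [hj]
      have e2 : (∀ j, (μ - Pi.single i 1 : Fin d → ℕ) j ≤ (ν - Pi.single i 1 : Fin d → ℕ) j ∧
          (ν - Pi.single i 1 : Fin d → ℕ) j < l) ↔ ∀ j, μ j ≤ ν j ∧ ν j < l := by
        refine forall_congr' fun j => ?_
        by_cases hj : j = i
        · subst hj; simp; omega
        · simp [hj]
      simp only [e1, e2]
    · rw [if_neg hν, if_neg]
      intro h2
      have := h2 i
      omega

lemma coef_s (w : Equiv.Perm (Fin d)) (ν w' α) :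
    coef R l d (s R l w) ν w' α = if ν = 0 ∧ w' = w ∧ α = 0 then 1 else 0 := by
  rw [← mul_one (s R l w), coef_s_mul, coef_one, vac]
  have h1 : ν ∘ w = 0 ↔ ν = 0 :=
    ⟨fun h => funext fun j => by simpa using congrFun h (w.symm j), fun h => by simp [h]⟩
  simp only [h1, inv_mul_eq_one, eq_comm (a := w)]

lemma coef_xMon_mul_s (μ : Fin d → ℕ) (w : Equiv.Perm (Fin d)) (ν w' α) :
    coef R l d (xMon R l μ * s R l w) ν w' α =
      if ν = μ ∧ (∀ j, ν j < l) ∧ w' = w ∧ α = 0 then 1 else 0 := by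
  rw [coef_xMon_mul, coef_s]
  by_cases h : ν = μ
  · subst h; simp [ite_and]
  · rw [if_neg (c := ν = μ ∧ _) (fun h1 => h h1.1)]
    split_ifs with h1 h2
    · exact absurd (le_antisymm (tsub_eq_zero_iff_le.1 h2.1) fun j => (h1 j).1) h
    · rfl
    · rfl

lemma coef_xMon (μ : Fin d → ℕ) (ν w α) : coef R l d (xMon R l μ) ν w α =
    if ν = μ ∧ (∀ j, ν j < l) ∧ w = 1 ∧ α = 0 then 1 else 0 := by
  rw [← coef_xMon_mul_s, s_one, mul_one]

/-- Right multiplication by an ordered monomial in the `c_i` permutes the coefficients up to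
sign. -/
lemma exists_coef_mul_prod_c {n : ℕ} (u : Fin n → Fin d) (a : Fin n → ZMod 2)
    (β : Fin d → ZMod 2) : ∃ r : ZMod 2, ∀ (y : Gr R l d) (ν w),
      coef R l d (y * (List.ofFn fun k => c R l (u k) ^ (a k).val).prod) ν w β =
        sg R r * coef R l d y ν w (β + ∑ k, Pi.single (u k) (a k)) := by
  induction n generalizing β with
  | zero => exact ⟨0, fun y ν w => by simp⟩
  | succ n ih =>
    obtain ⟨r, hr⟩ := ih (fun k => u k.succ) (fun k => a k.succ) β
    rcases zmod_two_cases (a 0) with h | h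
    · refine ⟨r, fun y ν w => ?_⟩
      rw [List.ofFn_succ, List.prod_cons, ← mul_assoc, hr, Fin.sum_univ_succ, h]
      simp
    · refine ⟨r + post (β + ∑ k : Fin n, Pi.single (u k.succ) (a k.succ)) (u 0),
        fun y ν w => ?_⟩
      rw [List.ofFn_succ, List.prod_cons, ← mul_assoc, hr, Fin.sum_univ_succ, h, ZMod.val_one,
        pow_one, coef_mul_c, sg_add, mul_assoc, add_assoc, add_comm (∑ k : Fin n, _)]

lemma exists_coef_mul_cFull (α β : Fin d → ZMod 2) : ∃ r : ZMod 2, ∀ (y : Gr R l d) (ν w),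
    coef R l d (y * cFull R l α) ν w β = sg R r * coef R l d y ν w (β + α) := by
  obtain ⟨r, hr⟩ := exists_coef_mul_prod_c (R := R) (l := l) (fun k => k) α β
  rw [sum_single_eq] at hr
  exact ⟨r, hr⟩

/-- An element is determined by its coefficients. -/
lemma eq_zero_of_coef {z : Gr R l d} (hz : ∀ ν w α, coef R l d z ν w α = 0) : z = 0 := by
  obtain ⟨a, rfl⟩ := (Submodule.mem_span_range_iff_exists_fun R).1 (span_monomials z)
  refine Finset.sum_eq_zero fun i _ => ?_
  have h := hz (fun j => i.1 j) i.2.1 i.2.2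
  rw [map_sum] at h
  simp only [Finset.sum_apply, map_smul, Pi.smul_apply] at h
  -- Reading the coefficient at the index of the term `i` isolates its scalar: right multiplication
  -- by `c_α` carries the index `α` to 0 and every other one elsewhere.
  rw [Finset.sum_eq_single i] at h
  · obtain ⟨r, hr⟩ := exists_coef_mul_cFull (R := R) (l := l) i.2.2 i.2.2
    have hadd : i.2.2 + i.2.2 = 0 := funext fun j => zmod_two_add_self _
    rw [hr, coef_xMon_mul_s, hadd, if_pos (by simp), mul_one, smul_eq_mul] at h
    rw [(isUnit_sg R r).mul_left_eq_zero.1 h, zero_smul]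
  · intro k _ hk
    obtain ⟨r, hr⟩ := exists_coef_mul_cFull (R := R) (l := l) k.2.2 i.2.2
    rw [hr, coef_xMon_mul_s, if_neg, mul_zero, smul_zero]
    rintro ⟨e1, -, e2, e3⟩
    apply hk
    refine Prod.ext (funext fun j => Fin.ext (congrFun e1 j).symm) (Prod.ext e2.symm ?_)
    funext j
    exact ((CharTwo.add_eq_zero).1 (congrFun e3 j)).symm
  · simp

/-- From here on, equalities in the algebra are proved by comparing coefficients. -/
lemma coef_injective : Function.Injective (coef R l d) := by
  intro y z h
  have h0 : y + (-1 : R) • z = 0 := by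
    refine eq_zero_of_coef fun ν w α => ?_
    rw [map_add, map_smul, h]
    simp
  have h1 : z + (-1 : R) • z = 0 := by
    refine eq_zero_of_coef fun ν w α => ?_
    rw [map_add, map_smul]
    simp
  have h2 : (-1 : R) • z + z = 0 := by rw [add_comm, h1]
  calc y = y + ((-1 : R) • z + z) := by rw [h2, add_zero]
    _ = z := by rw [← add_assoc, h0, zero_add]

/-! ### Polynomials -/

lemma coef_poly_mul_s {A : Set (Fin d)} {f : Gr R l d} (hf : f ∈ polyOn R l A)
    (w : Equiv.Perm (Fin d)) (ν w' α) : coef R l d (f * s R l w) ν w' α =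
      if w' = w ∧ α = 0 then coef R l d f ν 1 0 else 0 := by
  have hf' := polyOn_le_span hf
  clear hf
  induction hf' using Submodule.span_induction with
  | mem y hy =>
    obtain ⟨μ, -, rfl⟩ := hy
    rw [coef_xMon_mul_s, coef_xMon]
    simp only [← ite_and]
    congr 1
    simp only [and_true, eq_iff_iff]
    tauto
  | zero => simp
  | add y z _ _ hy hz =>
    rw [add_mul, map_add, Pi.add_apply, Pi.add_apply, Pi.add_apply, hy, hz, map_add]
    split_ifs <;> simp
  | smul r y _ hy =>
    rw [smul_mul_assoc, map_smul, Pi.smul_apply, Pi.smul_apply, Pi.smul_apply, hy, map_smul]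
    split_ifs <;> simp

lemma coef_poly {A : Set (Fin d)} {f : Gr R l d} (hf : f ∈ polyOn R l A) (ν w α) :
    coef R l d f ν w α = if w = 1 ∧ α = 0 then coef R l d f ν 1 0 else 0 := by
  have := coef_poly_mul_s hf 1 ν w α
  rwa [s_one, mul_one] at this

lemma coef_poly_eq_zero {A : Set (Fin d)} {f : Gr R l d} (hf : f ∈ polyOn R l A)
    {ν : Fin d → ℕ} {j : Fin d} (hj : j ∉ A) (hν : ν j ≠ 0) (w α) : coef R l d f ν w α = 0 := by
  have hf' := polyOn_le_span hf
  clear hf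
  induction hf' using Submodule.span_induction with
  | mem y hy =>
    obtain ⟨μ, hμ, rfl⟩ := hy
    rw [coef_xMon, if_neg]
    rintro ⟨rfl, -⟩
    exact hν (hμ j hj)
  | zero => simp
  | add y z _ _ hy hz =>
    rw [map_add, Pi.add_apply, Pi.add_apply, Pi.add_apply, hy, hz, add_zero]
  | smul r y _ hy =>
    rw [map_smul, Pi.smul_apply, Pi.smul_apply, Pi.smul_apply, hy, smul_zero]

lemma poly_expansion {A : Set (Fin d)} {f : Gr R l d} (hf : f ∈ polyOn R l A) :
    f = ∑ ν : Fin d → Fin l, coef R l d f (fun j => ν j) 1 0 • xMon R l (fun j => (ν j : ℕ)) := by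
  apply coef_injective
  funext ν w α
  rw [coef_poly hf, map_sum]
  simp only [Finset.sum_apply, map_smul, Pi.smul_apply, coef_xMon, smul_eq_mul]
  by_cases hν : ∀ j, ν j < l
  · rw [Finset.sum_eq_single (fun j => ⟨ν j, hν j⟩)]
    · simp only [hν, implies_true, true_and]
      split_ifs <;> simp
    · intro μ _ hμ
      rw [if_neg, mul_zero]
      rintro ⟨e, -⟩
      exact hμ (funext fun j => Fin.ext (congrFun e j).symm)
    · simp
  · have hν' := hν
    push Not at hν'
    obtain ⟨j, hj⟩ := hν'
    simp only [hν, false_and, and_false, if_false, mul_zero, Finset.sum_const_zero,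
      coef_eq_zero_of_le f hj, ite_self]

/-- With `eq_of_coef_x_pow_mul` this turns `IsMaxDegree` into a condition on the support: as
exponents stay below `l`, divisibility by the top power means exponent exactly `l - 1`. -/
lemma x_pow_dvd_of_coef {A : Set (Fin d)} {f : Gr R l d} (hf : f ∈ polyOn R l A) (j : Fin d)
    (h : ∀ ν : Fin d → ℕ, coef R l d f ν 1 0 ≠ 0 → ν j = l - 1) : x R l j ^ (l - 1) ∣ f := by
  rw [poly_expansion hf]
  refine Finset.dvd_sum fun ν _ => ?_
  by_cases h0 : coef R l d f (fun j => ν j) 1 0 = 0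
  · rw [h0, zero_smul]; exact dvd_zero _
  · have hν := h _ h0
    have : xMon R l (fun j => (ν j : ℕ)) = x R l j ^ (l - 1) *
        xMon R l ((fun j => (ν j : ℕ)) - Pi.single j (l - 1)) := by
      rw [x_pow_mul_xMon]
      congr 1
      funext k
      by_cases hk : k = j
      · subst hk; simp [hν]
      · simp [hk]
    rw [this, ← mul_smul_comm]
    exact dvd_mul_right _ _

lemma eq_of_coef_x_pow_mul {j : Fin d} {f : Gr R l d} (hf : x R l j ^ (l - 1) ∣ f)
    {ν : Fin d → ℕ} {w α} (h : coef R l d f ν w α ≠ 0) : ν j = l - 1 := by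
  obtain ⟨g, rfl⟩ := hf
  have hlt := lt_of_coef_ne_zero h j
  rw [← xMon_single, coef_xMon_mul] at h
  by_contra hne
  apply h
  rw [if_neg]
  intro h1
  have := (h1 j).1
  simp only [Pi.single_eq_same] at this
  omega

end Coefficients

/-! ### Cycles and the Clifford generators -/

section Cycles

variable (R : Type*) [CommRing R] (l : ℕ) {d : ℕ}

/-- The exponent vector on `A` with entries `ρ`. -/
def expo (A : List (Fin d)) (ρ : Fin A.length → ℕ) : Fin d → ℕ :=
  ∑ k, Pi.single (A.get k) (ρ k)

/-- The homogeneous sum of degree `n` on `A` with the variables signed by `ε`. -/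
noncomputable def hSigned (A : List (Fin d)) (n : ℕ) (ε : Fin A.length → ZMod 2) : Gr R l d :=
  ∑ ρ ∈ Finset.Nat.antidiagonalTuple A.length n,
    sg R (∑ k, ε k * (ρ k : ZMod 2)) • xMon R l (expo A ρ)

lemma natCast_epsExp {a : ℕ} (α : Fin a → ZMod 2) (j : Fin a) :
    ((epsExp α j : ℕ) : ZMod 2) = pre α j := by
  simp [epsExp, pre, Finset.sum_filter]

lemma natCast_weight {a : ℕ} (α : Fin a → ZMod 2) : ((weight α : ℕ) : ZMod 2) = ∑ k, α k := by
  simp [weight]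

lemma prod_ofFn_smul {B : Type*} [Semiring B] [Algebra R B] {n : ℕ} (r : Fin n → R)
    (u : Fin n → B) :
    (List.ofFn fun k => r k • u k).prod = (∏ k, r k) • (List.ofFn u).prod := by
  induction n with
  | zero => simp
  | succ n ih =>
    rw [List.ofFn_succ, List.prod_cons, ih (fun k => r k.succ) (fun k => u k.succ),
      smul_mul_smul_comm, Fin.prod_univ_succ, List.ofFn_succ, List.prod_cons]

lemma sg_sum {ι : Type*} (t : Finset ι) (f : ι → ZMod 2) :
    sg R (∑ k ∈ t, f k) = ∏ k ∈ t, sg R (f k) := by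
  classical
  induction t using Finset.induction_on with
  | empty => simp
  | insert a t ha ih => rw [Finset.sum_insert ha, Finset.prod_insert ha, sg_add, ih]

lemma sg_mul_natCast (e : ZMod 2) (n : ℕ) : sg R (e * n) = sg R e ^ n := by
  induction n with
  | zero => simp
  | succ n ih => rw [Nat.cast_succ, mul_add, mul_one, sg_add, ih, pow_succ]

/-- The polynomial depends on `α` only through the signs `pre α`, so passing a Clifford generator
through it just changes a sign vector. -/
lemma h_eq_hSigned (A : List (Fin d)) (r : ℕ) (α : Fin A.length → ZMod 2) :
    h R l A r α = hSigned R l A ((A.length - 1) * (l - 1) + r) (pre α) := by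
  refine Finset.sum_congr rfl fun ρ _ => ?_
  have h1 : (fun j => ((-1) ^ epsExp α j * x R l (A.get j)) ^ ρ j) =
      fun j => sg R (pre α j * (ρ j : ZMod 2)) • x R l (A.get j) ^ ρ j := by
    funext j
    rw [neg_one_pow_mul, smul_pow, natCast_epsExp, sg_mul_natCast]
  rw [h1, prod_ofFn_smul, ← sg_sum, prod_x_pow]
  rfl

lemma expo_get {A : List (Fin d)} (hA : A.Nodup) (ρ : Fin A.length → ℕ) (k : Fin A.length) :
    expo A ρ (A.get k) = ρ k := by
  rw [expo, Finset.sum_apply, Finset.sum_eq_single k]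
  · rw [Pi.single_eq_same]
  · intro j _ hj
    rw [Pi.single_eq_of_ne]
    rwa [ne_eq, hA.get_inj_iff, eq_comm]
  · simp

lemma expo_eq_zero {A : List (Fin d)} (ρ : Fin A.length → ℕ) {j : Fin d} (hj : j ∉ A) :
    expo A ρ j = 0 := by
  rw [expo, Finset.sum_apply]
  refine Finset.sum_eq_zero fun k _ => ?_
  rw [Pi.single_eq_of_ne]
  rintro rfl
  exact hj (A.get_mem k)

lemma c_mul_hSigned {A : List (Fin d)} (hA : A.Nodup) (n : ℕ) (ε : Fin A.length → ZMod 2)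
    (k : Fin A.length) : c R l (A.get k) * hSigned R l A n ε =
      hSigned R l A n (ε + Pi.single k 1) * c R l (A.get k) := by
  rw [hSigned, hSigned, Finset.mul_sum, Finset.sum_mul]
  refine Finset.sum_congr rfl fun ρ _ => ?_
  rw [mul_smul_comm, c_mul_xMon, expo_get hA, smul_smul, smul_mul_assoc, ← sg_add]
  congr 2
  simp [add_mul, Finset.sum_add_distrib, Pi.single_apply]

lemma c_mul_hSigned_of_notMem {A : List (Fin d)} (n : ℕ) (ε : Fin A.length → ZMod 2)
    {j : Fin d} (hj : j ∉ A) :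
    c R l j * hSigned R l A n ε = hSigned R l A n ε * c R l j := by
  rw [hSigned, Finset.mul_sum, Finset.sum_mul]
  refine Finset.sum_congr rfl fun ρ _ => ?_
  rw [mul_smul_comm, c_mul_xMon, expo_eq_zero ρ hj, smul_mul_assoc]
  simp

/-- Homogeneity. This is how the degree, and with it `r`, enters the commutation sign at the head of
a block. -/
lemma hSigned_add_one (A : List (Fin d)) (n : ℕ) (ε : Fin A.length → ZMod 2) :
    hSigned R l A n (ε + 1) = sg R (n : ZMod 2) • hSigned R l A n ε := by
  rw [hSigned, hSigned, Finset.smul_sum]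
  refine Finset.sum_congr rfl fun ρ hρ => ?_
  rw [smul_smul, ← sg_add, ← Finset.Nat.mem_antidiagonalTuple.1 hρ]
  congr 2
  simp [add_mul, Finset.sum_add_distrib, add_comm]

lemma c_mul_cMon {A : List (Fin d)} (hA : A.Nodup) (α : Fin A.length → ZMod 2)
    (k : Fin A.length) : c R l (A.get k) * cMon R l A α =
      sg R (pre α k) • cMon R l A (α + Pi.single k 1) :=
  clifford_mul_prod (R := R) (fun k => c R l (A.get k)) (fun _ => c_mul_self R l _)
    (fun _ _ hij => c_mul_c_of_ne R l _ _ fun h => hij (hA.get_inj_iff.1 h)) α k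

lemma c_mul_cMon_comm {A : List (Fin d)} (hA : A.Nodup) (α : Fin A.length → ZMod 2)
    (k : Fin A.length) : c R l (A.get k) * cMon R l A α =
      sg R (∑ j, α j + α k) • (cMon R l A α * c R l (A.get k)) := by
  have := mul_prod_ofFn_pow (R := R) (fun k => c R l (A.get k)) (c R l (A.get k))
    (fun j => if k = j then 0 else 1)
    (fun j => by simpa only [hA.get_inj_iff] using c_mul_c R l (A.get k) (A.get j))
    (fun j => (α j).val)
  rw [cMon, this]
  congr 2
  have h1 : α k = ∑ j, if k = j then α j else 0 := by simp
  rw [h1, ← Finset.sum_add_distrib]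
  refine Finset.sum_congr rfl fun j _ => ?_
  rw [val_cast_zmod_two]
  split_ifs
  · rw [zero_mul, zmod_two_add_self]
  · simp

lemma c_mul_cMon_of_notMem {A : List (Fin d)} (α : Fin A.length → ZMod 2) {j : Fin d}
    (hj : j ∉ A) :
    c R l j * cMon R l A α = sg R (∑ j, α j) • (cMon R l A α * c R l j) := by
  have := mul_prod_ofFn_pow (R := R) (fun k => c R l (A.get k)) (c R l j) (fun _ => 1)
    (fun k => by
      have := c_mul_c R l j (A.get k)
      rwa [if_neg] at this
      rintro rfl
      exact hj (A.get_mem k))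
    (fun j => (α j).val)
  simpa [cMon] using this

/-- The sum `∑ τ_α A^{(r,α)}` over all `α` of parity `p`. -/
noncomputable def signedCycle (A : List (Fin d)) (r : ℕ) (p : ZMod 2) : Gr R l d :=
  ∑ α : Fin A.length → ZMod 2 with ∑ k, α k = p,
    sg R ((tauExp α : ℕ) : ZMod 2) • xCycle R l A r α

lemma cxElem_eq_signedCycle (A : List (Fin d)) (r : ℕ) :
    cxElem R l A r = signedCycle R l A r 0 := by
  rw [cxElem, signedCycle]
  refine Finset.sum_congr ?_ fun α _ => neg_one_pow_mul R l _ _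
  rw [evenVec]
  ext α
  rw [Finset.mem_filter, Finset.mem_filter, ← natCast_weight, ZMod.natCast_eq_zero_iff_even]

/-- Toggling two entries preserves the parity of the weight, so the rounding in `weight α / 2` is
harmless even for odd `α`. Half the weight changes by `1 - α_j - α_k`, and the linear part by `j +
k` modulo 2, whether positions are counted from 0 or from 1. -/
lemma natCast_tauExp_add {a : ℕ} (α : Fin a → ZMod 2) {j k : Fin a} (hjk : j ≠ k) :
    ((tauExp (α + Pi.single j 1 + Pi.single k 1) : ℕ) : ZMod 2) =
      (tauExp α : ℕ) + 1 + (j : ℕ) + (k : ℕ) + α j + α k := by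
  set β := α + Pi.single j 1 + Pi.single k 1 with hβ
  have hval : ∀ b : ZMod 2, (b + 1).val = 1 - b.val ∧ b.val ≤ 1 := by decide
  have hj : (β j).val = 1 - (α j).val ∧ (α j).val ≤ 1 := by
    have : β j = α j + 1 := by simp [hβ, hjk]
    rw [this]; exact hval _
  have hk : (β k).val = 1 - (α k).val ∧ (α k).val ≤ 1 := by
    have : β k = α k + 1 := by simp [hβ, hjk.symm]
    rw [this]; exact hval _
  have hsplit : ∀ g : Fin a → ℕ,
      ∑ i, g i = g j + g k + ∑ i ∈ (Finset.univ.erase j).erase k, g i := by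
    intro g
    rw [add_assoc, Finset.add_sum_erase _ _ (by simp [hjk.symm]),
      Finset.add_sum_erase _ _ (Finset.mem_univ j)]
  have hrest : ∀ m : Fin a → ℕ, ∑ i ∈ (Finset.univ.erase j).erase k, m i * (β i).val =
      ∑ i ∈ (Finset.univ.erase j).erase k, m i * (α i).val := by
    intro m
    refine Finset.sum_congr rfl fun i hi => ?_
    simp only [Finset.mem_erase, Finset.mem_univ, and_true] at hi
    have : β i = α i := by simp [hβ, hi.1, hi.2]
    rw [this]
  have hw : weight β + 2 * (α j).val + 2 * (α k).val = weight α + 2 := by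
    have := hrest 1
    simp only [Pi.one_apply, one_mul] at this
    rw [weight, weight, hsplit, hsplit fun i => (α i).val, this, hj.1, hk.1]
    have := hj.2
    have := hk.2
    omega
  have ht : (∑ i : Fin a, ((i : ℕ) + 1) * (β i).val) + 2 * (((j : ℕ) + 1) * (α j).val) +
      2 * (((k : ℕ) + 1) * (α k).val) =
      (∑ i : Fin a, ((i : ℕ) + 1) * (α i).val) + ((j : ℕ) + 1) + ((k : ℕ) + 1) := by
    rw [hsplit, hsplit fun i => ((i : ℕ) + 1) * (α i).val, hrest, hj.1, hk.1]
    have e1 : ((j : ℕ) + 1) * (1 - (α j).val) + ((j : ℕ) + 1) * (α j).val = (j : ℕ) + 1 := by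
      rw [← mul_add, Nat.sub_add_cancel hj.2, mul_one]
    have e2 : ((k : ℕ) + 1) * (1 - (α k).val) + ((k : ℕ) + 1) * (α k).val = (k : ℕ) + 1 := by
      rw [← mul_add, Nat.sub_add_cancel hk.2, mul_one]
    linarith
  have hw' : weight β / 2 + (α j).val + (α k).val = weight α / 2 + 1 := by omega
  have c1 := congrArg (Nat.cast : ℕ → ZMod 2) ht
  have c2 := congrArg (Nat.cast : ℕ → ZMod 2) hw'
  have h2 : (2 : ZMod 2) = 0 := by decide
  push_cast at c1 c2
  rw [val_cast_zmod_two, val_cast_zmod_two] at c1 c2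
  rw [h2] at c1
  simp only [zero_mul, add_zero] at c1
  rw [tauExp, tauExp]
  push_cast
  rw [c1]
  linear_combination c2 + h2 * (1 - α j - α k)

lemma sum_add_single_add_single {a : ℕ} (α : Fin a → ZMod 2) (j k : Fin a) :
    ∑ i, (α + Pi.single j 1 + Pi.single k 1 : Fin a → ZMod 2) i = ∑ i, α i := by
  rw [sum_add_single, sum_add_single, add_assoc, zmod_two_add_self, add_zero]

lemma c_mul_sigma_get {A : List (Fin d)} {k k' : Fin A.length}
    (h : A.formPerm (A.get k') = A.get k) :
    c R l (A.get k) * sigma R l A = sigma R l A * c R l (A.get k') := by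
  rw [sigma, s_mul_c, h]

/-- As `c_k σ = σ c_{k'}`, multiplying by `c_k` on the left toggles entry `k'` of `α`, while
multiplying on the right toggles entry `k`. The term of `α` on one side thus matches that of `α +
e_k + e_{k'}` on the other, and what is left to verify is that the relative sign `q` is the same for
all `α`. A value `δ = 1` records that all variables change sign at once. -/
lemma c_mul_signedCycle_aux {A : List (Fin d)} (hA : A.Nodup) (r : ℕ) (p q : ZMod 2)
    {k k' : Fin A.length} (hk : k' ≠ k) (hσ : A.formPerm (A.get k') = A.get k) (δ : ZMod 2)
    (hδ : ∀ α : Fin A.length → ZMod 2, pre (α + Pi.single k' 1 + Pi.single k 1) =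
      pre α + Pi.single k 1 + fun _ => δ)
    (hq : ∀ α : Fin A.length → ZMod 2, ∑ i, α i = p → q = (k : ℕ) + (k' : ℕ) + α k' + pre α k' +
      pre α k + p + (if k' < k then 1 else 0) +
        δ * (((A.length - 1) * (l - 1) + r : ℕ) : ZMod 2)) :
    c R l (A.get k) * signedCycle R l A r p =
      sg R q • (signedCycle R l A r p * c R l (A.get k)) := by
  rw [signedCycle, Finset.mul_sum, Finset.sum_mul, Finset.smul_sum]
  have hinv : ∀ α : Fin A.length → ZMod 2,
      α + Pi.single k' 1 + Pi.single k 1 + Pi.single k' 1 + Pi.single k 1 = α := fun α => by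
    rw [add_right_comm (α + Pi.single k' 1), char_two_add_single, char_two_add_single]
  refine Finset.sum_nbij' (fun α => α + Pi.single k' 1 + Pi.single k 1)
    (fun α => α + Pi.single k' 1 + Pi.single k 1) ?_ ?_ ?_ ?_ ?_
  · intro α hα
    rw [Finset.mem_filter] at hα ⊢
    exact ⟨Finset.mem_univ _, by rw [sum_add_single_add_single, hα.2]⟩
  · intro α hα
    rw [Finset.mem_filter] at hα ⊢
    exact ⟨Finset.mem_univ _, by rw [sum_add_single_add_single, hα.2]⟩
  · intro α _; exact hinv α
  · intro α _; exact hinv α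
  · intro α hα
    have hp : ∑ i, α i = p := (Finset.mem_filter.1 hα).2
    set n := (A.length - 1) * (l - 1) + r
    set β := α + Pi.single k' 1 + Pi.single k 1 with hβ
    have hβk : β + Pi.single k 1 = α + Pi.single k' 1 := char_two_add_single _ _
    have hβv : β k = α k + 1 := by simp [hβ, hk.symm]
    have hβs : ∑ i, β i = p := by rw [hβ, sum_add_single_add_single, hp]
    have hpk : pre β k = pre α k + if k' < k then 1 else 0 := by
      rw [hβ, pre_add, pre_add, pre_single, pre_single, if_neg (lt_irrefl k), add_zero]
    have hh : hSigned R l A n (pre β) =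
        sg R (δ * n) • hSigned R l A n (pre α + Pi.single k 1) := by
      rw [hβ, hδ]
      rcases zmod_two_cases δ with rfl | rfl
      · have : (fun _ => 0 : Fin A.length → ZMod 2) = 0 := rfl
        rw [this, add_zero, zero_mul, sg_zero, one_smul]
      · rw [one_mul]; exact hSigned_add_one R l A n _
    have hc : cMon R l A β * c R l (A.get k) =
        sg R (p + β k + pre β k) • cMon R l A (α + Pi.single k' 1) := by
      have h1 := c_mul_cMon_comm R l hA β k
      rw [c_mul_cMon R l hA, hβk, hβs] at h1
      rw [sg_add, mul_smul, h1, sg_smul_sg_smul]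
    rw [xCycle, xCycle, h_eq_hSigned, h_eq_hSigned, mul_smul_comm, ← mul_assoc, ← mul_assoc,
      c_mul_hSigned R l hA, mul_assoc (hSigned _ _ _ _ _), c_mul_sigma_get R l hσ, mul_assoc,
      mul_assoc, c_mul_cMon R l hA, smul_mul_assoc, mul_assoc (hSigned _ _ _ _ _ * _), hc, hh]
    simp only [mul_smul_comm, smul_mul_assoc, smul_smul, ← sg_add, mul_assoc]
    congr 2
    rw [hβ, natCast_tauExp_add α hk, ← hβ, hβv, hpk, hq α hp]
    have h2 : (2 : ZMod 2) = 0 := by decide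
    linear_combination (-(k : ℕ) - (k' : ℕ) - α k - α k' - p - pre α k - δ * n - 1
      - (if k' < k then 1 else 0)) * h2

variable {l} in
-- The head is the image of the last letter. Toggling the first and last entries alters `pre`
-- everywhere except at the first place, that is by `e_k + 1`. The constant 1 costs the degree
-- `(a-1)(l-1) + r`, the distance of the two places costs `a - 1`, and together they give `(a-1)l +
-- r`.
lemma c_mul_signedCycle_head (hl : 1 ≤ l) {A : List (Fin d)} (hne : A ≠ []) (hA : A.Nodup)
    (r : ℕ) (p : ZMod 2) : c R l (A.head hne) * signedCycle R l A r p =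
      sg R (((A.length - 1) * l + r : ℕ) : ZMod 2) •
        (signedCycle R l A r p * c R l (A.head hne)) := by
  have hlen : 0 < A.length := List.length_pos_iff.2 hne
  set k : Fin A.length := ⟨0, hlen⟩ with hk
  have hhead : A.head hne = A.get k := by simp [hk, List.head_eq_getElem]
  rw [hhead]
  have hpre0 : ∀ α : Fin A.length → ZMod 2, pre α k = 0 := fun α => by
    refine Finset.sum_eq_zero fun j _ => if_neg ?_
    simp [hk, Fin.lt_def]
  rcases Nat.lt_or_ge 1 A.length with h1 | h1
  · set k' : Fin A.length := ⟨A.length - 1, by omega⟩ with hk'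
    have hlast : ∀ α : Fin A.length → ZMod 2, pre α k' + α k' = ∑ i, α i := fun α => by
      have : post α k' = 0 := by
        refine Finset.sum_eq_zero fun j _ => if_neg ?_
        have := j.2
        simp only [hk', Fin.lt_def]
        omega
      rw [← pre_add_post α k', this, add_zero]
    refine c_mul_signedCycle_aux R l hA r p _ (k := k) (k' := k') ?_ ?_ 1 ?_ ?_
    · simp only [hk, hk', ne_eq, Fin.mk.injEq]; omega
    · simp only [List.get_eq_getElem, hk, hk']
      rw [List.formPerm_apply_getElem _ hA]
      simp [Nat.sub_add_cancel hlen]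
    · intro α
      funext t
      have e1 : (k' < t) ↔ False := by
        have := t.2
        simp only [hk', Fin.lt_def, iff_false]; omega
      have e2 : (k < t) ↔ t ≠ k := by
        simp only [hk, Fin.lt_def, ne_eq, Fin.ext_iff]; omega
      rw [pre_add, pre_add, pre_single, pre_single]
      simp only [e1, e2, Pi.add_apply, Pi.single_apply]
      by_cases ht : t = k
      · simp [ht, add_assoc, zmod_two_add_self]
      · simp [ht]
    · intro α hα
      have e0 : ¬ k' < k := by simp [hk, Fin.lt_def]
      have e3 : (A.length - 1) * l + r =
          (A.length - 1) + ((A.length - 1) * (l - 1) + r) := by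
        obtain ⟨l', rfl⟩ := Nat.exists_eq_add_of_le hl
        simp only [Nat.add_sub_cancel_left]
        ring
      have h2 : (2 : ZMod 2) = 0 := by decide
      have e4 : ((k : ℕ) : ZMod 2) = 0 := by simp [hk]
      have e5 : ((k' : ℕ) : ZMod 2) = ((A.length - 1 : ℕ) : ZMod 2) := rfl
      rw [if_neg e0, hpre0, e3, Nat.cast_add, e4, e5, one_mul]
      linear_combination -(hlast α) - hα - p * h2
  -- For one letter the first and last entries coincide and nothing is toggled: `c_α` commutes with
  -- `c_k`, and the sign is that of passing `x_k^r`.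
  · have h1' : A.length = 1 := by omega
    have hk1 : ∀ t : Fin A.length, t = k := fun t => Fin.ext (by have := t.2; simp [hk]; omega)
    have hσ : sigma R l A = 1 := by
      rw [sigma]
      obtain ⟨a, rfl⟩ := List.length_eq_one_iff.1 h1'
      rw [List.formPerm_singleton, s_one]
    have hn : (A.length - 1) * (l - 1) + r = r := by simp [h1']
    have hn' : (A.length - 1) * l + r = r := by simp [h1']
    rw [signedCycle, Finset.mul_sum, Finset.sum_mul, Finset.smul_sum, hn']
    refine Finset.sum_congr rfl fun α _ => ?_
    have hs : Pi.single k 1 = (1 : Fin A.length → ZMod 2) := by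
      funext t; rw [hk1 t]; simp
    have hsum : ∑ j, α j = α k := by
      rw [Finset.sum_eq_single k]
      · intro t _ ht; exact absurd (hk1 t) ht
      · simp
    rw [xCycle, hσ, mul_one, h_eq_hSigned, hn, mul_smul_comm, ← mul_assoc,
      c_mul_hSigned R l hA, hs, hSigned_add_one, mul_assoc, c_mul_cMon_comm R l hA, hsum,
      zmod_two_add_self, sg_zero, one_smul]
    simp only [smul_mul_assoc, mul_assoc]
    rw [smul_comm]

lemma c_mul_signedCycle_of_notMem {A : List (Fin d)} (r : ℕ) (p : ZMod 2) {j : Fin d}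
    (hj : j ∉ A) :
    c R l j * signedCycle R l A r p = sg R p • (signedCycle R l A r p * c R l j) := by
  rw [signedCycle, Finset.mul_sum, Finset.sum_mul, Finset.smul_sum]
  refine Finset.sum_congr rfl fun α hα => ?_
  have hp : ∑ i, α i = p := (Finset.mem_filter.1 hα).2
  have hσ : c R l j * sigma R l A = sigma R l A * c R l j := by
    rw [sigma, s_mul_c, List.formPerm_apply_of_notMem hj]
  rw [xCycle, h_eq_hSigned, mul_smul_comm, ← mul_assoc, ← mul_assoc,
    c_mul_hSigned_of_notMem R l _ _ hj, mul_assoc (hSigned _ _ _ _ _), hσ, mul_assoc, mul_assoc,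
    c_mul_cMon_of_notMem R l α hj, hp]
  simp only [smul_mul_assoc, mul_smul_comm, mul_assoc]
  rw [smul_comm]

/-- Inside the block `k' = k - 1`; toggling two adjacent entries alters `pre` at `k` only, so there
is no global sign change and `δ = 0`. Neither `r` nor `l` affects the result, and the sign agrees
with that for letters outside the block. -/
lemma c_mul_signedCycle_of_ne_head {A : List (Fin d)} (hne : A ≠ []) (hA : A.Nodup)
    (r : ℕ) (p : ZMod 2) {j : Fin d} (hj : j ≠ A.head hne) :
    c R l j * signedCycle R l A r p = sg R p • (signedCycle R l A r p * c R l j) := by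
  by_cases hjA : j ∈ A
  · obtain ⟨k, rfl⟩ := List.get_of_mem hjA
    have hk0 : (k : ℕ) ≠ 0 := by
      intro h
      apply hj
      simp [List.head_eq_getElem, h]
    set k' : Fin A.length := ⟨k - 1, by omega⟩ with hk'
    have hlt : k' < k := by simp only [hk', Fin.lt_def]; omega
    have hpk : ∀ α : Fin A.length → ZMod 2, pre α k = pre α k' + α k' := by
      intro α
      have h1 : α k' = ∑ t, if t = k' then α t else 0 := by simp
      rw [h1, pre, pre, ← Finset.sum_add_distrib]
      refine Finset.sum_congr rfl fun t _ => ?_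
      have e1 : t < k ↔ t < k' ∨ t = k' := by
        simp only [hk', Fin.lt_def, Fin.ext_iff]; omega
      rcases eq_or_ne t k' with rfl | ht
      · simp [hlt]
      · simp [e1, ht]
    refine c_mul_signedCycle_aux R l hA r p _ (k := k) (k' := k') hlt.ne ?_ 0 ?_ ?_
    · simp only [List.get_eq_getElem, hk']
      rw [List.formPerm_apply_lt_getElem _ hA _ (by omega)]
      congr 1
      omega
    · intro α
      funext t
      have e1 : (k' < t) ↔ (k < t) ∨ t = k := by
        simp only [hk', Fin.lt_def, Fin.ext_iff]; omega
      rw [pre_add, pre_add, pre_single, pre_single]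
      simp only [e1, Pi.add_apply, Pi.single_apply, add_zero, add_assoc]
      by_cases ht : t = k
      · simp [ht]
      · by_cases h3 : k < t <;> simp [ht, h3, zmod_two_add_self]
    · intro α _
      have e5 : ((k : ℕ) : ZMod 2) = ((k' : ℕ) : ZMod 2) + 1 := by
        rw [← Nat.cast_succ]
        congr 1
        simp only [hk']
        omega
      have h2 : (2 : ZMod 2) = 0 := by decide
      rw [if_pos hlt, hpk, e5, zero_mul]
      linear_combination (-(k' : ℕ) - α k' - pre α k' - 1) * h2
  · exact c_mul_signedCycle_of_notMem R l r p hjA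

end Cycles

/-! ### Products of elements with disjoint supports -/

section Blocks

variable {R : Type*} [CommRing R] {l : ℕ} {d : ℕ}

/-- `e` is a product of Clifford generators `c_i` with `i ∈ S`, the generator `c_i` occurring
`γ i` times modulo `2`. -/
inductive CliffWord (S : Set (Fin d)) : (Fin d → ZMod 2) → Gr R l d → Prop
  | one : CliffWord S 0 1
  | cons (i : Fin d) (γ : Fin d → ZMod 2) (e : Gr R l d) (hi : i ∈ S) (he : CliffWord S γ e) :
    CliffWord S (Pi.single i 1 + γ) (c R l i * e)

lemma CliffWord.mono {S S' : Set (Fin d)} (hS : S ⊆ S') {γ : Fin d → ZMod 2} {e : Gr R l d}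
    (he : CliffWord S γ e) : CliffWord S' γ e := by
  induction he with
  | one => exact .one
  | cons i γ e hi _ ih => exact .cons i γ e (hS hi) ih

lemma CliffWord.mul {S : Set (Fin d)} {γ γ' : Fin d → ZMod 2} {e e' : Gr R l d}
    (he : CliffWord S γ e) (he' : CliffWord S γ' e') : CliffWord S (γ + γ') (e * e') := by
  induction he with
  | one => simpa using he'
  | cons i γ e hi _ ih =>
    rw [add_assoc, mul_assoc]
    exact .cons i _ _ hi ih

lemma CliffWord.eq_zero {S : Set (Fin d)} {γ : Fin d → ZMod 2} {e : Gr R l d}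
    (he : CliffWord S γ e) {j : Fin d} (hj : j ∉ S) : γ j = 0 := by
  induction he with
  | one => rfl
  | cons i γ e hi _ ih =>
    rw [Pi.add_apply, ih, add_zero, Pi.single_eq_of_ne]
    rintro rfl
    exact hj hi

lemma CliffWord.prod_ofFn {S : Set (Fin d)} {n : ℕ} {γ : Fin n → Fin d → ZMod 2}
    {e : Fin n → Gr R l d} (he : ∀ i, CliffWord S (γ i) (e i)) :
    CliffWord S (∑ i, γ i) (List.ofFn e).prod := by
  induction n with
  | zero => simpa using CliffWord.one
  | succ n ih =>
    rw [List.ofFn_succ, List.prod_cons, Fin.sum_univ_succ]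
    exact (he 0).mul (ih fun i => he _)

lemma cliffWord_pow {S : Set (Fin d)} {i : Fin d} (hi : i ∈ S) (a : ZMod 2) :
    CliffWord S (Pi.single i a) (c R l i ^ a.val) := by
  rcases zmod_two_cases a with rfl | rfl
  · simpa using CliffWord.one
  · simpa [ZMod.val_one] using CliffWord.cons i _ _ hi (CliffWord.one (R := R) (l := l))

lemma cliffWord_cMon (A : List (Fin d)) (α : Fin A.length → ZMod 2) :
    CliffWord {j | j ∈ A} (∑ k, Pi.single (A.get k) (α k)) (cMon R l A α) :=
  CliffWord.prod_ofFn fun k => cliffWord_pow (A.get_mem k) _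

lemma CliffWord.commute_c {S : Set (Fin d)} {γ : Fin d → ZMod 2} {e y : Gr R l d}
    (he : CliffWord S γ e) (hy : ∀ i ∈ S, Commute (c R l i) y) : Commute e y := by
  induction he with
  | one => exact Commute.one_left y
  | cons i γ e hi _ ih => exact (hy i hi).mul_left ih

lemma commute_poly {S : Set (Fin d)} {f y : Gr R l d} (hf : f ∈ polyOn R l S)
    (hy : ∀ i ∈ S, Commute y (x R l i)) : Commute y f := by
  have h : polyOn R l S ≤ Subalgebra.centralizer R {y} := by
    refine Algebra.adjoin_le ?_
    rintro _ ⟨i, hi, rfl⟩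
    rw [SetLike.mem_coe, Subalgebra.mem_centralizer_iff]
    rintro _ rfl
    exact hy i hi
  exact Subalgebra.mem_centralizer_iff _ |>.1 (h hf) y rfl

lemma commute_c_x {i j : Fin d} (hij : i ≠ j) : Commute (c R l i) (x R l j) := by
  have := c_mul_x R l i j
  rwa [if_neg hij, sg_zero, one_smul] at this

lemma commute_s_x {w : Equiv.Perm (Fin d)} {j : Fin d} (hw : w j = j) :
    Commute (s R l w) (x R l j) := by
  have := s_mul_x R l w j
  rwa [hw] at this

lemma commute_c_s {w : Equiv.Perm (Fin d)} {j : Fin d} (hw : w j = j) :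
    Commute (c R l j) (s R l w) := by
  have := s_mul_c R l w j
  rw [hw] at this
  exact this.symm

lemma polyOn_mono {S S' : Set (Fin d)} (h : S ⊆ S') : polyOn R l S ≤ polyOn R l S' :=
  Algebra.adjoin_mono (Set.image_mono h)

variable (R l) in
/-- The span of the elements `g w e` with `g` a polynomial on `S` and `e` a Clifford word on `S`
with exponents in `Q`. -/
def blockSpan (S : Set (Fin d)) (w : Equiv.Perm (Fin d)) (Q : Set (Fin d → ZMod 2)) :
    Submodule R (Gr R l d) :=
  Submodule.span R {z | ∃ g ∈ polyOn R l S, ∃ γ ∈ Q, ∃ e, CliffWord S γ e ∧ z = g * s R l w * e}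

lemma block_mul_block {S S' : Set (Fin d)} (hS : Disjoint S S') {w w' : Equiv.Perm (Fin d)}
    (hw : ∀ j ∈ S', w j = j) (hw' : ∀ j ∈ S, w' j = j) (g : Gr R l d) {g' : Gr R l d}
    (hg' : g' ∈ polyOn R l S') {γ : Fin d → ZMod 2} {e : Gr R l d} (he : CliffWord S γ e)
    (e' : Gr R l d) :
    g * s R l w * e * (g' * s R l w' * e') = g * g' * s R l (w * w') * (e * e') := by
  have h1 : e * g' = g' * e := he.commute_c fun i hi => commute_poly hg' fun j hj =>
    commute_c_x (hS.ne_of_mem hi hj)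
  have h2 : e * s R l w' = s R l w' * e := he.commute_c fun i hi => commute_c_s (hw' i hi)
  have h3 : s R l w * g' = g' * s R l w := commute_poly hg' fun j hj => commute_s_x (hw j hj)
  calc g * s R l w * e * (g' * s R l w' * e')
      = g * s R l w * (e * g') * s R l w' * e' := by simp only [mul_assoc]
    _ = g * (s R l w * g') * (e * s R l w') * e' := by rw [h1]; simp only [mul_assoc]
    _ = g * g' * s R l (w * w') * (e * e') := by
        rw [h2, h3, ← s_mul_s]; simp only [mul_assoc]

lemma mul_mem_blockSpan {S S' : Set (Fin d)} (hS : Disjoint S S') {w w' : Equiv.Perm (Fin d)}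
    (hw : ∀ j ∈ S', w j = j) (hw' : ∀ j ∈ S, w' j = j) {Q Q' Q'' : Set (Fin d → ZMod 2)}
    (hQ : ∀ γ ∈ Q, ∀ γ' ∈ Q', (∀ j ∉ S, γ j = 0) → (∀ j ∉ S', γ' j = 0) → γ + γ' ∈ Q'')
    {y z : Gr R l d} (hy : y ∈ blockSpan R l S w Q) (hz : z ∈ blockSpan R l S' w' Q') :
    y * z ∈ blockSpan R l (S ∪ S') (w * w') Q'' := by
  have h := Submodule.mul_mem_mul hy hz
  rw [blockSpan, blockSpan, Submodule.span_mul_span] at h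
  refine Submodule.span_mono ?_ h
  rintro _ ⟨_, ⟨g, hg, γ, hγ, e, he, rfl⟩, _, ⟨g', hg', γ', hγ', e', he', rfl⟩, rfl⟩
  refine ⟨g * g', mul_mem (polyOn_mono Set.subset_union_left hg)
    (polyOn_mono Set.subset_union_right hg'), γ + γ',
    hQ γ hγ γ' hγ' (fun j hj => he.eq_zero hj) (fun j hj => he'.eq_zero hj), e * e',
    (he.mono Set.subset_union_left).mul (he'.mono Set.subset_union_right),
    block_mul_block hS hw hw' g hg' he e'⟩

/-- `z` is `f w e`, with `e` of exponent `q`, up to terms with exponents `γ ≠ q` such that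
`N γ = q`. -/
structure Leads (N : (Fin d → ZMod 2) →+ (Fin d → ZMod 2)) (S : Set (Fin d))
    (w : Equiv.Perm (Fin d)) (q : Fin d → ZMod 2) (f e z : Gr R l d) : Prop where
  poly : f ∈ polyOn R l S
  word : CliffWord S q e
  map_eq : N q = q
  eq_add : ∃ n ∈ blockSpan R l S w {γ | N γ = q ∧ γ ≠ q}, z = f * s R l w * e + n

/-- Three kinds of cross terms must remain non-leading. For a product of two corrections,
cancellation is excluded because exponents living on disjoint sets can be recovered from their sum.
-/
lemma Leads.mul {N : (Fin d → ZMod 2) →+ (Fin d → ZMod 2)} {S S' : Set (Fin d)}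
    (hS : Disjoint S S') {w w' : Equiv.Perm (Fin d)}
    (hw : ∀ j ∈ S', w j = j) (hw' : ∀ j ∈ S, w' j = j) {q q' : Fin d → ZMod 2}
    {f f' e e' z z' : Gr R l d} (h : Leads N S w q f e z) (h' : Leads N S' w' q' f' e' z') :
    Leads N (S ∪ S') (w * w') (q + q') (f * f') (e * e') (z * z') := by
  obtain ⟨n, hn, rfl⟩ := h.eq_add
  obtain ⟨n', hn', rfl⟩ := h'.eq_add
  have hm : f * s R l w * e ∈ blockSpan R l S w {q} :=
    Submodule.subset_span ⟨f, h.poly, q, rfl, e, h.word, rfl⟩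
  have hm' : f' * s R l w' * e' ∈ blockSpan R l S' w' {q'} :=
    Submodule.subset_span ⟨f', h'.poly, q', rfl, e', h'.word, rfl⟩
  refine ⟨mul_mem (polyOn_mono Set.subset_union_left h.poly)
    (polyOn_mono Set.subset_union_right h'.poly), (h.word.mono Set.subset_union_left).mul
    (h'.word.mono Set.subset_union_right), by rw [map_add, h.map_eq, h'.map_eq],
    f * s R l w * e * n' + (n * (f' * s R l w' * e') + n * n'), ?_, ?_⟩
  · refine add_mem ?_ (add_mem ?_ ?_)
    · refine mul_mem_blockSpan hS hw hw' ?_ hm hn'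
      rintro _ rfl γ' ⟨hγ', hne⟩ - -
      exact ⟨by rw [map_add, h.map_eq, hγ'], fun h0 => hne (add_left_cancel h0)⟩
    · refine mul_mem_blockSpan hS hw hw' ?_ hn hm'
      rintro γ ⟨hγ, hne⟩ _ rfl - -
      exact ⟨by rw [map_add, h'.map_eq, hγ], fun h0 => hne (add_right_cancel h0)⟩
    · refine mul_mem_blockSpan hS hw hw' ?_ hn hn'
      rintro γ ⟨hγ, hne⟩ γ' ⟨hγ', -⟩ h1 h2
      refine ⟨by rw [map_add, hγ, hγ'], fun h0 => hne ?_⟩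
      funext j
      by_cases hj : j ∈ S
      · have hj' : j ∉ S' := Set.disjoint_left.1 hS hj
        simpa [h2 j hj', h'.word.eq_zero hj'] using congrFun h0 j
      · rw [h1 j hj, h.word.eq_zero hj]
  · rw [← block_mul_block hS hw hw' f h'.poly h.word e']
    simp only [mul_add, add_mul, add_assoc]
    rw [add_left_comm (n * _)]

lemma prod_ofFn_apply_of_fixed {m : ℕ} (v : Fin m → Equiv.Perm (Fin d)) {j : Fin d}
    (h : ∀ i, v i j = j) : (List.ofFn v).prod j = j := by
  induction m with
  | zero => simp
  | succ m ih =>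
    rw [List.ofFn_succ, List.prod_cons, Equiv.Perm.mul_apply, ih _ fun i => h _, h]

lemma prod_ofFn_apply {m : ℕ} (v : Fin m → Equiv.Perm (Fin d)) (i₀ : Fin m) {j : Fin d}
    (h : ∀ i, i ≠ i₀ → v i j = j) (h' : ∀ i, i ≠ i₀ → v i (v i₀ j) = v i₀ j) :
    (List.ofFn v).prod j = v i₀ j := by
  induction m with
  | zero => exact i₀.elim0
  | succ m ih =>
    rw [List.ofFn_succ, List.prod_cons, Equiv.Perm.mul_apply]
    rcases Fin.eq_zero_or_eq_succ i₀ with rfl | ⟨i, rfl⟩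
    · rw [prod_ofFn_apply_of_fixed _ fun i => h _ (Fin.succ_ne_zero i)]
    · rw [ih (fun i => v i.succ) i (fun k hk => h _ (by simpa using hk))
        (fun k hk => h' _ (by simpa using hk)), h' 0 (Fin.succ_ne_zero i).symm]

lemma Leads.prod {N : (Fin d → ZMod 2) →+ (Fin d → ZMod 2)} {m : ℕ} {A : Fin m → List (Fin d)}
    (hdisj : ∀ i j, i ≠ j → (A i).Disjoint (A j)) {q : Fin m → Fin d → ZMod 2}
    {f e z : Fin m → Gr R l d}
    (h : ∀ i, Leads N {j | j ∈ A i} (A i).formPerm (q i) (f i) (e i) (z i)) :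
    Leads N {j | ∃ i, j ∈ A i} (List.ofFn fun i => (A i).formPerm).prod (∑ i, q i)
      (List.ofFn f).prod (List.ofFn e).prod (List.ofFn z).prod := by
  induction m with
  | zero =>
    refine ⟨by simp, by simpa using CliffWord.one, by simp, 0, zero_mem _, by simp [s_one]⟩
  | succ m ih =>
    have ih' := ih (A := fun i => A i.succ) (fun i j hij => hdisj _ _ (by simpa using hij))
      (fun i => h _)
    have hS : {j | ∃ i, j ∈ A i} = {j | j ∈ A 0} ∪ {j | ∃ i : Fin m, j ∈ A i.succ} := by
      ext j
      simp [Fin.exists_fin_succ]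
    simp only [List.ofFn_succ, List.prod_cons, Fin.sum_univ_succ]
    rw [hS]
    refine (h 0).mul ?_ ?_ ?_ ih'
    · rw [Set.disjoint_left]
      rintro j hj ⟨i, hi⟩
      exact hdisj 0 i.succ (Fin.succ_ne_zero i).symm hj hi
    · rintro j ⟨i, hi⟩
      exact List.formPerm_apply_of_notMem fun hj =>
        hdisj 0 i.succ (Fin.succ_ne_zero i).symm hj hi
    · intro j hj
      exact prod_ofFn_apply_of_fixed _ fun i => List.formPerm_apply_of_notMem fun hi =>
        hdisj 0 i.succ (Fin.succ_ne_zero i).symm hj hi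

variable [NeZero l]

lemma CliffWord.exists_coef {S : Set (Fin d)} {γ : Fin d → ZMod 2} {e : Gr R l d}
    (he : CliffWord S γ e) (β : Fin d → ZMod 2) : ∃ r : ZMod 2, ∀ (y : Gr R l d) (ν w),
      coef R l d (y * e) ν w β = sg R r * coef R l d y ν w (β + γ) := by
  induction he generalizing β with
  | one => exact ⟨0, fun y ν w => by simp⟩
  | cons i γ e hi _ ih =>
    obtain ⟨r, hr⟩ := ih β
    refine ⟨r + post (β + γ) i, fun y ν w => ?_⟩
    rw [← mul_assoc, hr, coef_mul_c, sg_add, mul_assoc, add_assoc, add_comm γ]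

lemma coef_blockSpan {S : Set (Fin d)} {w : Equiv.Perm (Fin d)} {Q : Set (Fin d → ZMod 2)}
    {z : Gr R l d} (hz : z ∈ blockSpan R l S w Q) {ν : Fin d → ℕ} {w' : Equiv.Perm (Fin d)}
    {β : Fin d → ZMod 2} (h : coef R l d z ν w' β ≠ 0) : w' = w ∧ β ∈ Q := by
  by_contra hne
  apply h
  induction hz using Submodule.span_induction with
  | mem y hy =>
    obtain ⟨g, hg, γ, hγ, e, he, rfl⟩ := hy
    obtain ⟨r, hr⟩ := he.exists_coef β
    rw [hr, coef_poly_mul_s hg, if_neg, mul_zero]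
    rintro ⟨rfl, h0⟩
    refine hne ⟨rfl, ?_⟩
    have : β = γ := funext fun j => CharTwo.add_eq_zero.1 (congrFun h0 j)
    rwa [this]
  | zero => simp
  | add y z _ _ hy hz =>
    rw [map_add, Pi.add_apply, Pi.add_apply, Pi.add_apply]
    by_cases h1 : coef R l d y ν w' β = 0
    · by_cases h2 : coef R l d z ν w' β = 0
      · rw [h1, h2, add_zero]
      · exact absurd (hz h2) h2
    · exact absurd (hy h1) h1
  | smul r y _ hy =>
    rw [map_smul, Pi.smul_apply, Pi.smul_apply, Pi.smul_apply]
    by_cases h1 : coef R l d y ν w' β = 0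
    · rw [h1, smul_zero]
    · exact absurd (hy h1) h1

lemma CliffWord.exists_coef_self {S : Set (Fin d)} {γ : Fin d → ZMod 2} {e : Gr R l d}
    (he : CliffWord S γ e) : ∃ r : ZMod 2, ∀ (T : Set (Fin d)), ∀ f ∈ polyOn R l T, ∀ (ν w),
      coef R l d (f * s R l w * e) ν w γ = sg R r * coef R l d f ν 1 0 := by
  obtain ⟨r, hr⟩ := he.exists_coef γ
  refine ⟨r, fun T f hf ν w => ?_⟩
  have hγ : γ + γ = 0 := funext fun j => zmod_two_add_self _
  rw [hr, coef_poly_mul_s hf, hγ, if_pos ⟨rfl, rfl⟩]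

lemma Leads.coef_eq {N : (Fin d → ZMod 2) →+ (Fin d → ZMod 2)} {S : Set (Fin d)}
    {w : Equiv.Perm (Fin d)} {q : Fin d → ZMod 2} {f e z : Gr R l d}
    (h : Leads N S w q f e z) (ν) :
    coef R l d z ν w q = coef R l d (f * s R l w * e) ν w q := by
  obtain ⟨n, hn, rfl⟩ := h.eq_add
  have h0 : coef R l d n ν w q = 0 := by
    by_contra hne
    exact (coef_blockSpan hn hne).2.2 rfl
  rw [map_add, Pi.add_apply, Pi.add_apply, Pi.add_apply, h0, add_zero]

/-- Leading and correction terms alike have exponents with image `q` under `N`. -/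
lemma Leads.coef_ne_zero {N : (Fin d → ZMod 2) →+ (Fin d → ZMod 2)} {S : Set (Fin d)}
    {w w' : Equiv.Perm (Fin d)} {q : Fin d → ZMod 2} {f e z : Gr R l d}
    (h : Leads N S w q f e z) {ν β} (h0 : coef R l d z ν w' β ≠ 0) : w' = w ∧ N β = q := by
  obtain ⟨n, hn, rfl⟩ := h.eq_add
  have hm : f * s R l w * e ∈ blockSpan R l S w {γ | N γ = q} :=
    Submodule.subset_span ⟨f, h.poly, q, h.map_eq, e, h.word, rfl⟩
  have hn' : n ∈ blockSpan R l S w {γ | N γ = q} := by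
    refine Submodule.span_mono ?_ hn
    rintro _ ⟨g, hg, γ, hγ, e, he, rfl⟩
    exact ⟨g, hg, γ, hγ.1, e, he, rfl⟩
  exact coef_blockSpan (add_mem hm hn') h0

end Blocks

/-! ### Collecting exponents at the last element of each block -/

section Collect

variable {d m : ℕ}

open Classical in
/-- The last element of the block of `j`, and `j` itself outside all blocks. -/
noncomputable def blockEnd (A : Fin m → List (Fin d)) (j : Fin d) : Fin d :=
  if h : ∃ i, j ∈ A i then (A h.choose).getLast (List.ne_nil_of_mem h.choose_spec) else j

lemma blockEnd_of_mem {A : Fin m → List (Fin d)}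
    (hdisj : ∀ i j, i ≠ j → (A i).Disjoint (A j)) {i : Fin m} {j : Fin d} (hj : j ∈ A i) :
    blockEnd A j = (A i).getLast (List.ne_nil_of_mem hj) := by
  have h : ∃ i, j ∈ A i := ⟨i, hj⟩
  have hi : h.choose = i := by
    by_contra hne
    exact hdisj _ _ hne h.choose_spec hj
  rw [blockEnd, dif_pos h]
  congr 2

lemma blockEnd_of_notMem {A : Fin m → List (Fin d)} {j : Fin d} (hj : ∀ i, j ∉ A i) :
    blockEnd A j = j := by
  rw [blockEnd, dif_neg]
  rintro ⟨i, hi⟩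
  exact hj i hi

/-- The exponents collected at the ends of the blocks. -/
noncomputable def collect (A : Fin m → List (Fin d)) :
    (Fin d → ZMod 2) →+ (Fin d → ZMod 2) where
  toFun α := ∑ j, Pi.single (blockEnd A j) (α j)
  map_zero' := by simp
  map_add' α β := by
    simp only [Pi.add_apply, Pi.single_add, Finset.sum_add_distrib]

lemma collect_apply (A : Fin m → List (Fin d)) (α : Fin d → ZMod 2) :
    collect A α = ∑ j, Pi.single (blockEnd A j) (α j) := rfl

lemma collect_single (A : Fin m → List (Fin d)) (j : Fin d) (a : ZMod 2) :
    collect A (Pi.single j a) = Pi.single (blockEnd A j) a := by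
  rw [collect_apply, Finset.sum_eq_single j]
  · rw [Pi.single_eq_same]
  · intro k _ hk
    rw [Pi.single_eq_of_ne hk, Pi.single_zero]
  · simp

/-- The product of the cycles of the blocks. -/
def blockPerm (A : Fin m → List (Fin d)) : Equiv.Perm (Fin d) :=
  (List.ofFn fun i => (A i).formPerm).prod

lemma blockPerm_apply_of_mem {A : Fin m → List (Fin d)}
    (hdisj : ∀ i j, i ≠ j → (A i).Disjoint (A j)) {i : Fin m} {j : Fin d} (hj : j ∈ A i) :
    blockPerm A j = (A i).formPerm j :=
  prod_ofFn_apply _ i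
    (fun k hk => List.formPerm_apply_of_notMem fun h => hdisj k i hk h hj)
    (fun k hk => List.formPerm_apply_of_notMem fun h =>
      hdisj k i hk h (List.formPerm_apply_mem_of_mem hj))

lemma blockPerm_apply_of_notMem {A : Fin m → List (Fin d)} {j : Fin d} (hj : ∀ i, j ∉ A i) :
    blockPerm A j = j :=
  prod_ofFn_apply_of_fixed _ fun i => List.formPerm_apply_of_notMem (hj i)

/-- Hence toggling both `j` and its image under the cycles leaves `collect` unchanged. -/
lemma blockEnd_blockPerm {A : Fin m → List (Fin d)}
    (hdisj : ∀ i j, i ≠ j → (A i).Disjoint (A j)) (j : Fin d) :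
    blockEnd A (blockPerm A j) = blockEnd A j := by
  by_cases h : ∃ i, j ∈ A i
  · obtain ⟨i, hi⟩ := h
    have hi' : blockPerm A j ∈ A i := by
      rw [blockPerm_apply_of_mem hdisj hi]
      exact List.formPerm_apply_mem_of_mem hi
    rw [blockEnd_of_mem hdisj hi, blockEnd_of_mem hdisj hi']
  · push Not at h
    rw [blockPerm_apply_of_notMem h]

lemma blockPerm_get {A : Fin m → List (Fin d)} (hA : ∀ i, (A i).Nodup)
    (hdisj : ∀ i j, i ≠ j → (A i).Disjoint (A j)) (i : Fin m) (k : ℕ)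
    (hk : k + 1 < (A i).length) : blockPerm A (A i)[k] = (A i)[k + 1] := by
  rw [blockPerm_apply_of_mem hdisj (List.getElem_mem _),
    List.formPerm_apply_lt_getElem _ (hA i) k hk]

/-- `j` is not the first element of a block. -/
def NotHead (A : Fin m → List (Fin d)) (j : Fin d) : Prop :=
  ∀ i, (A i).head? ≠ some j

lemma notHead_succ {A : Fin m → List (Fin d)} (hA : ∀ i, (A i).Nodup)
    (hdisj : ∀ i j, i ≠ j → (A i).Disjoint (A j)) (i : Fin m) (k : ℕ)
    (hk : k + 1 < (A i).length) : NotHead A (A i)[k + 1] := by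
  intro i' h
  have hmem : (A i)[k + 1] ∈ A i' := List.mem_of_mem_head? h
  have hi : i' = i := by
    by_contra hne
    exact hdisj _ _ hne hmem (List.getElem_mem _)
  subst hi
  rw [List.head?_eq_getElem?, List.getElem?_eq_getElem (by omega), Option.some_inj,
    (hA i').getElem_inj_iff] at h
  omega

/-- A predicate invariant under moving exponents inside the blocks only depends on the collected
exponents. -/
lemma iff_collect {A : Fin m → List (Fin d)} (hA : ∀ i, (A i).Nodup)
    (hdisj : ∀ i j, i ≠ j → (A i).Disjoint (A j)) (P : (Fin d → ZMod 2) → Prop)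
    (hP : ∀ α (j : Fin d), (∃ i, j ∈ A i) → NotHead A (blockPerm A j) →
      (P α ↔ P (α + Pi.single j 1 + Pi.single (blockPerm A j) 1))) (α : Fin d → ZMod 2) :
    P α ↔ P (collect A α) := by
  -- Here `n` counts the letters between position `k` and the end of the block; each step passes the
  -- exponent on to the next letter.
  have hback : ∀ (i : Fin m) (n k : ℕ) (hk : k < (A i).length), k + 1 + n = (A i).length →
      ∀ α, P α ↔ P (α + Pi.single (A i)[k] 1 +
        Pi.single (blockEnd A (A i)[k]) 1) := by
    intro i n
    induction n with
    | zero =>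
      intro k hk hn α
      have : blockEnd A (A i)[k] = (A i)[k] := by
        rw [blockEnd_of_mem hdisj (List.getElem_mem _), List.getLast_eq_getElem]
        congr 1
        omega
      rw [this, char_two_add_single]
    | succ n ih =>
      intro k hk hn α
      have hk1 : k + 1 < (A i).length := by omega
      have hw := blockPerm_get hA hdisj i k hk1
      have h1 := hP α (A i)[k] ⟨i, List.getElem_mem _⟩
        (by rw [hw]; exact notHead_succ hA hdisj i k hk1)
      rw [h1, ih (k + 1) hk1 (by omega), hw, char_two_add_single,
        ← blockEnd_blockPerm hdisj (A i)[k], hw]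
  have hmove : ∀ (α) (j : Fin d), P α ↔ P (α + Pi.single j 1 + Pi.single (blockEnd A j) 1) := by
    intro α j
    by_cases h : ∃ i, j ∈ A i
    · obtain ⟨i, hi⟩ := h
      obtain ⟨k, hk, rfl⟩ := List.getElem_of_mem hi
      exact hback i ((A i).length - (k + 1)) k hk (by omega) α
    · push Not at h
      rw [blockEnd_of_notMem h, char_two_add_single]
  -- The moves are made one letter at a time, governed by the original `α`. For `T` everything, the
  -- two copies of `α` cancel and `collect A α` remains.
  have hset : ∀ T : Finset (Fin d), P α ↔
      P (α + ∑ j ∈ T, (Pi.single j (α j) + Pi.single (blockEnd A j) (α j))) := by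
    intro T
    induction T using Finset.induction_on with
    | empty => simp
    | insert j T hj ih =>
      rw [ih, Finset.sum_insert hj]
      rcases zmod_two_cases (α j) with h | h
      · simp [h]
      · rw [h, hmove _ j]
        have : ∀ a b c e : Fin d → ZMod 2, a + b + c + e = a + (c + e + b) := by
          intro a b c e; abel
        rw [this]
  rw [hset Finset.univ, Finset.sum_add_distrib, sum_single_eq, ← add_assoc]
  have h0 : α + α = 0 := funext fun j => zmod_two_add_self _
  rw [h0, zero_add]
  rfl

end Collect

/-! ### Transport of coefficients by the Clifford generators -/

section Commuting

variable {R : Type*} [CommRing R] {l : ℕ} {d m : ℕ} [NeZero l]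

/-- The relation is read at `α + e_j`: the right factor returns the index to `α`, the left one
shifts it by `e_{w⁻¹ j}`. The sign involves `q`, `ν`, `w` and `α` but not `z`, so two elements can
be transported in parallel. -/
lemma coef_of_c_comm {z : Gr R l d} {j : Fin d} {q : ZMod 2}
    (hz : c R l j * z = sg R q • (z * c R l j)) (ν) (w : Equiv.Perm (Fin d)) (α) :
    coef R l d z ν w α = sg R q * (sg R ((ν j : ZMod 2) + pre (α + Pi.single j 1) (w⁻¹ j) +
      post (α + Pi.single j 1) j) *
        coef R l d z ν w (α + Pi.single j 1 + Pi.single (w⁻¹ j) 1)) := by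
  have h := congrFun (congrFun (congrFun (congrArg (coef R l d) hz) ν) w) (α + Pi.single j 1)
  rw [coef_c_mul, map_smul, Pi.smul_apply, Pi.smul_apply, Pi.smul_apply, coef_mul_c,
    char_two_add_single, smul_eq_mul] at h
  rw [sg_add]
  linear_combination -(sg R q * sg R (post (α + Pi.single j 1) j)) * h -
    coef R l d z ν w α * (sg R (post (α + Pi.single j 1) j) * sg R (post (α + Pi.single j 1) j) *
      sg_mul_self R q + sg_mul_self R (post (α + Pi.single j 1) j))

/-- Each move multiplies both coefficients by the same unit, so equality propagates and no sign
needs to be known. Heads are not involved; the comparison element may therefore misbehave there. -/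
lemma coef_eq_iff_collect {A : Fin m → List (Fin d)} (hA : ∀ i, (A i).Nodup)
    (hdisj : ∀ i j, i ≠ j → (A i).Disjoint (A j)) {z z' : Gr R l d}
    (hz : ∀ j, (∃ i, j ∈ A i) → NotHead A j → c R l j * z = z * c R l j)
    (hz' : ∀ j, (∃ i, j ∈ A i) → NotHead A j → c R l j * z' = z' * c R l j) (ν) (α) :
    coef R l d z ν (blockPerm A) α = coef R l d z' ν (blockPerm A) α ↔
      coef R l d z ν (blockPerm A) (collect A α) =
        coef R l d z' ν (blockPerm A) (collect A α) := by
  refine iff_collect hA hdisj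
    (fun α => coef R l d z ν (blockPerm A) α = coef R l d z' ν (blockPerm A) α) ?_ α
  rintro α j ⟨i, hi⟩ hj
  have hmem : ∃ i, blockPerm A j ∈ A i := ⟨i, by
    rw [blockPerm_apply_of_mem hdisj hi]
    exact List.formPerm_apply_mem_of_mem hi⟩
  have e := fun (y : Gr R l d) (hy : c R l (blockPerm A j) * y = y * c R l (blockPerm A j)) =>
    coef_of_c_comm (q := 0) (by rw [hy, sg_zero, one_smul]) ν (blockPerm A) α
  have hinv : (blockPerm A)⁻¹ (blockPerm A j) = j := (blockPerm A).symm_apply_apply j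
  rw [e z (hz _ hmem hj), e z' (hz' _ hmem hj), hinv, add_right_comm α]
  rw [sg_zero, one_mul, one_mul, (isUnit_sg R _).mul_right_inj]

/-- A coefficient of an element commuting with the `c_j` vanishes if it agrees with that of an
element which anticommutes with one of them. -/
lemma coef_eq_zero_of_anticomm (h2 : (2 : R) ∈ nonZeroDivisors R) {A : Fin m → List (Fin d)}
    (hA : ∀ i, (A i).Nodup) (hdisj : ∀ i j, i ≠ j → (A i).Disjoint (A j)) {z z' : Gr R l d}
    (hz : ∀ j, c R l j * z = z * c R l j)
    (hz' : ∀ j, (∃ i, j ∈ A i) → NotHead A j → c R l j * z' = z' * c R l j) {j : Fin d}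
    (hj : c R l j * z' = sg R 1 • (z' * c R l j)) {ν : Fin d → ℕ} {γ : Fin d → ZMod 2}
    (hγ : collect A γ = γ)
    (h : coef R l d z ν (blockPerm A) γ = coef R l d z' ν (blockPerm A) γ) :
    coef R l d z ν (blockPerm A) γ = 0 := by
  set w := blockPerm A with hw
  set β := γ + Pi.single j 1 + Pi.single (w⁻¹ j) 1 with hβ
  have hend : blockEnd A (w⁻¹ j) = blockEnd A j := by
    rw [← blockEnd_blockPerm hdisj (w⁻¹ j), ← hw]
    congr 1
    exact w.apply_symm_apply j
  have hcβ : collect A β = γ := by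
    rw [hβ, map_add, map_add, hγ, collect_single, collect_single, hend, char_two_add_single]
  have h1 := coef_of_c_comm (q := 0) (by rw [hz j, sg_zero, one_smul]) ν w γ
  have h3 := coef_of_c_comm hj ν w γ
  -- Since `β` collects to `γ` again, the two elements agree at `β` too. One of them goes from `β`
  -- to `γ` with the opposite sign of the other, so the common coefficient at `γ` is its own
  -- negative.
  have h4 : coef R l d z ν w β = coef R l d z' ν w β := by
    rw [hw, coef_eq_iff_collect hA hdisj (fun j _ _ => hz j) hz', hcβ, h]
  rw [← hβ] at h1 h3
  rw [h4, sg_zero, one_mul] at h1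
  rw [← h, ← h1, sg_one] at h3
  refine (mul_right_mem_nonZeroDivisors_eq_zero_iff h2).1 ?_
  linear_combination h3

end Commuting

/-! ### Products of signed cycles and their leading coefficients -/

section BlockProducts

variable {d m : ℕ}

/-- The vector with entry `p` in the last place and zeros elsewhere. -/
def lastVec (n : ℕ) (p : ZMod 2) : Fin n → ZMod 2 := fun k => if (k : ℕ) + 1 = n then p else 0

/-- With the exponent on the last letter no variable is signed, so the leading term of a signed
cycle carries the plain complete homogeneous sum. -/
lemma pre_lastVec (n : ℕ) (p : ZMod 2) : pre (lastVec n p) = 0 := by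
  funext j
  refine Finset.sum_eq_zero fun k _ => ?_
  rw [lastVec]
  split_ifs with h1 h3
  · have := j.2
    have : (k : ℕ) < j := h1
    omega
  · rfl
  · rfl

lemma sum_lastVec {M : Type*} [AddCommMonoid M] {n : ℕ} (hn : 0 < n) (p : ZMod 2)
    (g : Fin n → ZMod 2 → M) (hg : ∀ k, g k 0 = 0) :
    ∑ k, g k (lastVec n p k) = g ⟨n - 1, by omega⟩ p := by
  rw [Finset.sum_eq_single ⟨n - 1, by omega⟩]
  · rw [lastVec, if_pos (Nat.sub_add_cancel hn)]
  · intro k _ hk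
    rw [lastVec, if_neg, hg]
    intro h
    exact hk (Fin.ext (by simp only; omega))
  · simp

lemma sum_single_get_apply {M : Type*} [AddCommMonoid M] {A : List (Fin d)} (hA : A.Nodup)
    (α : Fin A.length → M) (k : Fin A.length) :
    (∑ k, Pi.single (A.get k) (α k) : Fin d → M) (A.get k) = α k := by
  rw [Finset.sum_apply, Finset.sum_eq_single k]
  · rw [Pi.single_eq_same]
  · intro j _ hj
    rw [Pi.single_eq_of_ne]
    rwa [ne_eq, hA.get_inj_iff, eq_comm]
  · simp

variable {R : Type*} [CommRing R] {l : ℕ}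

lemma hSigned_mem_polyOn (A : List (Fin d)) (n : ℕ) (ε : Fin A.length → ZMod 2) :
    hSigned R l A n ε ∈ polyOn R l {j | j ∈ A} :=
  sum_mem fun ρ _ => Subalgebra.smul_mem _ (xMon_mem_polyOn fun _ hj => expo_eq_zero ρ hj) _

/-- All vectors of parity `p` on a block collect to the same exponent at its last letter, and
`lastVec` is the only one already of that form. -/
lemma leads_signedCycle {A : Fin m → List (Fin d)} (hA : ∀ i, (A i).Nodup)
    (hdisj : ∀ i j, i ≠ j → (A i).Disjoint (A j)) (i : Fin m) (hne : A i ≠ []) (r : ℕ)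
    (p : ZMod 2) :
    Leads (collect A) {j | j ∈ A i} (A i).formPerm (Pi.single ((A i).getLast hne) p)
      (sg R ((tauExp (lastVec (A i).length p) : ℕ) : ZMod 2) •
        hSigned R l (A i) (((A i).length - 1) * (l - 1) + r) 0)
      (cMon R l (A i) (lastVec (A i).length p)) (signedCycle R l (A i) r p) := by
  have hlen : 0 < (A i).length := List.length_pos_iff.2 hne
  have hlast : (A i).get ⟨(A i).length - 1, by omega⟩ = (A i).getLast hne := by
    rw [List.getLast_eq_getElem]; rfl
  have hend : ∀ k, blockEnd A ((A i).get k) = (A i).getLast hne := fun k =>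
    blockEnd_of_mem hdisj ((A i).get_mem k)
  have hemb : ∑ k, Pi.single ((A i).get k) (lastVec (A i).length p k) =
      (Pi.single ((A i).getLast hne) p : Fin d → ZMod 2) := by
    rw [← hlast]
    exact sum_lastVec hlen p (fun k a => (Pi.single ((A i).get k) a : Fin d → ZMod 2))
      (fun k => Pi.single_zero _)
  refine ⟨Subalgebra.smul_mem _ (hSigned_mem_polyOn _ _ _) _, ?_, ?_,
    ∑ α ∈ (Finset.univ.filter fun α : Fin (A i).length → ZMod 2 => ∑ k, α k = p).erase
      (lastVec (A i).length p), sg R ((tauExp α : ℕ) : ZMod 2) • xCycle R l (A i) r α, ?_, ?_⟩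
  · rw [← hemb]
    exact cliffWord_cMon _ _
  · rw [collect_single, ← hlast, hend, hlast]
  · refine sum_mem fun α hα => Submodule.smul_mem _ _ (Submodule.subset_span ?_)
    rw [Finset.mem_erase, Finset.mem_filter] at hα
    refine ⟨h R l (A i) r α, ?_, _, ⟨?_, ?_⟩, _, cliffWord_cMon _ α, rfl⟩
    · rw [h_eq_hSigned]; exact hSigned_mem_polyOn _ _ _
    · rw [map_sum]
      simp only [collect_single, hend]
      rw [← hα.2.2]
      exact (map_sum (AddMonoidHom.single (fun _ : Fin d => ZMod 2) _) α _).symm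
    · rw [← hemb]
      intro h0
      apply hα.1
      funext k
      rw [← sum_single_get_apply (hA i) α k, h0, sum_single_get_apply (hA i)]
  · rw [signedCycle, ← Finset.add_sum_erase _ _ (a := lastVec (A i).length p), xCycle,
      h_eq_hSigned, pre_lastVec]
    · simp only [smul_mul_assoc]
      rfl
    · rw [Finset.mem_filter]
      refine ⟨Finset.mem_univ _, ?_⟩
      exact sum_lastVec hlen p (fun _ a => a) (fun _ => rfl)

variable (R l) in
/-- The product of the signed cycles of the blocks. -/
noncomputable def blockProd (A : Fin m → List (Fin d)) (r : Fin m → ℕ) (p : Fin m → ZMod 2) :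
    Gr R l d :=
  (List.ofFn fun i => signedCycle R l (A i) (r i) (p i)).prod

/-- The exponent vector with entry `p i` at the end of the `i`-th block. -/
def ends (A : Fin m → List (Fin d)) (hne : ∀ i, A i ≠ []) (p : Fin m → ZMod 2) :
    Fin d → ZMod 2 :=
  ∑ i, Pi.single ((A i).getLast (hne i)) (p i)

lemma sum_ends (A : Fin m → List (Fin d)) (hne : ∀ i, A i ≠ []) (p : Fin m → ZMod 2) :
    ∑ j, ends A hne p j = ∑ i, p i := by
  simp only [ends, Finset.sum_apply]
  rw [Finset.sum_comm]
  simp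

lemma leads_blockProd {A : Fin m → List (Fin d)} (hne : ∀ i, A i ≠ [])
    (hA : ∀ i, (A i).Nodup) (hdisj : ∀ i j, i ≠ j → (A i).Disjoint (A j)) (r : Fin m → ℕ)
    (p : Fin m → ZMod 2) :
    Leads (collect A) {j | ∃ i, j ∈ A i} (blockPerm A) (ends A hne p)
      (sg R (∑ i, ((tauExp (lastVec (A i).length (p i)) : ℕ) : ZMod 2)) •
        (List.ofFn fun i => hSigned R l (A i) (((A i).length - 1) * (l - 1) + r i) 0).prod)
      (List.ofFn fun i => cMon R l (A i) (lastVec (A i).length (p i))).prod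
      (blockProd R l A r p) := by
  have := Leads.prod hdisj fun i => leads_signedCycle (R := R) (l := l) hA hdisj i (hne i) (r i) (p i)
  rw [prod_ofFn_smul, ← sg_sum] at this
  exact this

/-- Each factor contributes its own `p i`, whether or not `j` lies in its block. -/
lemma c_mul_blockProd_of_notHead {A : Fin m → List (Fin d)} (hne : ∀ i, A i ≠ [])
    (hA : ∀ i, (A i).Nodup) (r : Fin m → ℕ) (p : Fin m → ZMod 2) {j : Fin d}
    (hj : NotHead A j) :
    c R l j * blockProd R l A r p = sg R (∑ i, p i) • (blockProd R l A r p * c R l j) := by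
  have := mul_prod_ofFn_pow (R := R) (fun i => signedCycle R l (A i) (r i) (p i)) (c R l j) p
    (fun i => c_mul_signedCycle_of_ne_head R l (hne i) (hA i) (r i) (p i) (by
      rintro rfl
      exact hj i (List.head?_eq_some_head _))) (fun _ => 1)
  simpa [blockProd] using this

/-- The other blocks contribute their parities and block `i` its head sign; modulo 2 the extra `p i`
removes that term from the full sum. -/
lemma c_mul_blockProd_head (hl : 1 ≤ l) {A : Fin m → List (Fin d)} (hne : ∀ i, A i ≠ [])
    (hA : ∀ i, (A i).Nodup) (hdisj : ∀ i j, i ≠ j → (A i).Disjoint (A j)) (r : Fin m → ℕ)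
    (p : Fin m → ZMod 2) (i : Fin m) :
    c R l ((A i).head (hne i)) * blockProd R l A r p =
      sg R (∑ k, p k + p i + ((((A i).length - 1) * l + r i : ℕ) : ZMod 2)) •
        (blockProd R l A r p * c R l ((A i).head (hne i))) := by
  have := mul_prod_ofFn_pow (R := R) (fun i => signedCycle R l (A i) (r i) (p i))
    (c R l ((A i).head (hne i)))
    (Function.update p i ((((A i).length - 1) * l + r i : ℕ) : ZMod 2))
    (fun k => by
      rcases eq_or_ne k i with rfl | hk
      · rw [Function.update_self]
        exact c_mul_signedCycle_head R hl (hne k) (hA k) (r k) (p k)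
      · rw [Function.update_of_ne hk]
        refine c_mul_signedCycle_of_notMem R l (r k) (p k) fun hmem => ?_
        exact hdisj k i hk hmem (List.head_mem (hne i))) (fun _ => 1)
  simp only [pow_one, Nat.cast_one, mul_one] at this
  rw [blockProd, this]
  congr 2
  rw [Finset.sum_update_of_mem (Finset.mem_univ i), ← Finset.add_sum_erase _ p (Finset.mem_univ i),
    Finset.sdiff_singleton_eq_erase]
  linear_combination -(zmod_two_add_self (p i))

variable [NeZero l]

open Classical in
-- The factors are unsigned and use disjoint variables, so a monomial arises in at most one way: the
-- exponents on each block must be the restriction of `ν`, which is the `ρ₀` of the proof for the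
-- first block.
lemma coef_prod_hSigned {A : Fin m → List (Fin d)}
    (hA : ∀ i, (A i).Nodup) (hdisj : ∀ i j, i ≠ j → (A i).Disjoint (A j)) (n : Fin m → ℕ)
    (ν : Fin d → ℕ) :
    coef R l d (List.ofFn fun i => hSigned R l (A i) (n i) 0).prod ν 1 0 =
      if (∀ j, ν j < l) ∧ (∀ j, (∀ i, j ∉ A i) → ν j = 0) ∧
        ∀ i, ∑ k, ν ((A i).get k) = n i then 1 else 0 := by
  induction m generalizing ν with
  | zero =>
    simp only [List.ofFn_zero, List.prod_nil, coef_one, vac]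
    congr 1
    simp only [and_self, and_true, IsEmpty.forall_iff, true_imp_iff, eq_iff_iff]
    refine ⟨?_, fun h => funext h.2⟩
    rintro rfl
    exact ⟨fun _ => Nat.pos_of_ne_zero (NeZero.ne l), fun _ => rfl⟩
  | succ m ih =>
    have hdisj' : ∀ i j : Fin m, i ≠ j → (A i.succ).Disjoint (A j.succ) :=
      fun i j hij => hdisj _ _ (by simpa using hij)
    set Y := (List.ofFn fun i : Fin m => hSigned R l (A i.succ) (n i.succ) 0).prod with hY
    have hYmem : Y ∈ polyOn R l {j | ∃ i : Fin m, j ∈ A i.succ} := by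
      refine Subalgebra.list_prod_mem _ fun y hy => ?_
      obtain ⟨i, rfl⟩ := (List.mem_ofFn' _ _).1 hy
      exact polyOn_mono (S' := {j | ∃ i : Fin m, j ∈ A i.succ}) (fun j hj => ⟨i, hj⟩)
        (hSigned_mem_polyOn (A i.succ) _ _)
    have h0 : ∀ i : Fin m, ∀ j ∈ A 0, j ∉ A i.succ := fun i j hj hi =>
      hdisj 0 i.succ (Fin.succ_ne_zero i).symm hj hi
    set ρ₀ : Fin (A 0).length → ℕ := fun k => ν ((A 0).get k) with hρ₀
    have hle : ∀ j, expo (A 0) ρ₀ j ≤ ν j := by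
      intro j
      by_cases hj : j ∈ A 0
      · obtain ⟨k, rfl⟩ := List.get_of_mem hj
        rw [expo_get (hA 0)]
      · rw [expo_eq_zero _ hj]; exact Nat.zero_le _
    have hsub : ∀ j, (ν - expo (A 0) ρ₀) j = if j ∈ A 0 then 0 else ν j := by
      intro j
      rw [Pi.sub_apply]
      split_ifs with hj
      · obtain ⟨k, rfl⟩ := List.get_of_mem hj
        rw [expo_get (hA 0), hρ₀, Nat.sub_self]
      · rw [expo_eq_zero _ hj, Nat.sub_zero]
    have hzero : ∀ ρ ∈ Finset.Nat.antidiagonalTuple (A 0).length (n 0), ρ ≠ ρ₀ →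
        (if ∀ j, expo (A 0) ρ j ≤ ν j ∧ ν j < l then coef R l d Y (ν - expo (A 0) ρ) 1 0
          else 0) = 0 := by
      intro ρ _ hne
      split_ifs with hcond
      · obtain ⟨k, hk⟩ := Function.ne_iff.1 hne
        refine coef_poly_eq_zero hYmem (j := (A 0).get k) ?_ ?_ _ _
        · rintro ⟨i, hi⟩
          exact h0 i _ ((A 0).get_mem k) hi
        · have := (hcond ((A 0).get k)).1
          rw [Pi.sub_apply]
          rw [expo_get (hA 0)] at this ⊢
          change ρ k ≠ ν ((A 0).get k) at hk
          omega
      · rfl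
    have hexp : coef R l d (hSigned R l (A 0) (n 0) 0 * Y) ν 1 0 =
        ∑ ρ ∈ Finset.Nat.antidiagonalTuple (A 0).length (n 0),
          if ∀ j, expo (A 0) ρ j ≤ ν j ∧ ν j < l then coef R l d Y (ν - expo (A 0) ρ) 1 0
            else 0 := by
      rw [hSigned, Finset.sum_mul, map_sum, Finset.sum_apply, Finset.sum_apply, Finset.sum_apply]
      refine Finset.sum_congr rfl fun ρ _ => ?_
      simp only [Pi.zero_apply, zero_mul, Finset.sum_const_zero, sg_zero, one_smul]
      rw [coef_xMon_mul]
    rw [List.ofFn_succ, List.prod_cons, hexp]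
    by_cases hn : ∑ k, ν ((A 0).get k) = n 0
    · rw [Finset.sum_eq_single ρ₀ hzero
        (fun h => absurd (Finset.Nat.mem_antidiagonalTuple.2 hn) h), hY,
        ih (fun i => hA _) hdisj', ← ite_and]
      congr 1
      simp only [eq_iff_iff, Fin.forall_fin_succ, hsub]
      have hsum : ∀ i : Fin m, ∑ k, (if (A i.succ).get k ∈ A 0 then 0 else ν ((A i.succ).get k)) =
          ∑ k, ν ((A i.succ).get k) := fun i =>
        Finset.sum_congr rfl fun k _ => if_neg fun hk => h0 i _ hk ((A i.succ).get_mem k)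
      simp only [hsum, hn, true_and]
      constructor
      · rintro ⟨h1, -, h2, h3⟩
        refine ⟨fun j => (h1 j).2, fun j hj => ?_, h3⟩
        have := h2 j hj.2
        rwa [if_neg hj.1] at this
      · rintro ⟨h1, h2, h3⟩
        refine ⟨fun j => ⟨hle j, h1 j⟩, fun j => ?_, fun j hj => ?_, h3⟩
        · split_ifs
          · exact Nat.pos_of_ne_zero (NeZero.ne l)
          · exact h1 j
        · split_ifs with hj0
          · rfl
          · exact h2 j ⟨hj0, hj⟩
    · rw [if_neg (fun h => hn (h.2.2 0))]
      refine Finset.sum_eq_zero fun ρ hρ => hzero ρ hρ ?_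
      rintro rfl
      exact hn (Finset.Nat.mem_antidiagonalTuple.1 hρ)

open Classical in
/-- The coefficients of a monomial multiple of a product of signed cycles at the ends of the
blocks. -/
lemma exists_coef_blockProd {A : Fin m → List (Fin d)} (hne : ∀ i, A i ≠ [])
    (hA : ∀ i, (A i).Nodup) (hdisj : ∀ i j, i ≠ j → (A i).Disjoint (A j)) (p : Fin m → ZMod 2) :
    ∃ t : ZMod 2, ∀ (μ : Fin d → ℕ) (r : Fin m → ℕ), (∀ i, ∀ j ∈ A i, μ j = 0) → ∀ ν,
      coef R l d (xMon R l μ * blockProd R l A r p) ν (blockPerm A) (ends A hne p) =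
        if (∀ j, ν j < l) ∧ (∀ j, (∀ i, j ∉ A i) → ν j = μ j) ∧
          ∀ i, ∑ k, ν ((A i).get k) = ((A i).length - 1) * (l - 1) + r i
        then sg R t else 0 := by
  -- The leading Clifford word does not depend on `r`, so the sign found for `r = 0` serves for all
  -- `r`.
  obtain ⟨t, ht⟩ := (leads_blockProd (R := R) (l := l) hne hA hdisj 0 p).word.exists_coef_self
  refine ⟨t + ∑ i, ((tauExp (lastVec (A i).length (p i)) : ℕ) : ZMod 2), fun μ r hμ ν => ?_⟩
  have hL := leads_blockProd (R := R) (l := l) hne hA hdisj r p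
  rw [coef_xMon_mul, hL.coef_eq, ht _ _ hL.poly, map_smul]
  simp only [Pi.smul_apply]
  rw [coef_prod_hSigned hA hdisj]
  have hdeg : ∀ i, ∑ k, (ν - μ) ((A i).get k) = ∑ k, ν ((A i).get k) := fun i =>
    Finset.sum_congr rfl fun k _ => by
      rw [Pi.sub_apply, hμ i _ ((A i).get_mem k), Nat.sub_zero]
  simp only [hdeg]
  by_cases hc : ∀ j, μ j ≤ ν j ∧ ν j < l
  · rw [if_pos hc]
    have h1 : (∀ j, (ν - μ) j < l) ↔ ∀ j, ν j < l :=
      ⟨fun _ j => (hc j).2, fun _ j => lt_of_le_of_lt (Nat.sub_le _ _) (hc j).2⟩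
    have h2 : (∀ j, (∀ i, j ∉ A i) → (ν - μ) j = 0) ↔ ∀ j, (∀ i, j ∉ A i) → ν j = μ j := by
      refine forall_congr' fun j => forall_congr' fun _ => ?_
      have := (hc j).1
      rw [Pi.sub_apply]
      omega
    simp only [h1, h2]
    split_ifs
    · rw [smul_eq_mul, mul_one, sg_add]
    · simp
  · rw [if_neg hc, if_neg]
    rintro ⟨h1, h2, -⟩
    apply hc
    intro j
    refine ⟨?_, h1 j⟩
    by_cases hj : ∃ i, j ∈ A i
    · obtain ⟨i, hi⟩ := hj
      rw [hμ i j hi]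
      exact Nat.zero_le _
    · push Not at hj
      exact (h2 j hj).ge

lemma eq_of_coef_blockProd_ne_zero {A : Fin m → List (Fin d)} (hne : ∀ i, A i ≠ [])
    (hA : ∀ i, (A i).Nodup) (hdisj : ∀ i j, i ≠ j → (A i).Disjoint (A j)) (p : Fin m → ZMod 2)
    {μ : Fin d → ℕ} {r : Fin m → ℕ} {ν : Fin d → ℕ} {w α}
    (h : coef R l d (xMon R l μ * blockProd R l A r p) ν w α ≠ 0) :
    w = blockPerm A ∧ collect A α = ends A hne p := by
  rw [coef_xMon_mul] at h
  split_ifs at h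
  · exact (leads_blockProd hne hA hdisj r p).coef_ne_zero h
  · exact absurd rfl h

end BlockProducts

/-! ### Odd skew cycles -/

section OddSkew

variable {R : Type*} [CommRing R] {l : ℕ} {d : ℕ}

lemma cMon_mem_cliffOn (A : List (Fin d)) (α : Fin A.length → ZMod 2) :
    cMon R l A α ∈ cliffOn R l {i | i ∈ A} := by
  refine Subalgebra.list_prod_mem _ fun y hy => ?_
  obtain ⟨k, rfl⟩ := (List.mem_ofFn' _ _).1 hy
  have h : c R l (A.get k) ∈ cliffOn R l {i | i ∈ A} :=
    Algebra.subset_adjoin (Set.mem_image_of_mem (c R l) (A.get_mem k))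
  exact pow_mem h _

/-- In degree `a(l-1)` every monomial other than the one with all exponents `l - 1` has an exponent
of at least `l`, hence vanishes. -/
lemma hSigned_top {A : List (Fin d)} (hA : A.Nodup) (hl : 1 ≤ l) (ε : Fin A.length → ZMod 2) :
    hSigned R l A (A.length * (l - 1)) ε =
      sg R (∑ k, ε k * ((l - 1 : ℕ) : ZMod 2)) • xMon R l (expo A fun _ => l - 1) := by
  rw [hSigned, Finset.sum_eq_single fun _ => l - 1]
  · intro ρ hρ hne
    rw [Finset.Nat.mem_antidiagonalTuple] at hρ
    have h : ∃ k, l ≤ ρ k := by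
      by_contra! hlt
      obtain ⟨k₀, hk₀⟩ := Function.ne_iff.1 hne
      have : ∑ k, ρ k < ∑ _k : Fin A.length, (l - 1) := by
        refine Finset.sum_lt_sum (fun k _ => by have := hlt k; omega) ⟨k₀, Finset.mem_univ _, ?_⟩
        have := hlt k₀
        omega
      simp at this
      omega
    obtain ⟨k, hk⟩ := h
    rw [xMon_eq_zero (j := A.get k) (by rwa [expo_get hA]), smul_zero]
  · intro h
    exact absurd (Finset.Nat.mem_antidiagonalTuple.2 (by simp)) h

/-- For `r = l - 1` all terms share the top monomial up to sign, so the sum takes the shape `f σ_A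
c` required of a skew cycle. -/
lemma signedCycle_top {A : List (Fin d)} (hA : A.Nodup) (hne : A ≠ []) (hl : 1 ≤ l)
    (p : ZMod 2) : ∃ a : (Fin A.length → ZMod 2) → R, signedCycle R l A (l - 1) p =
      ∑ α : Fin A.length → ZMod 2 with ∑ k, α k = p,
        a α • (xMon R l (expo A fun _ => l - 1) * sigma R l A * cMon R l A α) := by
  have hn : (A.length - 1) * (l - 1) + (l - 1) = A.length * (l - 1) := by
    have : 0 < A.length := List.length_pos_iff.2 hne
    obtain ⟨n, hn⟩ := Nat.exists_eq_add_of_lt this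
    rw [hn]
    simp [add_mul]
  refine ⟨fun α => sg R ((tauExp α : ℕ) : ZMod 2) *
    sg R (∑ k, pre α k * ((l - 1 : ℕ) : ZMod 2)), ?_⟩
  rw [signedCycle]
  refine Finset.sum_congr rfl fun α _ => ?_
  rw [xCycle, h_eq_hSigned, hn, hSigned_top hA hl, mul_smul, smul_mul_assoc, smul_mul_assoc]

lemma x_mem_evenPart (i : Fin d) : x R l i ∈ evenPart R l d :=
  Algebra.subset_adjoin (.inl (.inl ⟨i, rfl⟩))

lemma s_mem_evenPart (w : Equiv.Perm (Fin d)) : s R l w ∈ evenPart R l d :=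
  Algebra.subset_adjoin (.inl (.inr ⟨w, rfl⟩))

lemma xMon_mem_evenPart (ν : Fin d → ℕ) : xMon R l ν ∈ evenPart R l d := by
  refine Subalgebra.list_prod_mem _ fun y hy => ?_
  obtain ⟨k, rfl⟩ := (List.mem_ofFn' _ _).1 hy
  exact pow_mem (x_mem_evenPart k) _

/-- Prepending a letter exchanges the two parities, hence the joint induction. -/
lemma CliffWord.mem_evenPart {S : Set (Fin d)} {γ : Fin d → ZMod 2} {e : Gr R l d}
    (he : CliffWord S γ e) : (∑ j, γ j = 0 → e ∈ evenPart R l d) ∧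
      (∑ j, γ j = 1 → ∀ i, c R l i * e ∈ evenPart R l d) := by
  induction he with
  | one => exact ⟨fun _ => one_mem _, fun h => by simp at h⟩
  | cons j γ e hj _ ih =>
    rw [add_comm, sum_add_single]
    refine ⟨fun h => ih.2 ?_ j, fun h i => ?_⟩
    · rwa [CharTwo.add_eq_zero] at h
    · rw [← mul_assoc]
      exact mul_mem (Algebra.subset_adjoin (.inr ⟨i, j, rfl⟩)) (ih.1 (by simpa using h))

lemma sum_sum_single_get (A : List (Fin d)) (α : Fin A.length → ZMod 2) :
    ∑ j, (∑ k, Pi.single (A.get k) (α k) : Fin d → ZMod 2) j = ∑ k, α k := by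
  simp only [Finset.sum_apply]
  rw [Finset.sum_comm]
  simp

/-- The top monomial kills every `x_j` of the block, so commuting with these is `0 = 0`; the
remaining `x_j` commute with each factor. Oddness is seen by writing `y = c_i (c_i y)`.
Anticommutation holds away from the head because the parity is 1, and at the head by `hp`. -/
lemma isOddSkewCycle_signedCycle {A : List (Fin d)} (hA : A.Nodup) (hne : A ≠ []) (hl : 1 ≤ l)
    (hp : (((A.length - 1) * l + (l - 1) : ℕ) : ZMod 2) = 1) :
    IsOddSkewCycle A (signedCycle R l A (l - 1) 1) := by
  obtain ⟨a, ha⟩ := signedCycle_top (R := R) hA hne hl 1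
  set X := xMon R l (expo A fun _ => l - 1) with hX
  have hXx : ∀ j ∈ A, X * x R l j = 0 := by
    intro j hj
    obtain ⟨k, rfl⟩ := List.get_of_mem hj
    rw [← pow_one (x R l _), ← xMon_single, hX, xMon_mul_xMon]
    refine xMon_eq_zero (j := A.get k) ?_
    rw [Pi.add_apply, expo_get hA, Pi.single_eq_same]
    omega
  have hxX : ∀ j, x R l j * X = X * x R l j := by
    intro j
    rw [← pow_one (x R l _), ← xMon_single, hX, xMon_mul_xMon, xMon_mul_xMon, add_comm]
  refine ⟨⟨X, xMon_mem_polyOn fun j hj => expo_eq_zero _ hj,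
    ∑ α : Fin A.length → ZMod 2 with ∑ k, α k = 1, a α • cMon R l A α,
    sum_mem fun α _ => Subalgebra.smul_mem _ (cMon_mem_cliffOn A α) _, ?_⟩, ?_, ?_, ?_⟩
  · rw [ha, Finset.mul_sum]
    exact Finset.sum_congr rfl fun α _ => (mul_smul_comm _ _ _).symm
  · rw [CX, Subalgebra.mem_centralizer_iff]
    rintro _ ⟨j, rfl⟩
    rw [ha, Finset.mul_sum, Finset.sum_mul]
    refine Finset.sum_congr rfl fun α _ => ?_
    rw [mul_smul_comm, smul_mul_assoc]
    congr 1
    by_cases hj : j ∈ A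
    · have h1 := mul_prod_ofFn_pow (R := R) (fun k => c R l (A.get k)) (x R l j)
        (fun k => if j = A.get k then 1 else 0) (fun k => x_mul_c R l j (A.get k))
        (fun k => (α k).val)
      have h2 : cMon R l A α * x R l j = sg R (∑ k, (if j = A.get k then 1 else 0) *
          ((α k).val : ZMod 2)) • (x R l j * cMon R l A α) := by
        rw [cMon, h1, sg_smul_sg_smul]
      have h3 : x R l j * (X * sigma R l A * cMon R l A α) = 0 := by
        rw [← mul_assoc, ← mul_assoc, hxX, hXx j hj, zero_mul, zero_mul]
      rw [h3, mul_assoc (X * sigma R l A), h2, mul_smul_comm, ← mul_assoc (X * sigma R l A),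
        mul_assoc X, sigma, s_mul_x, ← mul_assoc X, hXx _ (List.formPerm_apply_mem_of_mem hj),
        zero_mul, zero_mul, smul_zero]
    · have h1 : cMon R l A α * x R l j = x R l j * cMon R l A α :=
        (cliffWord_cMon A α).commute_c fun i hi => commute_c_x fun h => hj (h ▸ hi)
      have h2 : sigma R l A * x R l j = x R l j * sigma R l A :=
        commute_s_x (List.formPerm_apply_of_notMem hj)
      rw [mul_assoc, mul_assoc, mul_assoc, h1, ← mul_assoc (sigma R l A), h2, ← mul_assoc,
        ← mul_assoc, ← mul_assoc, hxX, mul_assoc, mul_assoc, mul_assoc, mul_assoc]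
  · rw [ha]
    refine sum_mem fun α hα => Submodule.smul_mem _ _ ?_
    have hα1 : ∑ k, α k = 1 := (Finset.mem_filter.1 hα).2
    set i := A.head hne with hi
    have h1 : X * sigma R l A * cMon R l A α =
        c R l i * (c R l i * (X * sigma R l A * cMon R l A α)) := by
      rw [← mul_assoc, c_mul_self, one_mul]
    rw [h1]
    refine Submodule.subset_span ⟨i, _, ?_, rfl⟩
    have h2 : c R l i * (X * sigma R l A * cMon R l A α) =
        sg R ((expo A (fun _ => l - 1) i : ℕ) : ZMod 2) •
          (X * sigma R l A * (c R l (A.formPerm⁻¹ i) * cMon R l A α)) := by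
      rw [← mul_assoc, ← mul_assoc, hX, c_mul_xMon, smul_mul_assoc, smul_mul_assoc, mul_assoc X,
        sigma, c_mul_s]
      simp only [mul_assoc]
      rfl
    rw [h2]
    refine Subalgebra.smul_mem _ (mul_mem (mul_mem (xMon_mem_evenPart _) (s_mem_evenPart _))
      ((cliffWord_cMon A α).mem_evenPart.2 ?_ _)) _
    rw [sum_sum_single_get, hα1]
  · intro j
    have h : c R l j * signedCycle R l A (l - 1) 1 =
        sg R 1 • (signedCycle R l A (l - 1) 1 * c R l j) := by
      by_cases hj : j = A.head hne
      · rw [hj, c_mul_signedCycle_head R hl hne hA, hp]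
      · exact c_mul_signedCycle_of_ne_head R l hne hA _ _ hj
    rw [h, neg_eq_sg_smul, sg_smul_sg_smul]

end OddSkew

/-! ### Commuting with the polynomial generators -/

section Levels

variable {d : ℕ}

lemma sum_add_single_sub {S : Finset (Fin d)} {j k : Fin d} (hjk : j ∈ S ↔ k ∈ S)
    {ν : Fin d → ℕ} (hj : 1 ≤ ν j) :
    ∑ i ∈ S, (ν + Pi.single k 1 - Pi.single j 1 : Fin d → ℕ) i = ∑ i ∈ S, ν i := by
  have h : ν + Pi.single k 1 - Pi.single j 1 + Pi.single j 1 = ν + Pi.single k 1 := by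
    funext i
    by_cases hi : i = j
    · subst hi; simp; omega
    · simp [hi]
  have h1 := congrArg (fun g : Fin d → ℕ => ∑ i ∈ S, g i) h
  simp only [Pi.add_apply, Finset.sum_add_distrib, Finset.sum_pi_single', hjk] at h1
  simpa using h1

variable {M : Type*} [Zero M] {l : ℕ}

/-- Functions of exponents invariant under moving exponents inside blocks are constant on
levels. -/
lemma eq_of_move {ι : Type*} (S : ι → Finset (Fin d))
    (hdisj : ∀ i i', i ≠ i' → Disjoint (S i) (S i')) (φ : (Fin d → ℕ) → M)
    (hmove : ∀ i, ∀ j ∈ S i, ∀ k ∈ S i, j ≠ k → ∀ ν : Fin d → ℕ, (∀ t, ν t < l) → ν k + 1 < l →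
      φ ν = if 1 ≤ ν j then φ (ν + Pi.single k 1 - Pi.single j 1) else 0)
    {ν ν' : Fin d → ℕ} (hν : ∀ j, ν j < l) (hν' : ∀ j, ν' j < l)
    (hout : ∀ j, (∀ i, j ∉ S i) → ν j = ν' j) (hsum : ∀ i, ∑ j ∈ S i, ν j = ∑ j ∈ S i, ν' j) :
    φ ν = φ ν' := by
  -- Induction on the total deficit of `ν` with respect to `ν'`. A deficit at `k` is matched by a
  -- surplus at some `j` of the same block, as block sums agree; a unit is moved from `j` to `k`.
  -- Deficit 0 gives `ν' ≤ ν`, which equal sums turn into equality.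
  obtain ⟨n, hn⟩ : ∃ n, ∑ j, (ν' j - ν j) = n := ⟨_, rfl⟩
  induction n generalizing ν with
  | zero =>
    have hle : ∀ j, ν' j ≤ ν j := fun j =>
      tsub_eq_zero_iff_le.1 (Finset.sum_eq_zero_iff.1 hn j (Finset.mem_univ j))
    congr 1
    funext j
    by_cases hj : ∃ i, j ∈ S i
    · obtain ⟨i, hi⟩ := hj
      exact ((Finset.sum_eq_sum_iff_of_le fun j _ => hle j).1 (hsum i).symm j hi).symm
    · push Not at hj
      exact hout j hj
  | succ n ih =>
    obtain ⟨k, -, hk⟩ : ∃ k ∈ Finset.univ, ν' k - ν k ≠ 0 :=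
      Finset.exists_ne_zero_of_sum_ne_zero (by omega)
    obtain ⟨i, hki⟩ : ∃ i, k ∈ S i := by
      by_contra! h
      have := hout k h
      omega
    obtain ⟨j, hji, hj⟩ : ∃ j ∈ S i, ν' j < ν j := by
      by_contra! h
      have : ∑ j ∈ S i, ν j < ∑ j ∈ S i, ν' j := Finset.sum_lt_sum h ⟨k, hki, by omega⟩
      have := hsum i
      omega
    have hjk : j ≠ k := by rintro rfl; omega
    have hkl := hν' k
    rw [hmove i j hji k hki hjk ν hν (by omega), if_pos (by omega)]
    have hval : ∀ t, (ν + Pi.single k 1 - Pi.single j 1 : Fin d → ℕ) t =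
        if t = k then ν k + 1 else if t = j then ν j - 1 else ν t := by
      intro t
      by_cases h1 : t = k
      · subst h1; simp [hjk]
      · by_cases h2 : t = j
        · subst h2; simp [h1]
        · simp [h1, h2]
    apply ih
    · intro t
      rw [hval]
      have := hν t
      split_ifs with h1 h2
      · omega
      · subst h2; omega
      · exact this
    · intro t ht
      rw [hval, if_neg, if_neg, hout t ht]
      · rintro rfl; exact ht i hji
      · rintro rfl; exact ht i hki
    · intro i'
      rw [sum_add_single_sub _ (by omega), hsum]
      rcases eq_or_ne i i' with rfl | hii
      · exact iff_of_true hji hki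
      · have := Finset.disjoint_left.1 (hdisj i i' hii)
        exact iff_of_false (this hji) (this hki)
    · have h1 : ∑ t, (ν' t - ν t) =
          ∑ t, (ν' t - (ν + Pi.single k 1 - Pi.single j 1 : Fin d → ℕ) t) +
            ∑ t, if t = k then 1 else 0 := by
        rw [← Finset.sum_add_distrib]
        refine Finset.sum_congr rfl fun t _ => ?_
        rw [hval]
        split_ifs with h1 h2
        · subst h1; omega
        · subst h2; omega
        · omega
      rw [Finset.sum_ite_eq' Finset.univ k, if_pos (Finset.mem_univ k)] at h1
      omega

/-- Empty one letter `j` into the others. Below degree `(|S|-1)(l-1)` the other letters are never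
all full, and a further move out of the exhausted `j` gives 0. -/
lemma eq_zero_of_move {S : Finset (Fin d)} (hS : S.Nonempty) (φ : (Fin d → ℕ) → M)
    (hmove : ∀ j ∈ S, ∀ k ∈ S, j ≠ k → ∀ ν : Fin d → ℕ, (∀ t, ν t < l) → ν k + 1 < l →
      φ ν = if 1 ≤ ν j then φ (ν + Pi.single k 1 - Pi.single j 1) else 0)
    {ν : Fin d → ℕ} (hν : ∀ j, ν j < l) (hsum : ∑ j ∈ S, ν j < (S.card - 1) * (l - 1)) :
    φ ν = 0 := by
  obtain ⟨j, hj⟩ := hS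
  obtain ⟨n, hn⟩ : ∃ n, ν j = n := ⟨_, rfl⟩
  have key : ∀ ν : Fin d → ℕ, ∑ j ∈ S, ν j < (S.card - 1) * (l - 1) →
      ∃ k ∈ S, j ≠ k ∧ ν k + 1 < l := by
    intro ν hsum
    by_contra! h
    have h1 : (S.erase j).card * (l - 1) ≤ ∑ k ∈ S.erase j, ν k := by
      rw [← smul_eq_mul]
      refine Finset.card_nsmul_le_sum _ _ _ fun k hk => ?_
      have := h k (Finset.mem_of_mem_erase hk) (Finset.ne_of_mem_erase hk).symm
      omega
    rw [Finset.card_erase_of_mem hj] at h1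
    have h2 := Finset.add_sum_erase S ν hj
    omega
  induction n generalizing ν with
  | zero =>
    obtain ⟨k, hk, hjk, hlt⟩ := key ν hsum
    rw [hmove j hj k hk hjk ν hν hlt, if_neg (by omega)]
  | succ n ih =>
    obtain ⟨k, hk, hjk, hlt⟩ := key ν hsum
    rw [hmove j hj k hk hjk ν hν hlt, if_pos (by omega)]
    apply ih
    · intro t
      have := hν t
      by_cases h1 : t = k
      · subst h1; simp [hjk]; omega
      · by_cases h2 : t = j
        · subst h2; simp [h1]; omega
        · simp [h1, h2]; omega
    · rwa [sum_add_single_sub (iff_of_true hj hk) (by omega)]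
    · simp [hjk, hn]

end Levels

/-! ### Coefficients of elements of the centralizer of the polynomials -/

section XCommuting

variable {R : Type*} [CommRing R] {l : ℕ} {d m : ℕ} [NeZero l]

lemma coef_x_comm {z : Gr R l d} (hz : z ∈ CX R l d) (j : Fin d) (ν w α) :
    coef R l d (x R l j * z) ν w α = sg R (α j) * coef R l d (x R l (w j) * z) ν w α := by
  rw [CX, Subalgebra.mem_centralizer_iff] at hz
  rw [hz _ ⟨j, rfl⟩, coef_mul_x]

lemma coef_x_block {A : Fin m → List (Fin d)} (hA : ∀ i, (A i).Nodup)
    (hdisj : ∀ i j, i ≠ j → (A i).Disjoint (A j)) {z : Gr R l d} (hz : z ∈ CX R l d) (i : Fin m)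
    (hne : A i ≠ []) (ν α) (k : ℕ) (hk : k < (A i).length) :
    coef R l d (x R l ((A i).head hne) * z) ν (blockPerm A) α =
      sg R (((A i).map α).take k).sum *
        coef R l d (x R l (A i)[k] * z) ν (blockPerm A) α := by
  induction k with
  | zero => simp [List.head_eq_getElem]
  | succ k ih =>
    rw [ih (by omega), coef_x_comm hz, blockPerm_get hA hdisj i k hk, ← mul_assoc, ← sg_add,
      List.sum_take_succ _ _ (by simpa using by omega), List.getElem_map]

/-- Going once around the cycle returns to the same letter and collects the signs of all entries of
`α` on the block. -/
lemma coef_x_head {A : Fin m → List (Fin d)} (hA : ∀ i, (A i).Nodup)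
    (hdisj : ∀ i j, i ≠ j → (A i).Disjoint (A j)) {z : Gr R l d} (hz : z ∈ CX R l d) (i : Fin m)
    (hne : A i ≠ []) (ν α) :
    coef R l d (x R l ((A i).head hne) * z) ν (blockPerm A) α =
      sg R ((A i).map α).sum *
        coef R l d (x R l ((A i).head hne) * z) ν (blockPerm A) α := by
  have hlen : 0 < (A i).length := List.length_pos_iff.2 hne
  have hlast : blockPerm A (A i)[(A i).length - 1] = (A i).head hne := by
    rw [blockPerm_apply_of_mem hdisj (List.getElem_mem _), List.formPerm_apply_getElem _ (hA i),
      List.head_eq_getElem]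
    simp [Nat.sub_add_cancel hlen]
  conv_lhs => rw [coef_x_block hA hdisj hz i hne ν α ((A i).length - 1) (by omega),
    coef_x_comm hz, hlast, ← mul_assoc, ← sg_add]
  congr 2
  have := List.sum_take_succ ((A i).map α) ((A i).length - 1) (by simpa using by omega)
  rw [List.getElem_map, Nat.sub_add_cancel hlen, List.take_of_length_le (by simp)] at this
  exact this.symm

/-- If the sign is odd on a block, the coefficients are of maximal degree there. -/
lemma eq_of_coef_ne_zero_of_odd (h2 : (2 : R) ∈ nonZeroDivisors R) {A : Fin m → List (Fin d)}
    (hA : ∀ i, (A i).Nodup)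
    (hdisj : ∀ i j, i ≠ j → (A i).Disjoint (A j)) {z : Gr R l d} (hz : z ∈ CX R l d) (i : Fin m)
    {ν α} (hα : ((A i).map α).sum = 1) (h : coef R l d z ν (blockPerm A) α ≠ 0) {j : Fin d}
    (hj : j ∈ A i) : ν j = l - 1 := by
  have hne : A i ≠ [] := List.ne_nil_of_mem hj
  obtain ⟨k, hk, rfl⟩ := List.getElem_of_mem hj
  have hlt := lt_of_coef_ne_zero h (A i)[k]
  by_contra hνj
  apply h
  -- At `ν + e_j`, still below `l` if `ν j` is not maximal, the coefficient of `x_j z` is that of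
  -- `z` at `ν`.
  have h1 := coef_x_head hA hdisj hz i hne (ν + Pi.single (A i)[k] 1) α
  rw [hα, sg_one] at h1
  have h3 : coef R l d (x R l ((A i).head hne) * z) (ν + Pi.single (A i)[k] 1)
      (blockPerm A) α = 0 := by
    refine (mul_right_mem_nonZeroDivisors_eq_zero_iff h2).1 ?_
    linear_combination h1
  rw [coef_x_block hA hdisj hz i hne _ α k hk, (isUnit_sg R _).mul_right_eq_zero, coef_x_mul,
    if_pos (by simp; omega), add_tsub_cancel_right] at h3
  exact h3

/-- At `α = 0` there are no signs, so all `x_t z` with `t` in the block have the same coefficients.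
Reading those of `x_k z` and `x_j z` at `ν + e_k` gives the move. -/
lemma coef_move {A : Fin m → List (Fin d)} (hA : ∀ i, (A i).Nodup)
    (hdisj : ∀ i j, i ≠ j → (A i).Disjoint (A j)) {z : Gr R l d} (hz : z ∈ CX R l d) (i : Fin m)
    {j k : Fin d} (hj : j ∈ A i) (hk : k ∈ A i) (hjk : j ≠ k) {ν : Fin d → ℕ}
    (hν : ∀ t, ν t < l) (hνk : ν k + 1 < l) :
    coef R l d z ν (blockPerm A) 0 = if 1 ≤ ν j then
      coef R l d z (ν + Pi.single k 1 - Pi.single j 1) (blockPerm A) 0 else 0 := by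
  have hne : A i ≠ [] := List.ne_nil_of_mem hj
  have hall : ∀ t ∈ A i, ∀ ν, coef R l d (x R l ((A i).head hne) * z) ν (blockPerm A) 0 =
      coef R l d (x R l t * z) ν (blockPerm A) 0 := by
    intro t ht ν
    obtain ⟨n, hn, rfl⟩ := List.getElem_of_mem ht
    rw [coef_x_block hA hdisj hz i hne ν 0 n hn]
    have : (((A i).map (0 : Fin d → ZMod 2)).take n).sum = 0 := by
      refine List.sum_eq_zero fun y hy => ?_
      obtain ⟨t, -, rfl⟩ := List.mem_map.1 (List.mem_of_mem_take hy)
      rfl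
    rw [this, sg_zero, one_mul]
  have h := (hall k hk (ν + Pi.single k 1)).symm.trans (hall j hj (ν + Pi.single k 1))
  rw [coef_x_mul, coef_x_mul, if_pos (by simp; omega), add_tsub_cancel_right] at h
  rw [h]
  have : (ν + Pi.single k 1 : Fin d → ℕ) j = ν j := by simp [hjk]
  rw [this]
  simp only [hν j, and_true]

end XCommuting

/-! ### Parities forced by commuting with the Clifford generators -/

section Parity

variable {R : Type*} [CommRing R] {l : ℕ} {d m : ℕ}

lemma collect_eq_ends {A : Fin m → List (Fin d)} (hne : ∀ i, A i ≠ []) (hA : ∀ i, (A i).Nodup)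
    (hdisj : ∀ i j, i ≠ j → (A i).Disjoint (A j)) {β : Fin d → ZMod 2}
    (hβ : ∀ j, (∀ i, j ∉ A i) → β j = 0) :
    collect A β = ends A hne fun i => ((A i).map β).sum := by
  have h : β = ∑ i, ∑ k, Pi.single ((A i).get k) (β ((A i).get k)) := by
    funext j
    rw [Finset.sum_apply]
    have hz : ∀ i, j ∉ A i →
        (∑ k, Pi.single ((A i).get k) (β ((A i).get k)) : Fin d → ZMod 2) j = 0 := by
      intro i hi
      rw [Finset.sum_apply]
      refine Finset.sum_eq_zero fun k _ => ?_
      rw [Pi.single_eq_of_ne]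
      rintro rfl
      exact hi ((A i).get_mem k)
    by_cases hj : ∃ i, j ∈ A i
    · obtain ⟨i, hi⟩ := hj
      rw [Finset.sum_eq_single i]
      · obtain ⟨k, rfl⟩ := List.get_of_mem hi
        exact (sum_single_get_apply (hA i) (fun k => β ((A i).get k)) k).symm
      · intro i' _ hi'
        exact hz i' fun h => hdisj i' i hi' h hi
      · simp
    · push Not at hj
      rw [hβ j hj, Finset.sum_eq_zero fun i _ => hz i (hj i)]
  conv_lhs => rw [h]
  rw [map_sum, ends]
  refine Finset.sum_congr rfl fun i _ => ?_
  rw [map_sum, ← Fin.sum_univ_fun_getElem]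
  simp only [collect_single, blockEnd_of_mem hdisj (List.get_mem _ _)]
  exact (map_sum (AddMonoidHom.single (fun _ : Fin d => ZMod 2) ((A i).getLast (hne i)))
    (fun k => β ((A i).get k)) Finset.univ).symm

lemma collect_ends {A : Fin m → List (Fin d)} (hne : ∀ i, A i ≠ []) (hA : ∀ i, (A i).Nodup)
    (hdisj : ∀ i j, i ≠ j → (A i).Disjoint (A j)) (p : Fin m → ZMod 2) :
    collect A (ends A hne p) = ends A hne p :=
  -- The claim involves no algebra, so any choice of ring, level and degrees may be used.
  (leads_blockProd (R := ℤ) (l := 0) hne hA hdisj 0 p).map_eq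

lemma c_mul_smul_xMon_mul {z : Gr R l d} {j : Fin d} {q : ZMod 2}
    (hz : c R l j * z = sg R q • (z * c R l j)) (a : R) (μ : Fin d → ℕ) :
    c R l j * (a • (xMon R l μ * z)) =
      sg R ((μ j : ZMod 2) + q) • (a • (xMon R l μ * z) * c R l j) := by
  rw [mul_smul_comm, ← mul_assoc, c_mul_xMon, smul_mul_assoc, mul_assoc, hz, mul_smul_comm,
    sg_add, smul_mul_assoc, mul_assoc]
  simp only [smul_smul]
  congr 1
  ring

lemma notHead_of_forall_notMem {A : Fin m → List (Fin d)} {j : Fin d} (hj : ∀ i, j ∉ A i) :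
    NotHead A j := fun i h => hj i (List.mem_of_mem_head? h)

lemma notHead_or {A : Fin m → List (Fin d)} (hne : ∀ i, A i ≠ []) (j : Fin d) :
    NotHead A j ∨ ∃ i, j = (A i).head (hne i) := by
  by_cases h : NotHead A j
  · exact .inl h
  · right
    rw [NotHead] at h
    push Not at h
    obtain ⟨i, hi⟩ := h
    rw [List.head?_eq_some_head (hne i), Option.some_inj] at hi
    exact ⟨i, hi.symm⟩

variable [NeZero l]

/-- The comparison element is a multiple of `x^μ` times the block product, with `μ` the part of `ν`
outside the blocks and the scalar chosen to match `z` at the collected exponent. A wrong parity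
makes it anticommute with a head, and an odd exponent outside makes it anticommute with that `c_j`;
either would force the coefficient to vanish. -/
lemma parity_of_coef_ne_zero (h2 : (2 : R) ∈ nonZeroDivisors R) (hl : 1 ≤ l)
    {A : Fin m → List (Fin d)} (hne : ∀ i, A i ≠ []) (hA : ∀ i, (A i).Nodup)
    (hdisj : ∀ i j, i ≠ j → (A i).Disjoint (A j)) {z : Gr R l d}
    (hz : ∀ j, c R l j * z = z * c R l j) {p : Fin m → ZMod 2} (hp : ∑ i, p i = 0)
    {ν : Fin d → ℕ} {r : Fin m → ℕ}
    (hr : ∀ i, ∑ k, ν ((A i).get k) = ((A i).length - 1) * (l - 1) + r i)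
    (h : coef R l d z ν (blockPerm A) (ends A hne p) ≠ 0) :
    (∀ i, p i = ((((A i).length - 1) * l + r i : ℕ) : ZMod 2)) ∧
      ∀ j, (∀ i, j ∉ A i) → Even (ν j) := by
  classical
  obtain ⟨t, ht⟩ := exists_coef_blockProd (R := R) (l := l) hne hA hdisj p
  set μ : Fin d → ℕ := fun j => if ∃ i, j ∈ A i then 0 else ν j with hμ
  have hμ0 : ∀ i, ∀ j ∈ A i, μ j = 0 := fun i j hj => if_pos ⟨i, hj⟩
  have hμ1 : ∀ j, (∀ i, j ∉ A i) → μ j = ν j := fun j hj => if_neg fun ⟨i, hi⟩ => hj i hi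
  set a := coef R l d z ν (blockPerm A) (ends A hne p) * sg R t with ha
  set z' := a • (xMon R l μ * blockProd R l A r p) with hz'
  have hco : coef R l d z ν (blockPerm A) (ends A hne p) =
      coef R l d z' ν (blockPerm A) (ends A hne p) := by
    rw [hz', map_smul]
    simp only [Pi.smul_apply]
    rw [ht μ r hμ0, if_pos ⟨lt_of_coef_ne_zero h, fun j hj => (hμ1 j hj).symm, hr⟩, ha,
      smul_eq_mul, mul_assoc, sg_mul_self, mul_one]
  have hcomm : ∀ j, NotHead A j → c R l j * z' = sg R (μ j : ZMod 2) • (z' * c R l j) := by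
    intro j hj
    have := c_mul_smul_xMon_mul (c_mul_blockProd_of_notHead (R := R) (l := l) hne hA r p hj) a μ
    rwa [hp, add_zero] at this
  have hin : ∀ j, (∃ i, j ∈ A i) → NotHead A j → c R l j * z' = z' * c R l j := by
    rintro j ⟨i, hi⟩ hj
    rw [hcomm j hj, hμ0 i j hi, Nat.cast_zero, sg_zero, one_smul]
  have hno : ∀ j, c R l j * z' ≠ sg R 1 • (z' * c R l j) := fun j hj =>
    h (coef_eq_zero_of_anticomm h2 hA hdisj hz hin hj (collect_ends hne hA hdisj p) hco)
  constructor
  · intro i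
    by_contra hpi
    apply hno ((A i).head (hne i))
    have := c_mul_smul_xMon_mul (c_mul_blockProd_head (R := R) hl hne hA hdisj r p i) a μ
    rw [hp, hμ0 i _ (List.head_mem (hne i)), Nat.cast_zero, zero_add, zero_add] at this
    have h1 : p i + ((((A i).length - 1) * l + r i : ℕ) : ZMod 2) = 1 := by
      rcases zmod_two_cases (p i + ((((A i).length - 1) * l + r i : ℕ) : ZMod 2)) with h0 | h0
      · exact absurd (CharTwo.add_eq_zero.1 h0) hpi
      · exact h0
    rwa [h1] at this
  · intro j hj
    by_contra hodd
    apply hno j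
    rw [hcomm j (notHead_of_forall_notMem hj), hμ1 j hj]
    rw [← ZMod.natCast_eq_zero_iff_even] at hodd
    rw [(zmod_two_cases _).resolve_left hodd]

lemma coef_eq_zero_iff_collect {A : Fin m → List (Fin d)} (hA : ∀ i, (A i).Nodup)
    (hdisj : ∀ i j, i ≠ j → (A i).Disjoint (A j)) {z : Gr R l d}
    (hz : ∀ j, c R l j * z = z * c R l j) (ν α) :
    coef R l d z ν (blockPerm A) α = 0 ↔ coef R l d z ν (blockPerm A) (collect A α) = 0 := by
  have := coef_eq_iff_collect (z' := 0) hA hdisj (fun j _ _ => hz j) (by simp) ν α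
  simpa using this

/-- The coefficients of `F w e` factor into one part depending on `ν` and one depending on `β`, so
the support conditions on `F` and on `e` can be treated separately. -/
lemma exists_cliffOn_coef {S : Set (Fin d)} {e : Gr R l d} (he : e ∈ cliffOn R l S) :
    ∃ κ : (Fin d → ZMod 2) → R, (∀ β, κ β ≠ 0 → ∀ j ∉ S, β j = 0) ∧
      ∀ F ∈ polyOn R l (Set.univ : Set (Fin d)), ∀ (w : Equiv.Perm (Fin d)) (ν w' β),
        coef R l d (F * s R l w * e) ν w' β = if w' = w then coef R l d F ν 1 0 * κ β else 0 := by
  have hspan : e ∈ Submodule.span R {y | ∃ γ, CliffWord S γ y} := by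
    have key : Submonoid.closure (c R l '' S) ≤
        ({ carrier := {y | ∃ γ, CliffWord S γ y}
           one_mem' := ⟨0, .one⟩
           mul_mem' := fun ⟨γ, h⟩ ⟨γ', h'⟩ => ⟨_, h.mul h'⟩ } : Submonoid (Gr R l d)) := by
      rw [Submonoid.closure_le]
      rintro _ ⟨i, hi, rfl⟩
      exact ⟨_, by simpa using CliffWord.cons i _ _ hi (CliffWord.one (R := R) (l := l))⟩
    have h : e ∈ Submodule.span R (Submonoid.closure (c R l '' S) : Set (Gr R l d)) := by
      rw [← Algebra.adjoin_eq_span]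
      exact he
    exact Submodule.span_mono (fun y hy => key hy) h
  clear he
  classical
  induction hspan using Submodule.span_induction with
  | mem y hy =>
    obtain ⟨γ, hy⟩ := hy
    choose r hr using hy.exists_coef
    refine ⟨fun β => if β = γ then sg R (r β) else 0, fun β hβ j hj => ?_,
      fun F hF w ν w' β => ?_⟩
    · have : β = γ := by by_contra h; exact hβ (if_neg h)
      rw [this]
      exact hy.eq_zero hj
    · rw [hr, coef_poly_mul_s hF]
      have : β + γ = 0 ↔ β = γ := by
        simp only [funext_iff, Pi.add_apply, Pi.zero_apply, CharTwo.add_eq_zero]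
      simp only [this]
      by_cases h1 : w' = w <;> by_cases h2 : β = γ <;> simp [h1, h2, mul_comm]
  | zero => exact ⟨0, fun β h => absurd rfl h, by simp⟩
  | add y y' _ _ hy hy' =>
    obtain ⟨κ, h1, h3⟩ := hy
    obtain ⟨κ', h1', h3'⟩ := hy'
    refine ⟨κ + κ', fun β hβ j hj => ?_, fun F hF w ν w' β => ?_⟩
    · by_cases h : κ β = 0
      · by_cases h' : κ' β = 0
        · exact absurd (by simp [h, h']) hβ
        · exact h1' β h' j hj
      · exact h1 β h j hj
    · rw [mul_add, map_add]
      simp only [Pi.add_apply]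
      rw [h3 F hF, h3' F hF]
      split_ifs
      · ring
      · simp
  | smul a y _ hy =>
    obtain ⟨κ, h1, h3⟩ := hy
    refine ⟨a • κ, fun β hβ j hj => ?_, fun F hF w ν w' β => ?_⟩
    · refine h1 β (fun h => hβ ?_) j hj
      simp [h]
    · rw [mul_smul_comm, map_smul]
      simp only [Pi.smul_apply]
      rw [h3 F hF]
      split_ifs
      · simp only [smul_eq_mul]; ring
      · simp

end Parity

/-! ### Elements of maximal degree -/

section MaxDegree

variable {R : Type*} [CommRing R] {l : ℕ} {d m : ℕ}

/-- The parity for which there is a signed cycle of maximal degree on a block. -/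
def topParity (l : ℕ) (A : Fin m → List (Fin d)) (i : Fin m) : ZMod 2 :=
  (((A i).length - 1) * l + (l - 1) : ℕ)

open Classical in
/-- The exponent `l - 1` on the blocks and `μ` elsewhere. -/
noncomputable def topOn (l : ℕ) (A : Fin m → List (Fin d)) (μ : Fin d → ℕ) : Fin d → ℕ :=
  fun j => if ∃ i, j ∈ A i then l - 1 else μ j

lemma xMon_mem_adjoin_sq {A : Fin m → List (Fin d)} {μ : Fin d → ℕ}
    (hμ : ∀ i, ∀ j ∈ A i, μ j = 0) (heven : ∀ j, (∀ i, j ∉ A i) → Even (μ j)) :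
    xMon R l μ ∈ Algebra.adjoin R {y | ∃ j : Fin d, (∀ i, j ∉ A i) ∧ y = x R l j ^ 2} := by
  refine Subalgebra.list_prod_mem _ fun y hy => ?_
  obtain ⟨j, rfl⟩ := (List.mem_ofFn' _ _).1 hy
  by_cases hj : ∃ i, j ∈ A i
  · obtain ⟨i, hi⟩ := hj
    beta_reduce
    rw [hμ i j hi, pow_zero]
    exact one_mem _
  · push Not at hj
    obtain ⟨k, hk⟩ := (heven j hj).two_dvd
    beta_reduce
    rw [hk, pow_mul]
    have h : x R l j ^ 2 ∈
        Algebra.adjoin R {y | ∃ j : Fin d, (∀ i, j ∉ A i) ∧ y = x R l j ^ 2} :=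
      Algebra.subset_adjoin ⟨j, hj, rfl⟩
    exact pow_mem h _

variable [NeZero l]

/-- A nonzero element of maximal degree on the blocks is a polynomial in squares outside the blocks
times a product of signed cycles of maximal degree. -/
theorem eq_mul_prod_of_isMaxDegree (h2 : (2 : R) ∈ nonZeroDivisors R) (hl : 1 ≤ l)
    {A : Fin m → List (Fin d)} (hne : ∀ i, A i ≠ []) (hA : ∀ i, (A i).Nodup)
    (hdisj : ∀ i j, i ≠ j → (A i).Disjoint (A j)) {F e z : Gr R l d}
    (hF : F ∈ polyOn R l (Set.univ : Set (Fin d))) (he : e ∈ cliffOn R l {j | ∃ i, j ∈ A i})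
    (hz : z = F * s R l (blockPerm A) * e) (heven : z ∈ evenPart R l d)
    (hc : ∀ j, c R l j * z = z * c R l j) (hmax : IsMaxDegree F {j | ∃ i, j ∈ A i}) :
    z = 0 ∨ ∑ i, topParity l A i = 0 ∧ ∃ P : Gr R l d,
      P ∈ Algebra.adjoin R {y | ∃ j : Fin d, (∀ i, j ∉ A i) ∧ y = x R l j ^ 2} ∧
      z = P * blockProd R l A (fun _ => l - 1) (topParity l A) ∧
      ∀ ν : Fin d → ℕ, (∀ i, ∀ j ∈ A i, ν j = 0) →
        (∃ g ∈ polyOn R l {j | ∃ i, j ∈ A i}, F = xMon R l ν * g) →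
        ∃ θ : R, P = θ • xMon R l ν := by
  classical
  obtain ⟨κ, hκ, hcoef⟩ := exists_cliffOn_coef he
  have hzc : ∀ ν w' β, coef R l d z ν w' β =
      if w' = blockPerm A then coef R l d F ν 1 0 * κ β else 0 := fun ν w' β => by
    rw [hz]; exact hcoef F hF _ ν w' β
  set p := topParity l A with hpdef
  set γ := ends A hne p with hγ
  have hlen : ∀ i, 0 < (A i).length := fun i => List.length_pos_iff.2 (hne i)
  have hdeg : ∀ i, ((A i).length - 1) * (l - 1) + (l - 1) = (A i).length * (l - 1) := by
    intro i
    obtain ⟨n, hn⟩ := Nat.exists_eq_add_of_lt (hlen i)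
    rw [hn]
    simp [add_mul]
  have htop : ∀ {ν w' β}, coef R l d z ν w' β ≠ 0 → ∀ i, ∀ j ∈ A i, ν j = l - 1 := by
    intro ν w' β h i j hj
    rw [hzc] at h
    split_ifs at h
    · exact eq_of_coef_x_pow_mul (hmax j ⟨i, hj⟩) (left_ne_zero_of_mul h)
    · exact absurd rfl h
  -- the support of the coefficients
  have hsupp : ∀ {ν w' β}, coef R l d z ν w' β ≠ 0 → w' = blockPerm A ∧ collect A β = γ ∧
      ∑ i, p i = 0 ∧ ∀ j, (∀ i, j ∉ A i) → Even (ν j) := by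
    intro ν w' β h
    have hw : w' = blockPerm A := by
      rw [hzc] at h
      by_contra hw
      exact h (if_neg hw)
    subst hw
    have hβ : ∀ j, (∀ i, j ∉ A i) → β j = 0 := by
      intro j hj
      rw [hzc, if_pos rfl] at h
      exact hκ β (right_ne_zero_of_mul h) j fun ⟨i, hi⟩ => hj i hi
    have hcol := collect_eq_ends hne hA hdisj hβ
    set p' : Fin m → ZMod 2 := fun i => ((A i).map β).sum
    have h1 : coef R l d z ν (blockPerm A) (ends A hne p') ≠ 0 := by
      rw [← hcol, ne_eq, ← coef_eq_zero_iff_collect hA hdisj hc]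
      exact h
    have hp' : ∑ i, p' i = 0 := by
      rcases zmod_two_cases (∑ i, p' i) with h0 | h0
      · exact h0
      · rw [← sum_ends A hne] at h0
        exact absurd (coef_eq_zero_of_even h2 heven _ _ h0) h1
    -- All exponents on the blocks are `l - 1`, so block `i` has degree `a_i(l-1)` and `r_i = l -
    -- 1`; the block parities of `β` are thereby forced.
    have hpar := parity_of_coef_ne_zero (r := fun _ => l - 1) h2 hl hne hA hdisj hc hp'
      (fun i => by
        rw [hdeg, Finset.sum_congr rfl fun k _ => htop h i _ ((A i).get_mem k)]
        simp) h1
    have hpp : p' = p := funext fun i => hpar.1 i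
    refine ⟨rfl, by rw [hcol, hpp], by rw [← hpp, hp'], hpar.2⟩
  by_cases hz0 : z = 0
  · exact .inl hz0
  right
  have hpsum : ∑ i, p i = 0 := by
    by_contra hne0
    exact hz0 (eq_zero_of_coef fun ν w' β => by
      by_contra h
      exact hne0 (hsupp h).2.2.1)
  obtain ⟨t, ht⟩ := exists_coef_blockProd (R := R) (l := l) hne hA hdisj p
  -- The coefficients of `P`, read off from `z` at the exponents completed by `l - 1` on the blocks;
  -- `sg R t` cancels the sign of the block product. Requiring `μ = 0` on the blocks counts each
  -- outside exponent once.
  set a : (Fin d → Fin l) → R := fun μ => if ∀ i, ∀ j ∈ A i, (μ j : ℕ) = 0 then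
    sg R t * coef R l d z (topOn l A fun j => μ j) (blockPerm A) γ else 0 with ha
  have htopA : ∀ (μ : Fin d → ℕ) i, ∀ j ∈ A i, topOn l A μ j = l - 1 := fun μ i j hj =>
    if_pos ⟨i, hj⟩
  have htopN : ∀ (μ : Fin d → ℕ) j, (∀ i, j ∉ A i) → topOn l A μ j = μ j := fun μ j hj =>
    if_neg fun ⟨i, hi⟩ => hj i hi
  have ha0 : ∀ μ, a μ ≠ 0 → (∀ i, ∀ j ∈ A i, (μ j : ℕ) = 0) ∧
      coef R l d z (topOn l A fun j => μ j) (blockPerm A) γ ≠ 0 ∧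
      ∀ j, (∀ i, j ∉ A i) → Even (μ j : ℕ) := by
    intro μ hμ
    have h1 : ∀ i, ∀ j ∈ A i, (μ j : ℕ) = 0 := by
      by_contra h
      exact hμ (if_neg h)
    have h3 : coef R l d z (topOn l A fun j => μ j) (blockPerm A) γ ≠ 0 := by
      intro h
      apply hμ
      simp only [ha, h, mul_zero, ite_self]
    refine ⟨h1, h3, fun j hj => ?_⟩
    have := (hsupp h3).2.2.2 j hj
    rwa [htopN _ j hj] at this
  refine ⟨hpsum, ∑ μ, a μ • xMon R l (fun j => (μ j : ℕ)), ?_, ?_, ?_⟩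
  · refine sum_mem fun μ _ => ?_
    by_cases hμ : a μ = 0
    · rw [hμ, zero_smul]; exact zero_mem _
    · exact Subalgebra.smul_mem _ (xMon_mem_adjoin_sq (ha0 μ hμ).1 (ha0 μ hμ).2.2) _
  · set B := blockProd R l A (fun _ => l - 1) p with hB
    rw [Finset.sum_mul]
    simp only [smul_mul_assoc]
    have hcB : ∀ j, c R l j * (∑ μ, a μ • (xMon R l (fun j => (μ j : ℕ)) * B)) =
        (∑ μ, a μ • (xMon R l (fun j => (μ j : ℕ)) * B)) * c R l j := by
      intro j
      rw [Finset.mul_sum, Finset.sum_mul]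
      refine Finset.sum_congr rfl fun μ _ => ?_
      by_cases hμ : a μ = 0
      · simp [hμ]
      obtain ⟨h1, -, h3⟩ := ha0 μ hμ
      have hμj : ((μ j : ℕ) : ZMod 2) = 0 := by
        rw [ZMod.natCast_eq_zero_iff_even]
        by_cases hj : ∃ i, j ∈ A i
        · obtain ⟨i, hi⟩ := hj
          rw [h1 i j hi]
          exact Even.zero
        · push Not at hj
          exact h3 j hj
      have hBj : c R l j * B = sg R 0 • (B * c R l j) := by
        rcases notHead_or hne j with hj | ⟨i, rfl⟩
        · rw [hB, c_mul_blockProd_of_notHead hne hA _ p hj, hpsum]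
        · rw [hB, c_mul_blockProd_head hl hne hA hdisj _ p i, hpsum, zero_add]
          have : p i + ((((A i).length - 1) * l + (l - 1) : ℕ) : ZMod 2) = 0 :=
            zmod_two_add_self (p i)
          rw [this]
      have := c_mul_smul_xMon_mul hBj (a μ) fun j => (μ j : ℕ)
      rwa [hμj, add_zero, sg_zero, one_smul] at this
    have hγeq : ∀ ν, coef R l d z ν (blockPerm A) γ =
        coef R l d (∑ μ, a μ • (xMon R l (fun j => (μ j : ℕ)) * B)) ν (blockPerm A) γ := by
      intro ν
      rw [map_sum]
      simp only [Finset.sum_apply, map_smul, Pi.smul_apply, smul_eq_mul]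
      -- Only one `μ` can contribute at a given `ν`, namely its part outside the blocks, and its
      -- contribution is the coefficient of `z`.
      have hterm : ∀ μ : Fin d → Fin l, a μ * coef R l d (xMon R l (fun j => (μ j : ℕ)) * B) ν
          (blockPerm A) γ ≠ 0 → ν = topOn l A (fun j => μ j) ∧
            a μ * coef R l d (xMon R l (fun j => (μ j : ℕ)) * B) ν (blockPerm A) γ =
              coef R l d z ν (blockPerm A) γ := by
        intro μ hμ
        have haμ := left_ne_zero_of_mul hμ
        obtain ⟨h1, -, -⟩ := ha0 μ haμ
        have hcμ := right_ne_zero_of_mul hμ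
        rw [hB, ht _ _ h1] at hcμ ⊢
        split_ifs at hcμ ⊢ with hcond
        · obtain ⟨hlt, hout, hsum⟩ := hcond
          have hν : ν = topOn l A (fun j => μ j) := by
            funext j
            by_cases hj : ∃ i, j ∈ A i
            · obtain ⟨i, hi⟩ := hj
              rw [htopA _ i j hi]
              obtain ⟨k, rfl⟩ := List.get_of_mem hi
              have h5 : ∑ k, ν ((A i).get k) = ∑ _k : Fin (A i).length, (l - 1) := by
                rw [hsum, hdeg]; simp
              exact (Finset.sum_eq_sum_iff_of_le
                fun k _ => Nat.le_sub_one_of_lt (hlt ((A i).get k))).1 h5 k (Finset.mem_univ k)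
            · push Not at hj
              rw [htopN _ j hj, hout j hj]
          refine ⟨hν, ?_⟩
          simp only [ha]
          rw [if_pos h1, ← hν, mul_right_comm, sg_mul_self, one_mul]
        · exact absurd rfl hcμ
      by_cases hν0 : coef R l d z ν (blockPerm A) γ = 0
      · rw [hν0]
        symm
        refine Finset.sum_eq_zero fun μ _ => ?_
        by_contra h
        exact h ((hterm μ h).2.trans hν0)
      · have hlt := lt_of_coef_ne_zero hν0
        set μ₀ : Fin d → Fin l := fun j =>
          if ∃ i, j ∈ A i then ⟨0, hl⟩ else ⟨ν j, hlt j⟩ with hμ₀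
        have hμA : ∀ i, ∀ j ∈ A i, (μ₀ j : ℕ) = 0 := by
          intro i j hj
          simp only [hμ₀]
          rw [if_pos ⟨i, hj⟩]
        have hμN : ∀ j, (∀ i, j ∉ A i) → (μ₀ j : ℕ) = ν j := by
          intro j hj
          simp only [hμ₀]
          rw [if_neg fun ⟨i, hi⟩ => hj i hi]
        have hν : topOn l A (fun j => μ₀ j) = ν := by
          funext j
          by_cases hj : ∃ i, j ∈ A i
          · obtain ⟨i, hi⟩ := hj
            rw [htopA _ i j hi, htop hν0 i j hi]
          · push Not at hj
            rw [htopN _ j hj, hμN j hj]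
        rw [Finset.sum_eq_single μ₀]
        · rw [hB, ht _ _ hμA, if_pos]
          · simp only [ha]
            rw [if_pos hμA, hν, mul_right_comm, sg_mul_self, one_mul]
          · refine ⟨hlt, fun j hj => (hμN j hj).symm, fun i => ?_⟩
            rw [hdeg, Finset.sum_congr rfl fun k _ => htop hν0 i _ ((A i).get_mem k)]
            simp
        · intro μ _ hne'
          by_contra h
          obtain ⟨hν', -⟩ := hterm μ h
          obtain ⟨h1, -, -⟩ := ha0 μ (left_ne_zero_of_mul h)
          apply hne'
          funext j
          apply Fin.ext
          by_cases hj : ∃ i, j ∈ A i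
          · obtain ⟨i, hi⟩ := hj
            rw [h1 i j hi, hμA i j hi]
          · push Not at hj
            rw [hμN j hj, hν', htopN _ j hj]
        · simp
    -- Both sides commute with the `c_j` and are supported on exponents collecting to `γ`, so
    -- agreement at `γ` suffices.
    apply coef_injective
    funext ν w' β
    have hother : (w' ≠ blockPerm A ∨ collect A β ≠ γ) → coef R l d z ν w' β =
        coef R l d (∑ μ, a μ • (xMon R l (fun j => (μ j : ℕ)) * B)) ν w' β := by
      intro hor
      have e1 : coef R l d z ν w' β = 0 := by
        by_contra h
        have := hsupp h
        tauto
      rw [e1, map_sum]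
      simp only [Finset.sum_apply, map_smul, Pi.smul_apply, smul_eq_mul]
      symm
      refine Finset.sum_eq_zero fun μ _ => ?_
      by_contra h
      have := eq_of_coef_blockProd_ne_zero hne hA hdisj p (right_ne_zero_of_mul h)
      tauto
    by_cases hw : w' = blockPerm A
    · by_cases hβ : collect A β = γ
      · rw [hw, coef_eq_iff_collect hA hdisj (fun j _ _ => hc j) (fun j _ _ => hcB j), hβ]
        exact hγeq ν
      · exact hother (.inr hβ)
    · exact hother (.inl hw)
  -- Any `μ` with `a μ ≠ 0` comes from an exponent of `F`, whose part outside the blocks is `ν`;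
  -- hence all surviving monomials of `P` coincide.
  · rintro ν hν ⟨g, hg, rfl⟩
    refine ⟨∑ μ, a μ, ?_⟩
    rw [Finset.sum_smul]
    refine Finset.sum_congr rfl fun μ _ => ?_
    by_cases hμ : a μ = 0
    · rw [hμ, zero_smul, zero_smul]
    obtain ⟨h1, h3, -⟩ := ha0 μ hμ
    congr 2
    funext j
    by_cases hj : ∃ i, j ∈ A i
    · obtain ⟨i, hi⟩ := hj
      rw [h1 i j hi, hν i j hi]
    · rw [hzc, if_pos rfl] at h3
      have h4 := left_ne_zero_of_mul h3
      rw [coef_xMon_mul] at h4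
      split_ifs at h4 with hcond
      · have h5 : (topOn l A (fun j => (μ j : ℕ)) - ν) j = 0 := by
          by_contra h
          exact h4 (coef_poly_eq_zero hg hj h _ _)
        push Not at hj
        rw [Pi.sub_apply, htopN _ j hj] at h5
        have := (hcond j).1
        rw [htopN _ j hj] at this
        omega
      · exact absurd rfl h4

end MaxDegree

/-! ### Products of disjoint cycles -/

section Products

variable {R : Type*} [CommRing R] {l : ℕ} {d m : ℕ}

lemma isCXCycle_singleton (j : Fin d) {k : ℕ} (hk : Even k) :
    IsCXCycle (R := R) (l := l) [j] (x R l j ^ k) := by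
  refine ⟨k, by simpa using hk, ?_⟩
  have h1 : evenVec [j].length = {0} := by
    change evenVec 1 = {0}
    decide
  rw [cxElem, h1, Finset.sum_singleton, xCycle, h]
  change x R l j ^ k = (-1) ^ tauExp (0 : Fin 1 → ZMod 2) *
    ((∑ ρ ∈ Finset.Nat.antidiagonalTuple 1 ((1 - 1) * (l - 1) + k), (List.ofFn fun i : Fin 1 =>
      ((-1) ^ epsExp (0 : Fin 1 → ZMod 2) i * x R l ([j].get i)) ^ ρ i).prod) *
        sigma R l [j] * cMon R l [j] 0)
  simp [Finset.Nat.antidiagonalTuple_one, tauExp, weight, epsExp, sigma, s_one, cMon]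

/-- Even powers of outside variables are one-letter CX-cycles, adjoined one letter at a time. The
induction records that all cycles so far lie in `J` or in the blocks, which keeps the new letter
disjoint from them. -/
lemma xMon_mul_blockProd_mem_cxProducts {A : Fin m → List (Fin d)} (hne : ∀ i, A i ≠ [])
    (hA : ∀ i, (A i).Nodup) (hdisj : ∀ i j, i ≠ j → (A i).Disjoint (A j)) {μ : Fin d → ℕ}
    (hμ : ∀ i, ∀ j ∈ A i, μ j = 0) (heven : ∀ j, (∀ i, j ∉ A i) → Even (μ j)) {r : Fin m → ℕ}
    (hr : ∀ i, Even (((A i).length - 1) * l + r i)) :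
    xMon R l μ * blockProd R l A r 0 ∈ cxProducts R l d := by
  classical
  have key : ∀ J : Finset (Fin d), (∀ j ∈ J, ∀ i, j ∉ A i) →
      ∃ (n : ℕ) (B : Fin n → List (Fin d)) (w : Fin n → Gr R l d),
        (∀ i, B i ≠ [] ∧ (B i).Nodup) ∧ (∀ i j, i ≠ j → (B i).Disjoint (B j)) ∧
        (∀ i, IsCXCycle (B i) (w i)) ∧ (∀ i, ∀ j ∈ B i, j ∈ J ∨ ∃ i, j ∈ A i) ∧
        xMon R l (fun j => if j ∈ J then μ j else 0) * blockProd R l A r 0 =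
          (List.ofFn w).prod := by
    intro J
    induction J using Finset.induction_on with
    | empty =>
      intro _
      refine ⟨m, A, fun i => signedCycle R l (A i) (r i) 0, fun i => ⟨hne i, hA i⟩, hdisj,
        fun i => ⟨r i, hr i, (cxElem_eq_signedCycle _ _ _ _).symm⟩, fun i j hj => .inr ⟨i, hj⟩, ?_⟩
      have : (fun j : Fin d => if j ∈ (∅ : Finset (Fin d)) then μ j else 0) = 0 := by
        funext j; simp
      rw [this, xMon_zero, one_mul]
      rfl
    | insert j J hjJ ih =>
      intro hJ
      obtain ⟨n, B, w, h1, h2, h3, h4, h5⟩ := ih fun k hk => hJ k (Finset.mem_insert_of_mem hk)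
      have hj := hJ j (Finset.mem_insert_self j J)
      have hjB : ∀ i, j ∉ B i := fun i hi => (h4 i j hi).elim hjJ fun ⟨i', hi'⟩ => hj i' hi'
      refine ⟨n + 1, Fin.cons [j] B, Fin.cons (x R l j ^ μ j) w, ?_, ?_, ?_, ?_, ?_⟩
      · intro i
        cases i using Fin.cases with
        | zero => simp
        | succ i => simpa using h1 i
      · intro i i' hii
        cases i using Fin.cases with
        | zero =>
          cases i' using Fin.cases with
          | zero => exact absurd rfl hii
          | succ i' => simpa using hjB i'
        | succ i =>
          cases i' using Fin.cases with
          | zero => simpa using hjB i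
          | succ i' => simpa using h2 i i' (by simpa using hii)
      · intro i
        cases i using Fin.cases with
        | zero => simpa using isCXCycle_singleton j (heven j hj)
        | succ i => simpa using h3 i
      · intro i k hk
        cases i using Fin.cases with
        | zero =>
          have : k = j := by simpa using hk
          exact .inl (this ▸ Finset.mem_insert_self j J)
        | succ i => exact (h4 i k (by simpa using hk)).imp (Finset.mem_insert_of_mem) id
      · rw [List.ofFn_cons, List.prod_cons, ← h5, ← mul_assoc, x_pow_mul_xMon]
        congr 2
        funext k
        by_cases hk : k = j
        · subst hk
          simp [hjJ]
        · simp [hk]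
  obtain ⟨n, B, w, h1, h2, h3, -, h5⟩ :=
    key (Finset.univ.filter fun j => ∀ i, j ∉ A i) (by simp)
  refine ⟨n, B, w, h1, h2, h3, ?_⟩
  rw [← h5]
  congr 2
  funext j
  by_cases hj : ∀ i, j ∉ A i
  · simp [hj]
  · rw [if_neg (by simpa using hj)]
    push Not at hj
    obtain ⟨i, hi⟩ := hj
    exact hμ i j hi

lemma c_mul_xMon_mul_blockProd_comm (hl : 1 ≤ l) {A : Fin m → List (Fin d)}
    (hne : ∀ i, A i ≠ []) (hA : ∀ i, (A i).Nodup)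
    (hdisj : ∀ i j, i ≠ j → (A i).Disjoint (A j)) {μ : Fin d → ℕ}
    (hμ : ∀ j, Even (μ j)) {r : Fin m → ℕ} {p : Fin m → ZMod 2} (hp : ∑ i, p i = 0)
    (hr : ∀ i, p i = ((((A i).length - 1) * l + r i : ℕ) : ZMod 2)) (a : R) (j : Fin d) :
    c R l j * (a • (xMon R l μ * blockProd R l A r p)) =
      a • (xMon R l μ * blockProd R l A r p) * c R l j := by
  have hB : c R l j * blockProd R l A r p = sg R 0 • (blockProd R l A r p * c R l j) := by
    rcases notHead_or hne j with hj | ⟨i, rfl⟩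
    · rw [c_mul_blockProd_of_notHead hne hA _ p hj, hp]
    · rw [c_mul_blockProd_head hl hne hA hdisj _ p i, hp, zero_add, ← hr, zmod_two_add_self]
  have := c_mul_smul_xMon_mul hB a μ
  rwa [(ZMod.natCast_eq_zero_iff_even).2 (hμ j), add_zero, sg_zero, one_smul] at this

end Products

/-! ### Elements without terms of maximal degree -/

section Span

variable {R : Type*} [CommRing R] {l : ℕ} {d m : ℕ}

lemma ends_zero (A : Fin m → List (Fin d)) (hne : ∀ i, A i ≠ []) : ends A hne 0 = 0 := by
  simp [ends]

variable [NeZero l]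

/-- The element `z` commutes with the `c_j`, it is supported on the product of the blocks and on
exponents with even sum on each block, and its coefficients depend only on the degrees in the
blocks, which are large. -/
structure Balanced (A : Fin m → List (Fin d)) (z : Gr R l d) : Prop where
  comm : ∀ j, c R l j * z = z * c R l j
  support : ∀ {ν w β}, coef R l d z ν w β ≠ 0 → w = blockPerm A ∧ collect A β = 0
  const : ∀ {ν ν' : Fin d → ℕ}, (∀ j, ν j < l) → (∀ j, ν' j < l) →
    (∀ j, (∀ i, j ∉ A i) → ν j = ν' j) →
    (∀ i, ∑ k, ν ((A i).get k) = ∑ k, ν' ((A i).get k)) →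
    coef R l d z ν (blockPerm A) 0 = coef R l d z ν' (blockPerm A) 0
  le : ∀ {ν}, coef R l d z ν (blockPerm A) 0 ≠ 0 → ∀ i,
    ((A i).length - 1) * (l - 1) ≤ ∑ k, ν ((A i).get k)

lemma Balanced.add {A : Fin m → List (Fin d)} {z z' : Gr R l d} (h : Balanced A z)
    (h' : Balanced A z') : Balanced A (z + z') := by
  refine ⟨fun j => by rw [mul_add, add_mul, h.comm, h'.comm], fun {ν w β} h0 => ?_,
    fun {ν ν'} h1 h2 h3 h4 => ?_, fun {ν} h0 => ?_⟩
  · by_cases hz : coef R l d z ν w β = 0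
    · have hz' : coef R l d z' ν w β ≠ 0 := fun hz' => h0 (by simp [hz, hz'])
      exact h'.support hz'
    · exact h.support hz
  · simp only [map_add, Pi.add_apply]
    rw [h.const h1 h2 h3 h4, h'.const h1 h2 h3 h4]
  · by_cases hz : coef R l d z ν (blockPerm A) 0 = 0
    · exact h'.le fun hz' => h0 (by simp [hz, hz'])
    · exact h.le hz

lemma balanced_smul_xMon_mul_blockProd (hl : 1 ≤ l) {A : Fin m → List (Fin d)}
    (hne : ∀ i, A i ≠ []) (hA : ∀ i, (A i).Nodup)
    (hdisj : ∀ i j, i ≠ j → (A i).Disjoint (A j)) {μ : Fin d → ℕ}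
    (hμ : ∀ i, ∀ j ∈ A i, μ j = 0) (heven : ∀ j, Even (μ j)) {r : Fin m → ℕ}
    (hr : ∀ i, Even (((A i).length - 1) * l + r i)) (a : R) :
    Balanced A (a • (xMon R l μ * blockProd R l A r 0)) := by
  obtain ⟨t, ht⟩ := exists_coef_blockProd (R := R) (l := l) hne hA hdisj 0
  simp only [ends_zero] at ht
  refine ⟨c_mul_xMon_mul_blockProd_comm hl hne hA hdisj heven (by simp)
    (fun i => ((ZMod.natCast_eq_zero_iff_even).2 (hr i)).symm) a, fun {ν w β} h0 => ?_,
    fun {ν ν'} h1 h2 h3 h4 => ?_, fun {ν} h0 i => ?_⟩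
  · rw [map_smul] at h0
    have := eq_of_coef_blockProd_ne_zero hne hA hdisj 0 (right_ne_zero_of_mul h0)
    rwa [ends_zero] at this
  · simp only [map_smul, Pi.smul_apply]
    rw [ht μ r hμ, ht μ r hμ]
    congr 1
    refine if_congr ?_ rfl rfl
    refine and_congr (iff_of_true h1 h2) (and_congr ?_ ?_)
    · exact forall₂_congr fun j hj => by rw [h3 j hj]
    · exact forall_congr' fun i => by rw [h4 i]
  · simp only [map_smul, Pi.smul_apply] at h0
    rw [ht μ r hμ] at h0
    split_ifs at h0 with hc
    · rw [hc.2.2 i]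
      exact Nat.le_add_right _ _
    · simp at h0

/-- Balanced elements are linear combinations of products of disjoint CX-cycles. -/
theorem Balanced.mem_span (h2 : (2 : R) ∈ nonZeroDivisors R) (hl : 1 ≤ l)
    {A : Fin m → List (Fin d)} (hne : ∀ i, A i ≠ []) (hA : ∀ i, (A i).Nodup)
    (hdisj : ∀ i j, i ≠ j → (A i).Disjoint (A j)) {z : Gr R l d} (hz : Balanced A z) :
    z ∈ Submodule.span R (cxProducts R l d) := by
  classical
  -- Induction on the size of the support at `α = 0`, which determines a balanced element.
  obtain ⟨n, hn⟩ : ∃ n, (Finset.univ.filter fun ν : Fin d → Fin l =>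
    coef R l d z (fun j => ν j) (blockPerm A) 0 ≠ 0).card = n := ⟨_, rfl⟩
  induction n using Nat.strong_induction_on generalizing z with
  | _ n ih =>
  by_cases hsupp : ∃ ν : Fin d → ℕ, coef R l d z ν (blockPerm A) 0 ≠ 0
  · obtain ⟨ν₀, hν₀⟩ := hsupp
    obtain ⟨t, ht⟩ := exists_coef_blockProd (R := R) (l := l) hne hA hdisj 0
    simp only [ends_zero] at ht
    -- The truncated subtraction is exact by `Balanced.le`.
    set r : Fin m → ℕ := fun i => ∑ k, ν₀ ((A i).get k) - ((A i).length - 1) * (l - 1) with hr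
    have hr' : ∀ i, ∑ k, ν₀ ((A i).get k) = ((A i).length - 1) * (l - 1) + r i := fun i =>
      (Nat.add_sub_of_le (hz.le hν₀ i)).symm
    set μ : Fin d → ℕ := fun j => if ∃ i, j ∈ A i then 0 else ν₀ j with hμ
    have hμ0 : ∀ i, ∀ j ∈ A i, μ j = 0 := fun i j hj => if_pos ⟨i, hj⟩
    have hμ1 : ∀ j, (∀ i, j ∉ A i) → μ j = ν₀ j := fun j hj => if_neg fun ⟨i, hi⟩ => hj i hi
    have hpar := parity_of_coef_ne_zero (p := 0) h2 hl hne hA hdisj hz.comm (by simp) hr'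
      (by rwa [ends_zero])
    have hreven : ∀ i, Even (((A i).length - 1) * l + r i) := fun i =>
      (ZMod.natCast_eq_zero_iff_even).1 (hpar.1 i).symm
    have hμeven : ∀ j, Even (μ j) := by
      intro j
      by_cases hj : ∃ i, j ∈ A i
      · obtain ⟨i, hi⟩ := hj
        rw [hμ0 i j hi]
        exact Even.zero
      · push Not at hj
        rw [hμ1 j hj]
        exact hpar.2 j hj
    set Z := xMon R l μ * blockProd R l A r 0 with hZ
    set a := coef R l d z ν₀ (blockPerm A) 0 * sg R t with ha
    have hz₁ : Balanced A (z + (-a) • Z) :=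
      hz.add (balanced_smul_xMon_mul_blockProd hl hne hA hdisj hμ0 hμeven hreven _)
    -- At `α = 0`, `Z` lives exactly on the level of `ν₀` and is constant there, as is `z`.
    -- Subtracting removes the whole level and creates nothing new.
    have hcoef : ∀ ν, coef R l d (z + (-a) • Z) ν (blockPerm A) 0 ≠ 0 →
        coef R l d z ν (blockPerm A) 0 ≠ 0 ∧ ν ≠ ν₀ := by
      intro ν hν
      have hνl := lt_of_coef_ne_zero hν
      simp only [map_add, map_smul, Pi.add_apply, Pi.smul_apply] at hν
      rw [hZ, ht μ r hμ0] at hν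
      split_ifs at hν with hc
      · exfalso
        apply hν
        rw [hz.const hc.1 (lt_of_coef_ne_zero hν₀) (fun j hj => by rw [hc.2.1 j hj, hμ1 j hj])
          (fun i => by rw [hc.2.2 i, hr' i]), smul_eq_mul, ha, neg_mul, mul_assoc, sg_mul_self,
          mul_one, add_neg_cancel]
      · rw [smul_zero, add_zero] at hν
        refine ⟨hν, ?_⟩
        rintro rfl
        exact hc ⟨hνl, fun j hj => (hμ1 j hj).symm, hr'⟩
    have hlt := lt_of_coef_ne_zero hν₀
    have hcard : (Finset.univ.filter fun ν : Fin d → Fin l =>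
        coef R l d (z + (-a) • Z) (fun j => ν j) (blockPerm A) 0 ≠ 0).card < n := by
      rw [← hn]
      refine Finset.card_lt_card ((Finset.ssubset_iff_of_subset ?_).2
        ⟨fun j => ⟨ν₀ j, hlt j⟩, ?_, ?_⟩)
      · intro ν hν
        rw [Finset.mem_filter] at hν ⊢
        exact ⟨hν.1, (hcoef _ hν.2).1⟩
      · rw [Finset.mem_filter]
        exact ⟨Finset.mem_univ _, hν₀⟩
      · rw [Finset.mem_filter]
        exact fun h => (hcoef _ h.2).2 rfl
    have hadd : z = z + (-a) • Z + a • Z := by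
      rw [add_assoc, ← add_smul, neg_add_cancel, zero_smul, add_zero]
    rw [hadd]
    exact add_mem (ih _ hcard hz₁ rfl) (Submodule.smul_mem _ _ (Submodule.subset_span
      (xMon_mul_blockProd_mem_cxProducts hne hA hdisj hμ0 (fun j _ => hμeven j) hreven)))
  · push Not at hsupp
    have : z = 0 := eq_zero_of_coef fun ν w β => by
      by_contra h
      obtain ⟨rfl, hβ⟩ := hz.support h
      apply h
      rw [coef_eq_zero_iff_collect hA hdisj hz.comm, hβ, hsupp]
    rw [this]
    exact zero_mem _

lemma nodup_flatten_ofFn {A : Fin m → List (Fin d)} (hA : ∀ i, (A i).Nodup)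
    (hdisj : ∀ i j, i ≠ j → (A i).Disjoint (A j)) : (List.ofFn A).flatten.Nodup := by
  rw [List.nodup_flatten]
  refine ⟨fun L hL => ?_, List.pairwise_ofFn.2 fun i j hij => hdisj i j hij.ne⟩
  obtain ⟨i, rfl⟩ := (List.mem_ofFn' _ _).1 hL
  exact hA i

lemma sum_toFinset {B : List (Fin d)} (hB : B.Nodup) (ν : Fin d → ℕ) :
    ∑ j ∈ B.toFinset, ν j = ∑ k, ν (B.get k) := by
  rw [List.sum_toFinset _ hB, ← Fin.sum_univ_fun_getElem]
  rfl

/-- An odd parity on some block would make the corresponding `f α` of maximal degree there, so only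
parity 0 occurs on every block. Constancy on levels and the lower degree bound then come from moving
exponents inside blocks. -/
theorem balanced_of_forall_not_isMaxDegree (h2 : (2 : R) ∈ nonZeroDivisors R)
    {A : Fin m → List (Fin d)} (hne : ∀ i, A i ≠ []) (hA : ∀ i, (A i).Nodup)
    (hdisj : ∀ i j, i ≠ j → (A i).Disjoint (A j))
    {L : List (Fin d)} (hnd : L.Nodup) (hmem : ∀ j, j ∈ L ↔ ∃ i, j ∈ A i)
    {f : (Fin L.length → ZMod 2) → Gr R l d} {z : Gr R l d}
    (hf : ∀ α, f α ∈ polyOn R l (Set.univ : Set (Fin d)))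
    (hz : z = ∑ α ∈ evenVec L.length,
      f α * s R l (blockPerm A) * cMon R l L α)
    (hX : z ∈ CX R l d) (hc : ∀ j, c R l j * z = z * c R l j)
    (hmax : ∀ α ∈ evenVec L.length, f α ≠ 0 →
      ∀ i, ¬ IsMaxDegree (f α) {j | j ∈ A i}) : Balanced A z := by
  classical
  set v : (Fin L.length → ZMod 2) → Fin d → ZMod 2 := fun α => ∑ k, Pi.single (L.get k) (α k)
    with hv
  -- Hence a given Clifford exponent arises from a single `α`, and the coefficients of `z` there
  -- are, up to one common sign, those of `f α`.
  have hvinj : Function.Injective v := by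
    intro α α' h
    funext k
    rw [← sum_single_get_apply hnd α k, ← sum_single_get_apply hnd α' k]
    exact congrFun h (L.get k)
  have hsupp : ∀ {ν w β}, coef R l d z ν w β ≠ 0 → w = blockPerm A ∧
      ∃ α ∈ evenVec L.length, β = v α ∧ ∃ r : ZMod 2, ∀ ν, coef R l d z ν w β =
        sg R r * coef R l d (f α) ν 1 0 := by
    intro ν w β h
    choose r hr using fun α : Fin L.length → ZMod 2 =>
      exists_coef_mul_prod_c (R := R) (l := l) (fun k => L.get k) α β
    have hterm : ∀ α ν, coef R l d (f α * s R l (blockPerm A) * cMon R l L α) ν w β =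
        if w = blockPerm A ∧ β = v α then sg R (r α) * coef R l d (f α) ν 1 0 else 0 := by
      intro α ν
      rw [cMon, hr, coef_poly_mul_s (hf α)]
      have : β + v α = 0 ↔ β = v α := by
        simp only [funext_iff, Pi.add_apply, Pi.zero_apply, CharTwo.add_eq_zero]
      rw [mul_ite, mul_zero]
      exact if_congr (and_congr Iff.rfl this) rfl rfl
    have hsum : ∀ ν, coef R l d z ν w β = ∑ α ∈ evenVec L.length,
        if w = blockPerm A ∧ β = v α then sg R (r α) * coef R l d (f α) ν 1 0 else 0 := by
      intro ν
      rw [hz, map_sum]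
      simp only [Finset.sum_apply, hterm]
    rw [hsum] at h
    obtain ⟨α, hα, h⟩ := Finset.exists_ne_zero_of_sum_ne_zero h
    have hcond : w = blockPerm A ∧ β = v α := by
      by_contra hne
      exact h (if_neg hne)
    refine ⟨hcond.1, α, hα, hcond.2, r α, fun ν => ?_⟩
    rw [hsum, Finset.sum_eq_single_of_mem α hα, if_pos hcond]
    intro α' _ hne'
    refine if_neg fun h' => hne' (hvinj ?_)
    rw [← h'.2, hcond.2]
  have hmove : ∀ i, ∀ j ∈ (A i).toFinset, ∀ k ∈ (A i).toFinset, j ≠ k → ∀ ν : Fin d → ℕ,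
      (∀ t, ν t < l) → ν k + 1 < l → coef R l d z ν (blockPerm A) 0 = if 1 ≤ ν j then
        coef R l d z (ν + Pi.single k 1 - Pi.single j 1) (blockPerm A) 0 else 0 :=
    fun i j hj k hk hjk ν hν hνk => coef_move hA hdisj hX i (List.mem_toFinset.1 hj)
      (List.mem_toFinset.1 hk) hjk hν hνk
  refine ⟨hc, fun {ν w β} h => ?_, fun {ν ν'} h1 h3 h4 h5 => ?_, fun {ν} h i => ?_⟩
  · obtain ⟨rfl, α, hα, hβ, r, hr⟩ := hsupp h
    refine ⟨rfl, ?_⟩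
    have hβ0 : ∀ j, (∀ i, j ∉ A i) → β j = 0 := by
      intro j hj
      simp only [hβ, hv, Finset.sum_apply]
      refine Finset.sum_eq_zero fun k _ => Pi.single_eq_of_ne ?_ _
      rintro rfl
      obtain ⟨i, hi⟩ := (hmem _).1 (L.get_mem k)
      exact hj i hi
    rw [collect_eq_ends hne hA hdisj hβ0, ← ends_zero A hne]
    congr 1
    funext i
    refine (zmod_two_cases _).resolve_right fun hi => ?_
    have hf0 : f α ≠ 0 := by
      intro h0
      apply h
      rw [hr, h0]
      simp
    -- Every non-zero coefficient of `f α`, not just the one at `ν`, is up to sign a coefficient of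
    -- `z` at `β`, so each has exponent `l - 1` at `j`.
    refine hmax α hα hf0 i fun j hj => x_pow_dvd_of_coef (hf α) j fun ν' hν' => ?_
    refine eq_of_coef_ne_zero_of_odd h2 hA hdisj hX i hi (α := β) ?_ hj
    rw [hr]
    exact fun h0 => hν' ((isUnit_sg R r).mul_right_eq_zero.1 h0)
  · refine eq_of_move (fun i => (A i).toFinset) (fun i i' hii => ?_)
      (fun ν => coef R l d z ν (blockPerm A) 0) hmove h1 h3 (fun j hj => h4 j ?_) fun i => ?_
    · rw [List.disjoint_toFinset_iff_disjoint]
      exact hdisj i i' hii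
    · simpa using hj
    · rw [sum_toFinset (hA i), sum_toFinset (hA i), h5 i]
  · by_contra hlt
    refine h (eq_zero_of_move (S := (A i).toFinset) ?_ (fun ν => coef R l d z ν (blockPerm A) 0)
      (hmove i) (lt_of_coef_ne_zero h) ?_)
    · exact (List.toFinset_nonempty_iff _).2 (hne i)
    · rw [sum_toFinset (hA i), List.toFinset_card_of_nodup (hA i)]
      exact not_le.1 hlt

end Span

end Sergeev

/-! ### Assembly of the two statements -/

theorem mainTheorem4 {R : Type*} [CommRing R] (h2 : (2 : R) ∈ nonZeroDivisors R)
    (l d : ℕ) (hl : 1 ≤ l) (m : ℕ) (A : Fin m → List (Fin d))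
    (hA : ∀ i, A i ≠ [] ∧ (A i).Nodup)
    (hdisj : ∀ i j, i ≠ j → (A i).Disjoint (A j)) :
    (∀ (F e z : Sergeev.Gr R l d),
      F ∈ Sergeev.polyOn R l (Set.univ : Set (Fin d)) →
      e ∈ Sergeev.cliffOn R l {j | ∃ i, j ∈ A i} →
      z = F * (List.ofFn fun i => Sergeev.sigma R l (A i)).prod * e →
      z ∈ Sergeev.CCX R l d →
      Sergeev.IsMaxDegree F {j | ∃ i, j ∈ A i} →
      z = 0 ∨
        ∃ (T : Finset (Fin m)) (w : Fin m → Sergeev.Gr R l d) (P : Sergeev.Gr R l d),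
          Even T.card ∧
          (∀ i ∈ T, Sergeev.IsOddSkewCycle (A i) (w i)) ∧
          (∀ i ∉ T, Sergeev.IsCXCycle (A i) (w i)) ∧
          P ∈ Algebra.adjoin R {y | ∃ j : Fin d, (∀ i, j ∉ A i) ∧ y = Sergeev.x R l j ^ 2} ∧
          z = P * (List.ofFn w).prod ∧
          ∀ ν : Fin d → ℕ, (∀ i, ∀ j ∈ A i, ν j = 0) →
            (∃ g ∈ Sergeev.polyOn R l {j | ∃ i, j ∈ A i}, F = Sergeev.xMon R l ν * g) →
            ∃ θ : R, P = θ • Sergeev.xMon R l ν) ∧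
    (∀ (f : (Fin (List.ofFn A).flatten.length → ZMod 2) → Sergeev.Gr R l d)
        (z : Sergeev.Gr R l d),
      (∀ α, f α ∈ Sergeev.polyOn R l (Set.univ : Set (Fin d))) →
      z = ∑ α ∈ Sergeev.evenVec (List.ofFn A).flatten.length,
        f α * (List.ofFn fun i => Sergeev.sigma R l (A i)).prod *
          Sergeev.cMon R l (List.ofFn A).flatten α →
      z ∈ Sergeev.CCX R l d →
      (∀ α ∈ Sergeev.evenVec (List.ofFn A).flatten.length, f α ≠ 0 →
        ∀ i, ¬ Sergeev.IsMaxDegree (f α) {j | j ∈ A i}) →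
      z ∈ Submodule.span R (Sergeev.cxProducts R l d)) := by
  have hne : ∀ i, A i ≠ [] := fun i => (hA i).1
  have hnd : ∀ i, (A i).Nodup := fun i => (hA i).2
  have : NeZero l := ⟨by omega⟩
  have hσ : (List.ofFn fun i => Sergeev.sigma R l (A i)).prod =
      Sergeev.s R l (Sergeev.blockPerm A) := Sergeev.prod_ofFn_s R l _
  have hcomm : ∀ {z}, z ∈ Sergeev.CCX R l d → ∀ j, Sergeev.c R l j * z = z * Sergeev.c R l j :=
    fun hz j => Subalgebra.mem_centralizer_iff R |>.1 hz.2 _ ⟨j, rfl⟩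
  constructor
  · intro F e z hF he hz hzc hmax
    rw [hσ] at hz
    refine (Sergeev.eq_mul_prod_of_isMaxDegree h2 hl hne hnd hdisj hF he hz hzc.1.1 (hcomm hzc)
      hmax).imp id ?_
    rintro ⟨hp, P, hP, hzP, hν⟩
    -- The odd skew cycles sit on the blocks whose forced parity is 1; modulo 2 their number is the
    -- sum of the parities, which is 0.
    refine ⟨Finset.univ.filter fun i => Sergeev.topParity l A i = 1,
      fun i => Sergeev.signedCycle R l (A i) (l - 1) (Sergeev.topParity l A i), P, ?_, ?_, ?_,
      hP, hzP, hν⟩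
    · rw [← ZMod.natCast_eq_zero_iff_even, Finset.card_filter, ← hp, Nat.cast_sum]
      refine Finset.sum_congr rfl fun i _ => ?_
      rcases Sergeev.zmod_two_cases (Sergeev.topParity l A i) with h | h <;> simp [h]
    · intro i hi
      have h1 := (Finset.mem_filter.1 hi).2
      simp only [h1]
      exact Sergeev.isOddSkewCycle_signedCycle (hnd i) (hne i) hl h1
    · intro i hi
      have h0 : Sergeev.topParity l A i = 0 :=
        (Sergeev.zmod_two_cases _).resolve_right fun h => hi (by simp [h])
      simp only [h0]
      exact ⟨l - 1, (ZMod.natCast_eq_zero_iff_even).1 h0,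
        (Sergeev.cxElem_eq_signedCycle _ _ _ _).symm⟩
  · intro f z hf hz hzc hmax
    simp only [hσ] at hz
    exact (Sergeev.balanced_of_forall_not_isMaxDegree h2 hne hnd hdisj
      (Sergeev.nodup_flatten_ofFn hnd hdisj) (fun j => by simp [List.mem_flatten, List.mem_ofFn])
      hf hz hzc.1.2 (hcomm hzc) hmax).mem_span h2 hl hne hnd hdisj
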